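/- **Setting.** Let $d,n,J,k\ge 1$ be integers, $\pi_1\in(0,1)$, $\pi_0=1-\pi_1$, and let $P_0,P_1$ be probability measures on $\mathbb R^d$ (with the Euclidean norm). Let $P$ be the law of $(X,Y)$ with $Y\sim\mathrm{Ber}(\pi_1)$ and $X\mid Y=l\sim P_l$, and let $Q$ be the balanced law, with $Y\sim\mathrm{Ber}(1/2)$ and $X\mid Y=l\sim P_l$. Let $\ell:\{0,1\}\times\mathbb R\to\mathbb R$ be a loss and $\mathcal F$ a class of functions $\mathbb R^d\to\mathbb R$ such that every $(x,y)\mapsto\ell(y,f(x))$, $f\in\mathcal F$, is measurable and the loss class is pointwise separable (there is a countable $\mathcal F_0\subseteq\mathcal F$ such that for each $f\in\mathcal F$ there are $f_m\in\mathcal F_0$ with $\ell(y,f_m(x))\to\ell(y,f(x))$ for all $x,y$). Let $b,L,D>0$ and $\delta\in(0,1)$, and assume * $\sup_{f\in\mathcal F}|\ell(Y,f(X))|\le b$ and $\|X\|\le D$, $P$-almost surely; * $|\ell(1,f(x))-\ell(1,f(x'))|\le L\|x-x'\|$ for all $f\in\mathcal F$ and all $x,x'$ in the convex hull of $\operatorname{supp}P_1$.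 For a law $\nu$ of $(X,Y)$ put $\mathrm{Rad}_m(\nu)=\mathbb E\sup_{f\in\mathcal F}\big|\frac1m\sum_{i=1}^m\varepsilon_i\,\ell(Y_i,f(X_i))\big|$, where $(X_i,Y_i)$ are i.i.d. from $\nu$ and $\varepsilon_i$ are independent uniform signs; for a law $\nu$ on $\mathbb R^d$, $\mathrm{Rad}_m(\nu)$ means $\mathrm{Rad}_m(\nu\otimes\Delta_{Y=1})$. Let $(X_i,Y_i)_{i\le n}$ be i.i.d. from $P$, and let $n_1$, $n_0$ be the numbers of indices with $Y_i=1$, $Y_i=0$. When $n_1>k$, let $\hat P^{\mathrm{SMOTE}}$ be the (data-dependent) law of the point obtained by choosing $X_j$ uniformly among the $n_1$ minority points, choosing uniformly one of its $k$ nearest neighbours among the other minority points (ties broken by index), and taking a uniformly distributed point on the segment joining the two. Write $$H_1(c)=\Big(\tfrac{3k+4d\log(32n_1/\delta)}{c\,n_1}\Big)^{1/d},\qquad H_2=6D\big(\tfrac k{n_1}\big)^{1/d}+2D\sqrt{2\log(2/\delta)}\;\tfrac{k5^d+1}{\sqrt{n_1}} .$$ **(1)** Condition on labels $(Y_i)_{i\le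 n}$ with $n_1>k$. Each of the following two bounds holds with conditional probability at least $1-\delta$ for $H=H_2$, and also for $H=\min\{H_1(c),H_2\}$ whenever $c>0$ satisfies $P_1(\{x':\|x'-x\|\le r\})\ge\min\{cr^d,1\}$ for all $x\in\operatorname{supp}P_1$ and $r>0$: $$\sup_{f\in\mathcal F}\Big|\mathbb E_{\hat P^{\mathrm{SMOTE}}}[\ell(1,f(X))]-\mathbb E_{P_1}[\ell(1,f(X))]\Big|\le 2\,\mathrm{Rad}_{n_1}(P_1)+LH+2\sqrt{2\log(2/\delta)}\,\frac b{\sqrt{n_1}},$$ $$\mathrm{Rad}_J(\hat P^{\mathrm{SMOTE}})\le 4\Big(\sqrt{\tfrac{n_1}J\log(2n_1)}+\tfrac{n_1}J\log(2n_1)\Big)\mathrm{Rad}_{n_1}(P_1)+LH+2\sqrt{2\log(1/\delta)}\,\frac b{\sqrt{n_1}} .$$ **(2)** There is a universal constant $C>0$ (independent of all of the above) with the following property. Given the data with $n_1>k$, let $\tilde X_1,\dots,\tilde X_J$ be conditionally i.i.d. from $\hat P^{\mathrm{SMOTE}}$, and let $$\hat f\in\arg\min_{f\in\mathcal F}\frac1{n+J}\Big\{\sum_{i=1}^n\ell(Y_i,f(X_i))+\sum_{j=1}^J\ell(1,f(\tilde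 X_j))\Big\}.$$ Let $f^\star\in\mathcal F$ be arbitrary (for example $f^\star(x)=Q(Y=1\mid X=x)$, if it belongs to $\mathcal F$), and put $$R=LD\Big(6\big(\tfrac k{n_1}\big)^{1/d}+\sqrt{\log(2/\delta)}\,\tfrac{k5^d+1}{\sqrt{n_1}}\Big)+b\Big|\tfrac{n\pi_0}{n+J}-\tfrac12\Big|+\big(14\sqrt{2\log(4/\delta)}+36\big)\tfrac b{\sqrt{n+J}}+b\sqrt{\tfrac{\log(1/\delta)}{n_1}} .$$ Then, outside an event of probability at most $\delta$, whenever $n_1>k$, $$\mathbb E_Q\big[\ell(Y,\hat f(X))-\ell(Y,f^\star(X))\big]\le C\Big\{\mathrm{Rad}_{n+J}(Q)+\Big(1+\sqrt{\tfrac{n_1}J\log(2n_1)}\Big)^2\mathrm{Rad}_{n_1}(P_1)+R\Big\},$$ and, if moreover $n_1<n_0$, $$\mathbb E_Q\big[\ell(Y,\hat f(X))-\ell(Y,f^\star(X))\big]\le C\Big\{\Big(1+\sqrt{\tfrac{n_1}{n_0-n_1}\log(2n_1)}\Big)^2\mathrm{Rad}_{2n_1}(Q)+R\Big\}.$$ 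-/

import Mathlib

open MeasureTheory Set Filter Topology

noncomputable section

/-- The covariate space `ℝ^d` with the Euclidean norm. -/
abbrev Cov (d : ℕ) : Type := EuclideanSpace ℝ (Fin d)

/-- A labelled observation `(X, Y)`; the label `true` is the minority class `Y = 1`. -/
abbrev Obs (d : ℕ) : Type := Cov d × Bool

/-- The law of `(X, Y)` when `Y ∼ Ber(p)`, `X ∣ Y = 0 ∼ P₀` and `X ∣ Y = 1 ∼ P₁`. -/
def labelMixture {d : ℕ} (p : ℝ) (P₀ P₁ : Measure (Cov d)) : Measure (Obs d) :=
  ENNReal.ofReal (1 - p) • P₀.map (fun x => (x, false)) +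
    ENNReal.ofReal p • P₁.map (fun x => (x, true))

/-- The balanced target distribution `Q`. -/
def balanced {d : ℕ} (P₀ P₁ : Measure (Cov d)) : Measure (Obs d) :=
  labelMixture (1 / 2) P₀ P₁

/-- The product `ν ⊗ Δ_{Y = 1}` of a covariate law with the point mass at label `1`. -/
def withLabelOne {d : ℕ} (ν : Measure (Cov d)) : Measure (Obs d) :=
  ν.map (fun x => (x, true))

/-- The real sign of a boolean. -/
def sgn (s : Bool) : ℝ := if s then 1 else -1

/-- The Rademacher complexity
`E sup_{f ∈ F} |(1/n) ∑ᵢ εᵢ ℓ(Yᵢ, f(Xᵢ))|` with `(Xᵢ, Yᵢ)` i.i.d. from `ν` and `εᵢ` i.i.d.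
uniform signs, the latter averaged explicitly over the `2 ^ n` sign patterns. -/
def radComplexity {d : ℕ} (ℓ : Bool → ℝ → ℝ) (F : Set (Cov d → ℝ)) (n : ℕ)
    (ν : Measure (Obs d)) : ℝ :=
  (1 / 2 ^ n : ℝ) * ∑ ε : Fin n → Bool,
    (∫⁻ z : Fin n → Obs d,
      ⨆ f ∈ F, ENNReal.ofReal |(1 / n : ℝ) * ∑ i, sgn (ε i) * ℓ (z i).2 (f (z i).1)|
      ∂(Measure.pi fun _ => ν)).toReal

/-- The loss class is pointwise separable (pointwise measurable): some countable subclass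
approximates every member, in the sense of pointwise convergence of losses. -/
def PointwiseSeparable {d : ℕ} (ℓ : Bool → ℝ → ℝ) (F : Set (Cov d → ℝ)) : Prop :=
  ∃ F₀ ⊆ F, F₀.Countable ∧ ∀ f ∈ F, ∃ u : ℕ → Cov d → ℝ, (∀ m, u m ∈ F₀) ∧
    ∀ (x : Cov d) (y : Bool), Tendsto (fun m => ℓ y (u m x)) atTop (𝓝 (ℓ y (f x)))

/-- The indices `I₁` of the minority-class observations. -/
def minority {n : ℕ} (y : Fin n → Bool) : Finset (Fin n) :=
  Finset.univ.filter fun i => y i = true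

/-- `n₁`, the number of minority-class observations. -/
def numMin {n : ℕ} (y : Fin n → Bool) : ℕ := (minority y).card

/-- `n₀`, the number of majority-class observations. -/
def numMaj {n : ℕ} (y : Fin n → Bool) : ℕ := (Finset.univ.filter fun i => y i = false).card

/-- The labels of a data set. -/
def labels {d n : ℕ} (z : Fin n → Obs d) : Fin n → Bool := fun i => (z i).2

/-- Observation `i` precedes observation `l` in the order of distance to observation `j`;
ties are broken by the index. -/
def Precedes {d n : ℕ} (z : Fin n → Obs d) (j i l : Fin n) : Prop :=
  dist (z i).1 (z j).1 < dist (z l).1 (z j).1 ∨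
    (dist (z i).1 (z j).1 = dist (z l).1 (z j).1 ∧ i < l)

open Classical in
/-- The (indices of the) `k` nearest neighbours of observation `j` among the other
minority-class observations: those preceded by fewer than `k` others. -/
def knn {d n : ℕ} (k : ℕ) (z : Fin n → Obs d) (j : Fin n) : Finset (Fin n) :=
  ((minority (labels z)).erase j).filter fun l =>
    (((minority (labels z)).erase j).filter fun i => Precedes z j i l).card < k

/-- The law of one SMOTE sample given the data: pick a minority-class point uniformly, pick one of
its `k` nearest minority-class neighbours uniformly, and pick a uniform point of the segment that
joins the two. (It is a probability measure when `0 < k < n₁`.) -/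
def smote {d n : ℕ} (k : ℕ) (z : Fin n → Obs d) : Measure (Cov d) :=
  (numMin (labels z) : ENNReal)⁻¹ • ∑ j ∈ minority (labels z),
    (k : ENNReal)⁻¹ • ∑ l ∈ knn k z j,
      (volume.restrict (Icc (0 : ℝ) 1)).map fun t => (z j).1 + t • ((z l).1 - (z j).1)

/-- Whenever `k < n₁`, the vector `S` is, conditionally on the data `Z`, an i.i.d. sample of size
`J` from the SMOTE distribution built on `Z` (regular conditional distribution). -/
def IsSmoteSample {d n J : ℕ} {Ω : Type*} [MeasurableSpace Ω] (k : ℕ) (μ : Measure Ω)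
    (Z : Ω → Fin n → Obs d) (S : Ω → Fin J → Cov d) : Prop :=
  ∀ A : Set ((Fin n → Obs d) × (Fin J → Cov d)), MeasurableSet A →
    μ {ω | k < numMin (labels (Z ω)) ∧ (Z ω, S ω) ∈ A} =
      ∫⁻ ω in {ω | k < numMin (labels (Z ω))},
        (Measure.pi fun _ : Fin J => smote k (Z ω)) {s | (Z ω, s) ∈ A} ∂μ

/-- The empirical risk on the data `z` augmented by the synthetic minority points `s`. -/
def augRisk {d n J : ℕ} (ℓ : Bool → ℝ → ℝ) (z : Fin n → Obs d) (s : Fin J → Cov d)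
    (f : Cov d → ℝ) : ℝ :=
  1 / ((n : ℝ) + J) * (∑ i, ℓ (z i).2 (f (z i).1) + ∑ j, ℓ true (f (s j)))

/-- `f` minimises the augmented empirical risk over `F`. -/
def IsRebalancedERM {d n J : ℕ} (ℓ : Bool → ℝ → ℝ) (F : Set (Cov d → ℝ)) (z : Fin n → Obs d)
    (s : Fin J → Cov d) (f : Cov d → ℝ) : Prop :=
  f ∈ F ∧ ∀ g ∈ F, augRisk ℓ z s f ≤ augRisk ℓ z s g

/-- `E_ν[ℓ(Y, f(X)) - ℓ(Y, g(X))]`. -/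
def excessRisk {d : ℕ} (ℓ : Bool → ℝ → ℝ) (ν : Measure (Obs d)) (f g : Cov d → ℝ) : ℝ :=
  ∫ z, (ℓ z.2 (f z.1) - ℓ z.2 (g z.1)) ∂ν

/-- The fluctuation term `t_N(δ) = (14 √(2 log (4/δ)) + 36) b / √N`. -/
def fluctuation (b δ : ℝ) (N : ℕ) : ℝ :=
  (14 * √(2 * Real.log (4 / δ)) + 36) * (b / √(N : ℝ))

/-- `H₁ = ((3k + 4d log(32m/δ)) / (c m))^{1/d}`. -/
def smoteH1 (d k : ℕ) (c δ : ℝ) (m : ℕ) : ℝ :=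
  ((3 * k + 4 * d * Real.log (32 * m / δ)) / (c * m)) ^ (1 / d : ℝ)

/-- `H₂ = 6D (k/m)^{1/d} + 2D √(2 log(2/δ)) (k 5^d + 1)/√m`. -/
def smoteH2 (d k : ℕ) (D δ : ℝ) (m : ℕ) : ℝ :=
  6 * D * ((k : ℝ) / m) ^ (1 / d : ℝ) +
    2 * D * √(2 * Real.log (2 / δ)) * ((k * 5 ^ d + 1) / √(m : ℝ))

/-- The minority law gives mass at least `min {c r^d, 1}` to every closed ball of radius `r > 0`
centred in its support. -/
def BallLowerBound {d : ℕ} (c : ℝ) (P₁ : Measure (Cov d)) : Prop :=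
  ∀ x ∈ P₁.support, ∀ r : ℝ, 0 < r →
    ENNReal.ofReal (min (c * r ^ d) 1) ≤ P₁ (Metric.closedBall x r)

end

/-! Given the labels, the covariates are independent and the minority ones have law `P₁`
(`pi_labelMixture_apply`). Every random quantity below is then a supremum or an average over
independent coordinates with bounded differences: symmetrization (`lintegral_supE_sum_sub_le`)
bounds its mean by a Rademacher average and McDiarmid's inequality its fluctuation. Pointwise
separability reduces suprema over `F` to a countable `F₀`, and the losses are clamped so that the
almost sure bounds hold at every point, as bounded differences require.

The SMOTE law is compared with the uniform law on the minority sample through the coupling of a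
synthetic point with its base point (`smoteCoupling`). The two are no farther apart than the
nearest-neighbour radius of the base point, and the segment stays in the convex hull of the support,
so replacing one by the other costs at most `L` times the mean radius, for means as well as for
Rademacher complexities. Balls of half the nearest-neighbour radii cover no point more than `k`
times; comparing volumes and applying the power-mean inequality bounds the mean radius by
`4D(k/n₁)^{1/d}` for every sample in the ball (`meanRadius_le`). This is below `H₂`. The bound by
`H₁` is a Chernoff estimate with a union bound over base points.

What remains of the SMOTE bias is the empirical process of the minority sample. What remains of the
SMOTE complexity is that of a sample of size `J` drawn with replacement from `m = n₁` fixed points.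
An extra sign attached to each base point makes it a Rademacher sum with weights the signed
multiplicities of the draws; contraction pulls out their maximum, whose mean is of order `√((J/m)
log 2m) + log 2m` by exponential moments (`sum_rad_comp_le`).

For the excess risk, the uniform distance between the augmented risk and the `Q`-risk splits into
the deviation of the data given the labels, the deviation of the synthetic points given the data,
`J` times the SMOTE bias, and the label imbalance `n₀/(n+J) - 1/2` times a difference of class
risks. A minimiser loses at most twice that distance. For the last bound, either `J` is comparable
with `n₀ - n₁` or larger, and the resampling factor is controlled, or `J` is so small that the
imbalance term dominates a trivial bound for the synthetic part. -/

open scoped ENNReal NNReal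

/-! ### Rademacher averages of families of vectors. -/

section Rademacher

variable {ι κ κ' : Type*}

/-- The supremum `sup_f |v f|`, with values in `[0, ∞]`. -/
noncomputable def supE (v : ι → ℝ) : ℝ≥0∞ := ⨆ i, ‖v i‖ₑ

lemma le_supE (v : ι → ℝ) (i : ι) : ‖v i‖ₑ ≤ supE v := le_iSup (fun i => ‖v i‖ₑ) i

lemma supE_le {v : ι → ℝ} {c : ℝ≥0∞} (h : ∀ i, ‖v i‖ₑ ≤ c) : supE v ≤ c := iSup_le h

@[simp] lemma supE_zero : supE (0 : ι → ℝ) = 0 := by simp [supE]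

lemma supE_add_le (u v : ι → ℝ) : supE (u + v) ≤ supE u + supE v :=
  supE_le fun i => (enorm_add_le _ _).trans (add_le_add (le_supE u i) (le_supE v i))

lemma supE_smul (c : ℝ) (v : ι → ℝ) : supE (c • v) = ‖c‖ₑ * supE v := by
  simp [supE, ENNReal.mul_iSup, enorm_mul]

lemma supE_sum_le (s : Finset κ) (v : κ → ι → ℝ) : supE (∑ i ∈ s, v i) ≤ ∑ i ∈ s, supE (v i) := by
  classical
  induction s using Finset.induction_on with
  | empty => simp
  | insert a s ha ih =>
    rw [Finset.sum_insert ha, Finset.sum_insert ha]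
    exact (supE_add_le _ _).trans (add_le_add le_rfl ih)

lemma supE_le_ofReal {v : ι → ℝ} {B : ℝ} (h : ∀ i, |v i| ≤ B) : supE v ≤ ENNReal.ofReal B :=
  supE_le fun i => by
    rw [Real.enorm_eq_ofReal_abs]; exact ENNReal.ofReal_le_ofReal (h i)

@[simp] lemma enorm_sgn (s : Bool) : ‖sgn s‖ₑ = 1 := by
  cases s <;> simp [sgn]

lemma sgn_mul_sgn (s t : Bool) : sgn (s == t) = sgn s * sgn t := by
  cases s <;> cases t <;> simp [sgn]

section Fintype

variable [Fintype κ] [DecidableEq κ] [Fintype κ'] [DecidableEq κ']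

/-- The average of `sup_f |∑ᵢ εᵢ vᵢ f|` over all sign patterns `ε`. -/
noncomputable def rad (v : κ → ι → ℝ) : ℝ≥0∞ :=
  ((2 : ℝ≥0∞) ^ Fintype.card κ)⁻¹ * ∑ ε : κ → Bool, supE (∑ i, sgn (ε i) • v i)

lemma two_pow_inv_mul_card (c : ℝ≥0∞) :
    ((2 : ℝ≥0∞) ^ Fintype.card κ)⁻¹ * ∑ _ε : κ → Bool, c = c := by
  rw [Finset.sum_const, Finset.card_univ, Fintype.card_fun, Fintype.card_bool, nsmul_eq_mul,
    ← mul_assoc]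
  push_cast
  rw [ENNReal.inv_mul_cancel (by positivity) (by simp), one_mul]

lemma rad_add_le (u v : κ → ι → ℝ) : rad (u + v) ≤ rad u + rad v := by
  simp only [rad]
  rw [← mul_add, ← Finset.sum_add_distrib]
  gcongr with ε
  have : ∑ i, sgn (ε i) • (u + v) i = ∑ i, sgn (ε i) • u i + ∑ i, sgn (ε i) • v i := by
    simp [Finset.sum_add_distrib, smul_add]
  rw [this]
  exact supE_add_le _ _

lemma rad_zero : rad (0 : κ → ι → ℝ) = 0 := by simp [rad]

lemma rad_sum_le {τ : Type*} (s : Finset τ) (v : τ → κ → ι → ℝ) :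
    rad (∑ i ∈ s, v i) ≤ ∑ i ∈ s, rad (v i) := by
  classical
  induction s using Finset.induction_on with
  | empty => simp [rad_zero]
  | insert a s ha ih =>
    rw [Finset.sum_insert ha, Finset.sum_insert ha]
    exact (rad_add_le _ _).trans (add_le_add le_rfl ih)

lemma rad_smul (c : ℝ) (v : κ → ι → ℝ) : rad (c • v) = ‖c‖ₑ * rad v := by
  simp only [rad]
  rw [mul_left_comm]
  congr 1
  rw [Finset.mul_sum]
  refine Finset.sum_congr rfl fun ε _ => ?_
  rw [← supE_smul, Finset.smul_sum]
  exact congrArg supE (Finset.sum_congr rfl fun i _ => smul_comm (sgn (ε i)) c (v i))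

lemma rad_le_sum (v : κ → ι → ℝ) : rad v ≤ ∑ i, supE (v i) := by
  simp only [rad]
  calc _ ≤ ((2 : ℝ≥0∞) ^ Fintype.card κ)⁻¹ * ∑ _ε : κ → Bool, ∑ i, supE (v i) := by
        gcongr with ε
        refine (supE_sum_le _ _).trans (Finset.sum_le_sum fun i _ => ?_)
        rw [supE_smul, enorm_sgn, one_mul]
    _ = _ := two_pow_inv_mul_card _

lemma rad_le_add_sum (u v : κ → ι → ℝ) : rad u ≤ rad v + ∑ i, supE (u i - v i) := by
  have : u = v + (u - v) := by simp
  calc rad u = rad (v + (u - v)) := by rw [← this]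
    _ ≤ rad v + rad (u - v) := rad_add_le _ _
    _ ≤ _ := by gcongr; exact rad_le_sum _

/-- Multiplication by a fixed sign pattern permutes the sign patterns. -/
lemma rad_sgn_smul (s : κ → Bool) (v : κ → ι → ℝ) : rad (fun i => sgn (s i) • v i) = rad v := by
  simp only [rad]
  congr 1
  let e : (κ → Bool) ≃ (κ → Bool) :=
    { toFun := fun ε i => ε i == s i
      invFun := fun ε i => ε i == s i
      left_inv := fun ε => by ext i; cases h : ε i <;> cases h' : s i <;> simp [h, h']
      right_inv := fun ε => by ext i; cases h : ε i <;> cases h' : s i <;> simp [h, h'] }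
  refine Fintype.sum_equiv e _ _ fun ε => ?_
  simp [e, sgn_mul_sgn, smul_smul]

lemma rad_comp_equiv (e : κ' ≃ κ) (v : κ → ι → ℝ) : rad (v ∘ e) = rad v := by
  simp only [rad, Fintype.card_congr e]
  congr 1
  refine Fintype.sum_equiv (e.arrowCongr (Equiv.refl Bool)) _ _ fun ε => ?_
  congr 1
  refine Fintype.sum_equiv e _ _ fun i => ?_
  simp [Equiv.arrowCongr]

/-- The contraction principle for Rademacher averages. -/
lemma rad_contraction (w : κ → ℝ) (hw : ∀ i, |w i| ≤ 1) (v : κ → ι → ℝ) :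
    rad (fun i => w i • v i) ≤ rad v := by
  have key : ∀ S : Finset κ, rad (fun i => if i ∈ S then w i • v i else v i) ≤ rad v := by
    intro S
    induction S using Finset.induction_on with
    | empty => simp
    | insert a S ha ih =>
      set u : κ → ι → ℝ := fun i => if i ∈ S then w i • v i else v i with hu
      refine le_trans ?_ ih
      -- As `|w a| ≤ 1`, scaling coordinate `a` by `w a` gives a convex combination of `u` and of
      -- `u` with that coordinate negated, and sign changes leave `rad` invariant.
      have h1 : (fun i => if i ∈ insert a S then w i • v i else v i) =
          ((1 + w a) / 2) • u + ((1 - w a) / 2) • fun i => sgn (decide (i ≠ a)) • u i := by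
        ext i f
        by_cases hi : i = a
        · subst hi
          simp [hu, ha, sgn]
          ring
        · simp [hu, hi, sgn]
          split_ifs <;> simp <;> ring
      rw [h1]
      refine (rad_add_le _ _).trans ?_
      rw [rad_smul, rad_smul, rad_sgn_smul, ← add_mul]
      have h2 := abs_le.1 (hw a)
      have : ‖(1 + w a) / 2‖ₑ + ‖(1 - w a) / 2‖ₑ = 1 := by
        rw [Real.enorm_eq_ofReal (by linarith), Real.enorm_eq_ofReal (by linarith),
          ← ENNReal.ofReal_add (by linarith) (by linarith)]
        ring_nf; simp
      rw [this, one_mul]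
  simpa using key Finset.univ

lemma rad_indicator_le (s : Set κ) [DecidablePred (· ∈ s)] (v : κ → ι → ℝ) :
    rad (fun i => if i ∈ s then v i else 0) ≤ rad v := by
  convert rad_contraction (fun i => if i ∈ s then 1 else 0) (fun i => by split_ifs <;> simp) v
    using 2
  ext i f
  split_ifs <;> simp

lemma rad_ite_le (s : κ → Bool) (v : κ → ι → ℝ) :
    rad (fun i f => if s i then v i f else 0) ≤ rad v := by
  convert rad_contraction (fun i => if s i then 1 else 0) (fun i => by split_ifs <;> simp) v
    using 2
  ext i f
  split_ifs <;> simp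

lemma rad_le_ite_add_ite (s : κ → Bool) (v : κ → ι → ℝ) :
    rad v ≤ rad (fun i f => if s i then v i f else 0) +
      rad (fun i f => if !(s i) then v i f else 0) := by
  refine le_trans (le_of_eq (congrArg rad ?_)) (rad_add_le _ _)
  ext i f
  by_cases h : s i <;> simp [h]

/-- Coefficients of absolute value at most `c` enlarge a Rademacher average by at most `c`. -/
lemma rad_mul_le (w : κ → ℝ) {c : ℝ} (hw : ∀ i, |w i| ≤ c) (v : κ → ι → ℝ) :
    rad (fun i => w i • v i) ≤ ENNReal.ofReal c * rad v := by
  rcases isEmpty_or_nonempty κ with h | ⟨⟨i₀⟩⟩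
  · simp [rad]
  have hc : 0 ≤ c := (abs_nonneg _).trans (hw i₀)
  rcases hc.eq_or_lt with rfl | hc
  · have : (fun i => w i • v i) = 0 := by
      ext i f
      simp [abs_nonpos_iff.1 (hw i)]
    rw [this, rad_zero]; simp
  · have : (fun i => w i • v i) = c • fun i => (w i / c) • v i := by
      ext i f
      simp; field_simp
    rw [this, rad_smul, Real.enorm_eq_ofReal hc.le]
    gcongr
    refine rad_contraction _ (fun i => ?_) v
    rw [abs_div, abs_of_pos hc]
    exact (div_le_one hc).2 (hw i)

lemma rad_sumElim_zero (v : κ → ι → ℝ) : rad (Sum.elim v (0 : κ' → ι → ℝ)) = rad v := by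
  simp only [rad]
  have h : ∑ ε : κ ⊕ κ' → Bool, supE (∑ i, sgn (ε i) • Sum.elim v (0 : κ' → ι → ℝ) i) =
      ∑ ε : κ → Bool, ∑ _ε' : κ' → Bool, supE (∑ i, sgn (ε i) • v i) := by
    rw [← Fintype.sum_prod_type']
    refine Fintype.sum_equiv (Equiv.sumArrowEquivProdArrow κ κ' Bool) _ _ fun ε => ?_
    simp [Equiv.sumArrowEquivProdArrow]
  rw [h]
  simp only [Finset.sum_const, Finset.card_univ, Fintype.card_fun, Fintype.card_bool,
    Fintype.card_sum, nsmul_eq_mul, pow_add]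
  rw [← Finset.mul_sum, ← mul_assoc]
  congr 1
  push_cast
  rw [ENNReal.mul_inv (by simp) (by simp), mul_assoc,
    ENNReal.inv_mul_cancel (by positivity) (by simp), mul_one]

/-- The Rademacher average of a subfamily, seen as a family that vanishes elsewhere. -/
lemma rad_indicator_range (e : κ' → κ) (he : Function.Injective e) (v : κ → ι → ℝ)
    [DecidablePred (· ∈ range e)] :
    rad (fun i => if i ∈ range e then v i else 0) = rad (v ∘ e) := by
  let E : κ' ⊕ ((range e)ᶜ : Set κ) ≃ κ :=
    ((Equiv.ofInjective e he).sumCongr (Equiv.refl _)).trans (Equiv.Set.sumCompl (range e))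
  classical
  rw [← rad_comp_equiv E, ← rad_sumElim_zero (κ' := ((range e)ᶜ : Set κ)) (v ∘ e)]
  congr 1
  ext i f
  rcases i with i | ⟨i, hi⟩
  · simp [E]
  · have : i ∉ range e := hi
    simp only [mem_range, not_exists] at this
    simp [E, this]

lemma rad_comp_injective_le (e : κ' → κ) (he : Function.Injective e) (v : κ → ι → ℝ) :
    rad (v ∘ e) ≤ rad v := by
  classical
  rw [← rad_indicator_range e he]
  exact rad_indicator_le _ v

/-- The family is the sum of its blocks, each extended by zero, and vanishing coordinates do not
affect `rad`. -/
lemma rad_prod_le {τ : Type*} [Fintype τ] [DecidableEq τ] (v : τ × κ → ι → ℝ) :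
    rad v ≤ ∑ t, rad fun i => v (t, i) := by
  classical
  have h : v = ∑ t, fun i => if i ∈ range (fun k : κ => (t, k)) then v i else 0 := by
    ext ⟨t, k⟩ f
    simp only [Finset.sum_apply]
    rw [Finset.sum_eq_single t]
    · simp
    · intro t' _ ht'
      rw [if_neg (by simpa using fun h => absurd h ht')]; rfl
    · simp
  calc rad v = rad (∑ t, fun i => if i ∈ range (fun k : κ => (t, k)) then v i else 0) :=
        congrArg rad h
    _ ≤ ∑ t, rad fun i => if i ∈ range (fun k : κ => (t, k)) then v i else 0 := rad_sum_le _ _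
    _ = _ := Finset.sum_congr rfl fun t _ =>
        rad_indicator_range (fun k : κ => (t, k)) (fun a b h => by simpa using h) v

end Fintype

section Measurable

variable {α : Type*} [MeasurableSpace α] [Countable ι]

lemma measurable_supE {v : α → ι → ℝ} (hv : ∀ f, Measurable fun x => v x f) :
    Measurable fun x => supE (v x) :=
  Measurable.iSup fun f => (hv f).enorm

lemma measurable_rad [Fintype κ] [DecidableEq κ] {v : α → κ → ι → ℝ}
    (hv : ∀ i f, Measurable fun x => v x i f) : Measurable fun x => rad (v x) := by
  unfold rad
  refine Measurable.const_mul (Finset.measurable_sum _ fun ε _ => measurable_supE fun f => ?_) _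
  simp only [Finset.sum_apply, Pi.smul_apply, smul_eq_mul]
  exact Finset.measurable_sum _ fun i _ => (hv i f).const_mul _

end Measurable

end Rademacher

/-! ### McDiarmid's and Markov's inequalities. -/

section BoundedDifferences

/-- The coordinates of `x` are exchanged for those of `y` one at a time. In particular a function
with bounded differences is bounded, which settles all integrability questions below. -/
lemma abs_sub_le_sum_of_update {𝒳 : Type*} {n : ℕ} {G : (Fin n → 𝒳) → ℝ} {c : Fin n → ℝ}
    (h : ∀ x i a, |G x - G (Function.update x i a)| ≤ c i) (x y : Fin n → 𝒳) :
    |G x - G y| ≤ ∑ i, c i := by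
  classical
  have key : ∀ S : Finset (Fin n), |G x - G (S.piecewise y x)| ≤ ∑ i ∈ S, c i := by
    intro S
    induction S using Finset.induction_on with
    | empty => simp
    | insert a S ha ih =>
      rw [Finset.sum_insert ha, Finset.piecewise_insert, add_comm]
      exact (abs_sub_le _ (G (S.piecewise y x)) _).trans (add_le_add ih (h _ _ _))
  simpa using key Finset.univ

variable {𝒳 : Type*} [MeasurableSpace 𝒳]

/-- The exponential moment bound for functions with bounded differences. -/
lemma integral_exp_le_of_update : ∀ {n : ℕ} (ν : Fin n → Measure 𝒳)
    [∀ i, IsProbabilityMeasure (ν i)] (G : (Fin n → 𝒳) → ℝ) (c : Fin n → ℝ), Measurable G →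
    (∀ x i a, |G x - G (Function.update x i a)| ≤ c i) → ∀ t : ℝ,
    ∫ x, Real.exp (t * (G x - ∫ y, G y ∂Measure.pi ν)) ∂Measure.pi ν ≤
      Real.exp (t ^ 2 * (∑ i, c i ^ 2) / 8) := by
  intro n
  induction n with
  | zero =>
    intro ν _ G c hG h t
    have : ∀ x, G x = G default := fun x => congrArg G (Subsingleton.elim _ _)
    simp [this]
  | succ n ih =>
    intro ν _ G c hG h t
    have : Nonempty 𝒳 := (inferInstance : (ae (ν 0)).NeBot).nonempty
    obtain ⟨x₀⟩ := this
    have hbdd : ∃ K, ∀ x, |G x| ≤ K := by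
      refine ⟨|G fun _ => x₀| + ∑ i, c i, fun x => ?_⟩
      have := abs_sub_le_sum_of_update h x (fun _ => x₀)
      have := abs_sub_abs_le_abs_sub (G x) (G fun _ => x₀)
      linarith
    obtain ⟨K, hK⟩ := hbdd
    set ν' : Fin n → Measure 𝒳 := fun i => ν i.succ
    have hmp := (measurePreserving_piFinSuccAbove ν 0).symm
    have hcons : Measurable fun p : 𝒳 × (Fin n → 𝒳) => (Fin.cons p.1 p.2 : Fin (n + 1) → 𝒳) := by
      refine measurable_pi_iff.2 fun i => ?_
      refine Fin.cases ?_ (fun j => ?_) i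
      · simpa using measurable_fst
      · simpa using! (measurable_pi_apply j).comp measurable_snd
    have hint : ∀ φ : (Fin (n + 1) → 𝒳) → ℝ, ∫ x, φ x ∂Measure.pi ν =
        ∫ p : 𝒳 × (Fin n → 𝒳), φ (Fin.cons p.1 p.2) ∂(ν 0).prod (Measure.pi ν') := by
      intro φ
      rw [← hmp.integral_comp']
      simp [MeasurableEquiv.piFinSuccAbove_symm_apply, Fin.insertNthEquiv, ν']
    have hG' : Measurable fun p : 𝒳 × (Fin n → 𝒳) => G (Fin.cons p.1 p.2) := hG.comp hcons
    -- `G₁` averages out all coordinates but the first. At a fixed first coordinate, the fluctuation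
    -- of `G` about `G₁` falls under the induction hypothesis; that of `G₁` about its mean falls
    -- under Hoeffding's lemma, since `G₁` oscillates by at most `c 0`.
    set G₁ : 𝒳 → ℝ := fun a => ∫ x, G (Fin.cons a x) ∂Measure.pi ν' with hG₁
    have hG₁m : Measurable G₁ :=
      (hG'.stronglyMeasurable.integral_prod_right).measurable
    have hsec : ∀ a, Measurable fun x : Fin n → 𝒳 => G (Fin.cons a x) :=
      fun a => hG'.comp measurable_prodMk_left
    have hseci : ∀ a, Integrable (fun x : Fin n → 𝒳 => G (Fin.cons a x)) (Measure.pi ν') :=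
      fun a => Integrable.of_bound (hsec a).aestronglyMeasurable K (ae_of_all _ fun x => hK _)
    have hmean : ∫ y, G y ∂Measure.pi ν = ∫ a, G₁ a ∂ν 0 := by
      rw [hint, integral_prod]
      exact Integrable.of_bound hG'.aestronglyMeasurable K (ae_of_all _ fun x => hK _)
    set E := ∫ a, G₁ a ∂ν 0 with hE
    rw [hmean, hint]
    have hG₁diff : ∀ a b, |G₁ a - G₁ b| ≤ c 0 := by
      intro a b
      rw [hG₁, ← integral_sub (hseci a) (hseci b)]
      have := norm_integral_le_of_norm_le_const (μ := Measure.pi ν')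
        (f := fun x => G (Fin.cons a x) - G (Fin.cons b x)) (C := c 0)
        (ae_of_all _ fun x => by
          have := h (Fin.cons a x) 0 b
          rwa [Fin.update_cons_zero] at this)
      simpa using this
    have hG₁K : ∀ a, |G₁ a| ≤ K := fun a => by
      have := norm_integral_le_of_norm_le_const (μ := Measure.pi ν')
        (f := fun x => G (Fin.cons a x)) (C := K) (ae_of_all _ fun x => hK _)
      simpa using this
    have hc0 : 0 ≤ c 0 := (abs_nonneg _).trans (hG₁diff x₀ x₀)
    have hEK : |E| ≤ K := by
      have := norm_integral_le_of_norm_le_const (μ := ν 0) (f := G₁) (C := K)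
        (ae_of_all _ fun x => hG₁K _)
      simpa using this
    have hbddexp : ∀ z : ℝ, |z| ≤ 2 * K → ‖Real.exp (t * z)‖ ≤ Real.exp (|t| * (2 * K)) := by
      intro z hz
      rw [Real.norm_eq_abs, Real.abs_exp]
      refine Real.exp_le_exp.2 ((le_abs_self _).trans ?_)
      rw [abs_mul]
      gcongr
    have hintexp : Integrable (fun p : 𝒳 × (Fin n → 𝒳) =>
        Real.exp (t * (G (Fin.cons p.1 p.2) - E))) ((ν 0).prod (Measure.pi ν')) := by
      refine Integrable.of_bound
        (Real.measurable_exp.comp ((hG'.sub_const E).const_mul t)).aestronglyMeasurable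
        (Real.exp (|t| * (2 * K))) (ae_of_all _ fun p => hbddexp _ ?_)
      have := abs_sub (G (Fin.cons p.1 p.2)) E
      linarith [hK (Fin.cons p.1 p.2)]
    rw [integral_prod _ hintexp]
    have hinner : ∀ a, ∫ x, Real.exp (t * (G (Fin.cons a x) - E)) ∂Measure.pi ν' ≤
        Real.exp (t ^ 2 * (∑ i : Fin n, c i.succ ^ 2) / 8) * Real.exp (t * (G₁ a - E)) := by
      intro a
      have h1 : ∀ x : Fin n → 𝒳, Real.exp (t * (G (Fin.cons a x) - E)) =
          Real.exp (t * (G (Fin.cons a x) - G₁ a)) * Real.exp (t * (G₁ a - E)) := by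
        intro x; rw [← Real.exp_add]; ring_nf
      simp only [h1]
      rw [integral_mul_const]
      gcongr
      refine ih ν' (fun x => G (Fin.cons a x)) (fun i => c i.succ) (hsec a) (fun x i b => ?_) t
      have := h (Fin.cons a x) i.succ b
      rwa [← Fin.cons_update] at this
    have hout : Integrable (fun a => Real.exp (t * (G₁ a - E))) (ν 0) := by
      refine Integrable.of_bound (by fun_prop) (Real.exp (|t| * (2 * K)))
        (ae_of_all _ fun p => hbddexp _ ?_)
      have := abs_sub (G₁ p) E
      linarith [hG₁K p]
    calc _ ≤ ∫ a, Real.exp (t ^ 2 * (∑ i : Fin n, c i.succ ^ 2) / 8) *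
            Real.exp (t * (G₁ a - E)) ∂ν 0 :=
          integral_mono hintexp.integral_prod_left (hout.const_mul _) hinner
      _ = Real.exp (t ^ 2 * (∑ i : Fin n, c i.succ ^ 2) / 8) *
            ∫ a, Real.exp (t * (G₁ a - E)) ∂ν 0 := integral_const_mul _ _
      _ ≤ Real.exp (t ^ 2 * (∑ i : Fin n, c i.succ ^ 2) / 8) * Real.exp (t ^ 2 * c 0 ^ 2 / 8) := by
          gcongr
          have hbd : BddBelow (range G₁) := ⟨-K, by
            rintro _ ⟨a, rfl⟩; exact (abs_le.1 (hG₁K a)).1⟩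
          -- An interval of length `c 0` above the infimum, whence the variance proxy `(c 0 / 2)²`.
          have hI : ∀ᵐ a ∂ν 0, G₁ a ∈ Icc (⨅ a, G₁ a) ((⨅ a, G₁ a) + c 0) :=
            ae_of_all _ fun a => ⟨ciInf_le hbd a, by
              have : Nonempty 𝒳 := ⟨x₀⟩
              have : G₁ a - c 0 ≤ ⨅ a, G₁ a :=
                le_ciInf fun b => by linarith [(abs_le.1 (hG₁diff a b)).2]
              linarith⟩
          have := (ProbabilityTheory.hasSubgaussianMGF_of_mem_Icc hG₁m.aemeasurable hI).mgf_le t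
          refine this.trans (le_of_eq ?_)
          simp only [add_sub_cancel_left]
          congr 1
          push_cast
          rw [Real.norm_of_nonneg hc0]
          ring
      _ = _ := by
          rw [← Real.exp_add, Fin.sum_univ_succ]
          ring_nf

/-- McDiarmid's inequality. -/
lemma measure_ge_le_of_update {n : ℕ} (ν : Fin n → Measure 𝒳)
    [∀ i, IsProbabilityMeasure (ν i)] {G : (Fin n → 𝒳) → ℝ} {c : Fin n → ℝ} (hG : Measurable G)
    (h : ∀ x i a, |G x - G (Function.update x i a)| ≤ c i) {σ t : ℝ} (hσ : 0 < σ)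
    (hc : ∑ i, c i ^ 2 ≤ σ) (ht : 0 ≤ t) :
    Measure.pi ν {x | (∫ y, G y ∂Measure.pi ν) + t ≤ G x} ≤
      ENNReal.ofReal (Real.exp (-2 * t ^ 2 / σ)) := by
  set E := ∫ y, G y ∂Measure.pi ν
  have : Nonempty (Fin n → 𝒳) := (inferInstance : (ae (Measure.pi ν)).NeBot).nonempty
  obtain ⟨x₀⟩ := this
  -- The value `r = 4t/σ` minimises `-r t + r² σ / 8`, and the minimum is `-2t²/σ`.
  have hint : Integrable (fun x => Real.exp ((4 * t / σ) * (G x - E))) (Measure.pi ν) := by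
    refine Integrable.of_bound (by fun_prop)
      (Real.exp (|4 * t / σ| * (|G x₀ - E| + ∑ i, c i))) (ae_of_all _ fun p => ?_)
    rw [Real.norm_eq_abs, Real.abs_exp]
    refine Real.exp_le_exp.2 ((le_abs_self _).trans ?_)
    rw [abs_mul]
    gcongr
    have := abs_sub_le_sum_of_update h p x₀
    have := abs_sub_le (G p) (G x₀) E
    linarith
  have h1 := ProbabilityTheory.measure_ge_le_exp_mul_mgf (μ := Measure.pi ν)
    (X := fun x => G x - E) t (t := 4 * t / σ) (by positivity) hint
  have h2 := integral_exp_le_of_update ν G c hG h (4 * t / σ)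
  have hset : {x | E + t ≤ G x} = {x | t ≤ G x - E} := by
    ext x; simp only [mem_ofPred_eq]; constructor <;> intro h <;> linarith
  rw [hset, ← ENNReal.ofReal_toReal (measure_ne_top (Measure.pi ν) _)]
  refine ENNReal.ofReal_le_ofReal (h1.trans ?_)
  calc _ ≤ Real.exp (-(4 * t / σ) * t) * Real.exp ((4 * t / σ) ^ 2 * (∑ i, c i ^ 2) / 8) := by
        gcongr; exact h2
    _ ≤ Real.exp (-(4 * t / σ) * t) * Real.exp ((4 * t / σ) ^ 2 * σ / 8) := by gcongr
    _ = _ := by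
        rw [← Real.exp_add]
        congr 1
        field_simp
        ring

/-- McDiarmid's inequality for functions with values in `[0, ∞]`. -/
lemma measure_gt_le_of_update {n : ℕ} (ν : Fin n → Measure 𝒳)
    [∀ i, IsProbabilityMeasure (ν i)] {G : (Fin n → 𝒳) → ℝ≥0∞} {c : Fin n → ℝ} (hG : Measurable G)
    (hfin : ∀ x, G x ≠ ∞) (hc0 : ∀ i, 0 ≤ c i)
    (h : ∀ x i a, G x ≤ G (Function.update x i a) + ENNReal.ofReal (c i)) {σ t : ℝ} (hσ : 0 < σ)
    (hc : ∑ i, c i ^ 2 ≤ σ) (ht : 0 ≤ t) :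
    Measure.pi ν {x | (∫⁻ y, G y ∂Measure.pi ν) + ENNReal.ofReal t < G x} ≤
      ENNReal.ofReal (Real.exp (-2 * t ^ 2 / σ)) := by
  classical
  have hle : ∀ x i a, (G x).toReal ≤ (G (Function.update x i a)).toReal + c i := by
    intro x i a
    have := ENNReal.toReal_mono (by simp [hfin]) (h x i a)
    rwa [ENNReal.toReal_add (hfin _) (by simp), ENNReal.toReal_ofReal (hc0 i)] at this
  have hdiff : ∀ x i a, |(G x).toReal - (G (Function.update x i a)).toReal| ≤ c i := by
    intro x i a
    rw [abs_le]
    have h1 := hle x i a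
    have h2 := hle (Function.update x i a) i (x i)
    rw [Function.update_idem, Function.update_eq_self] at h2
    constructor <;> linarith
  refine (measure_mono ?_).trans (measure_ge_le_of_update ν hG.ennreal_toReal hdiff hσ hc ht)
  intro x hx
  simp only [mem_ofPred_eq] at hx ⊢
  rw [integral_toReal hG.aemeasurable (ae_of_all _ fun x => (hfin x).lt_top)]
  have h3 := ENNReal.toReal_mono (hfin x) hx.le
  have h4 : (∫⁻ y, G y ∂Measure.pi ν) ≠ ∞ := by
    intro h; rw [h] at hx; simp at hx
  rwa [ENNReal.toReal_add h4 (by simp), ENNReal.toReal_ofReal ht] at h3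

/-- Markov's inequality, for strict excess over a multiple of the mean. -/
lemma measure_gt_le_of_mul_lintegral {α : Type*} [MeasurableSpace α] (ν : Measure α)
    [IsProbabilityMeasure ν] {G : α → ℝ≥0∞} (hG : Measurable G)
    {a : ℝ≥0∞} (ha : a ≠ 0) (ha' : a ≠ ∞) :
    ν {x | a * (∫⁻ y, G y ∂ν) < G x} ≤ a⁻¹ := by
  -- Markov's inequality needs a level in `(0, ∞)`. If the mean is `0` then `G` vanishes almost
  -- everywhere, and if it is `∞` a strict excess is impossible.
  rcases eq_or_ne (∫⁻ y, G y ∂ν) 0 with h0 | h0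
  · have := (lintegral_eq_zero_iff hG).1 h0
    have h1 : ν {x | a * (∫⁻ y, G y ∂ν) < G x} = 0 := by
      rw [h0, mul_zero]
      refine measure_mono_null ?_ this
      intro x hx
      simp only [mem_ofPred_eq, mem_compl_iff] at hx ⊢
      exact hx.ne'
    simp [h1]
  rcases eq_or_ne (∫⁻ y, G y ∂ν) ∞ with hi | hi
  · rw [hi, ENNReal.mul_top ha]
    simp
  have := meas_ge_le_lintegral_div hG.aemeasurable (μ := ν) (mul_ne_zero ha h0)
    (ENNReal.mul_ne_top ha' hi)
  have h1 : {x | a * (∫⁻ y, G y ∂ν) < G x} ⊆ {x | a * (∫⁻ y, G y ∂ν) ≤ G x} :=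
    fun x hx => le_of_lt (α := ℝ≥0∞) hx
  refine (measure_mono h1).trans (this.trans ?_)
  rw [ENNReal.div_le_iff (mul_ne_zero ha h0) (ENNReal.mul_ne_top ha' hi), ← mul_assoc,
    ENNReal.inv_mul_cancel ha ha', one_mul]

end BoundedDifferences

/-! ### Symmetrization, and Rademacher complexities of i.i.d. samples. -/

section Product

variable {ι κ κ' 𝒳 : Type*} [Fintype κ] [Fintype κ'] [MeasurableSpace 𝒳]

lemma measurePreserving_comp_injective (ν : κ → Measure 𝒳) [∀ i, IsProbabilityMeasure (ν i)]
    (e : κ' → κ) (he : Function.Injective e) :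
    MeasurePreserving (fun x : κ → 𝒳 => x ∘ e) (Measure.pi ν) (Measure.pi fun i => ν (e i)) := by
  have h1 := (ProbabilityTheory.iIndepFun_pi (μ := ν) (X := fun _ x => x)
    (fun i => aemeasurable_id)).precomp he
  have h2 := (ProbabilityTheory.iIndepFun_iff_map_fun_eq_pi_map
    (fun i => (measurable_pi_apply (e i)).aemeasurable)).1 h1
  refine ⟨measurable_pi_iff.2 fun i => measurable_pi_apply (e i), h2.trans ?_⟩
  congr 1
  ext1 i
  exact (measurePreserving_eval ν (e i)).map_eq

lemma integral_pi_eval (ν : κ → Measure 𝒳) [∀ i, IsProbabilityMeasure (ν i)] (i : κ) {g : 𝒳 → ℝ}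
    (hg : Measurable g) : ∫ x, g (x i) ∂Measure.pi ν = ∫ a, g a ∂ν i := by
  rw [← (measurePreserving_eval ν i).map_eq, integral_map (measurable_pi_apply i).aemeasurable
    hg.aestronglyMeasurable]

lemma lintegral_pi_eval (ν : κ → Measure 𝒳) [∀ i, IsProbabilityMeasure (ν i)] (i : κ)
    {g : 𝒳 → ℝ≥0∞} (hg : Measurable g) : ∫⁻ x, g (x i) ∂Measure.pi ν = ∫⁻ a, g a ∂ν i :=
  (measurePreserving_eval ν i).lintegral_comp hg

lemma ae_pi_eval (ν : κ → Measure 𝒳) [∀ i, IsProbabilityMeasure (ν i)] (i : κ)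
    {p : 𝒳 → Prop} (hp : ∀ᵐ a ∂ν i, p a) : ∀ᵐ x ∂Measure.pi ν, p (x i) :=
  (measurePreserving_eval ν i).quasiMeasurePreserving.ae hp

variable [Countable ι] [DecidableEq κ] [DecidableEq κ']

/-- Symmetrization: the uniform deviation of a sum of independent terms from its mean is at most
twice the Rademacher average. -/
lemma lintegral_supE_sum_sub_le (ν : κ → Measure 𝒳) [∀ i, IsProbabilityMeasure (ν i)]
    (U : κ → ι → 𝒳 → ℝ) (hU : ∀ i f, Measurable (U i f)) (hi : ∀ i f, Integrable (U i f) (ν i)) :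
    ∫⁻ x, supE (fun f => ∑ i, (U i f (x i) - ∫ a, U i f a ∂ν i)) ∂Measure.pi ν ≤
      2 * ∫⁻ x, rad (fun i f => U i f (x i)) ∂Measure.pi ν := by
  set Dp : (κ → 𝒳 × 𝒳) → κ → ι → ℝ := fun p i f => U i f (p i).1 - U i f (p i).2 with hDp
  set ρ : Measure (κ → 𝒳 × 𝒳) := Measure.pi fun i => (ν i).prod (ν i) with hρ
  have hUi : ∀ i f, Integrable (fun x : κ → 𝒳 => U i f (x i)) (Measure.pi ν) := fun i f =>
    (measurePreserving_eval ν i).integrable_comp_of_integrable (hi i f)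
  -- The means are written as averages over an independent ghost sample `x'`, and the supremum moves
  -- inside that average.
  have h1 : ∀ x : κ → 𝒳, supE (fun f => ∑ i, (U i f (x i) - ∫ a, U i f a ∂ν i)) ≤
      ∫⁻ x', supE (fun f => ∑ i, (U i f (x i) - U i f (x' i))) ∂Measure.pi ν := by
    intro x
    refine supE_le fun f => ?_
    have : ∑ i, (U i f (x i) - ∫ a, U i f a ∂ν i) =
        ∫ x', ∑ i, (U i f (x i) - U i f (x' i)) ∂Measure.pi ν := by
      have hi' : ∀ i, Integrable (fun x' : κ → 𝒳 => U i f (x i) - U i f (x' i)) (Measure.pi ν) :=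
        fun i => (integrable_const _).sub (hUi i f)
      rw [integral_finsetSum _ fun i _ => hi' i]
      refine Finset.sum_congr rfl fun i _ => ?_
      rw [integral_sub (integrable_const _) (hUi i f), integral_pi_eval ν i (hU i f)]
      simp
    rw [this]
    refine (enorm_integral_le_lintegral_enorm _).trans (lintegral_mono fun x' => ?_)
    exact le_supE (fun f => ∑ i, (U i f (x i) - U i f (x' i))) f
  have hmeas2 : Measurable fun q : (κ → 𝒳) × (κ → 𝒳) =>
      supE (fun f => ∑ i, (U i f (q.1 i) - U i f (q.2 i))) :=
    measurable_supE fun f => Finset.measurable_sum _ fun i _ => by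
      have := hU i f; fun_prop
  have hDm : ∀ i f, Measurable fun p => Dp p i f := fun i f => by
    have := hU i f; simp only [hDp]; fun_prop
  have h2 : ∫⁻ x, ∫⁻ x', supE (fun f => ∑ i, (U i f (x i) - U i f (x' i)))
      ∂Measure.pi ν ∂Measure.pi ν = ∫⁻ p, supE (∑ i, Dp p i) ∂ρ := by
    rw [← lintegral_prod _ hmeas2.aemeasurable,
      ← (measurePreserving_arrowProdEquivProdArrow 𝒳 𝒳 κ ν ν).lintegral_comp hmeas2]
    refine lintegral_congr fun p => ?_
    congr 1
    ext f
    simp [hDp, MeasurableEquiv.arrowProdEquivProdArrow, Equiv.arrowProdEquivProdArrow]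
  -- Swapping the two members of a pair preserves the law and negates the corresponding difference,
  -- so arbitrary signs may be inserted.
  have h3 : ∀ ε : κ → Bool, ∫⁻ p, supE (∑ i, sgn (ε i) • Dp p i) ∂ρ =
      ∫⁻ p, supE (∑ i, Dp p i) ∂ρ := by
    intro ε
    have hmp : MeasurePreserving (fun (p : κ → 𝒳 × 𝒳) i => (bif ε i then id else Prod.swap) (p i))
        ρ ρ := by
      refine measurePreserving_pi _ _ fun i => ?_
      cases ε i
      · exact Measure.measurePreserving_swap
      · exact MeasurePreserving.id _
    rw [← hmp.lintegral_comp (show Measurable fun p => supE (∑ i, Dp p i) from measurable_supE fun f => by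
      simp only [Finset.sum_apply]
      exact Finset.measurable_sum _ fun i _ => hDm i f)]
    refine lintegral_congr fun p => ?_
    congr 1
    refine Finset.sum_congr rfl fun i _ => ?_
    ext f
    cases h : ε i <;> simp [hDp, sgn, h]
  have h4 : ∫⁻ p, supE (∑ i, Dp p i) ∂ρ = ∫⁻ p, rad (Dp p) ∂ρ := by
    unfold rad
    have hm : ∀ ε : κ → Bool, Measurable fun p => supE (∑ i, sgn (ε i) • Dp p i) := fun ε =>
      measurable_supE fun f => by
        simp only [Finset.sum_apply, Pi.smul_apply, smul_eq_mul]
        exact Finset.measurable_sum _ fun i _ => (hDm i f).const_mul _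
    rw [lintegral_const_mul _ (Finset.measurable_sum _ fun ε _ => hm ε),
      lintegral_finsetSum _ fun ε _ => hm ε]
    simp only [h3]
    rw [two_pow_inv_mul_card]
  have hrm : Measurable fun x : κ → 𝒳 => rad (fun i f => U i f (x i)) :=
    measurable_rad fun i f => (hU i f).comp (measurable_pi_apply i)
  have hfst : MeasurePreserving (fun (p : κ → 𝒳 × 𝒳) i => (p i).1) ρ (Measure.pi ν) :=
    measurePreserving_pi _ _ fun i => measurePreserving_fst
  have hsnd : MeasurePreserving (fun (p : κ → 𝒳 × 𝒳) i => (p i).2) ρ (Measure.pi ν) :=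
    measurePreserving_pi _ _ fun i => measurePreserving_snd
  calc _ ≤ ∫⁻ x, ∫⁻ x', supE (fun f => ∑ i, (U i f (x i) - U i f (x' i)))
        ∂Measure.pi ν ∂Measure.pi ν := lintegral_mono h1
    _ = ∫⁻ p, rad (Dp p) ∂ρ := h2.trans h4
    _ ≤ ∫⁻ p, (rad (fun i f => U i f (p i).1) + rad (fun i f => U i f (p i).2)) ∂ρ := by
        refine lintegral_mono fun p => ?_
        have : Dp p = (fun i f => U i f (p i).1) + (-1 : ℝ) • fun i f => U i f (p i).2 := by
          ext i f; simp [hDp, sub_eq_add_neg]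
        simp only [this]
        refine (rad_add_le _ _).trans ?_
        rw [rad_smul]; simp
    _ = 2 * ∫⁻ x, rad (fun i f => U i f (x i)) ∂Measure.pi ν := by
        have hrm1 : Measurable fun p : κ → 𝒳 × 𝒳 => rad (fun i f => U i f (p i).1) :=
          hrm.comp hfst.measurable
        rw [lintegral_add_left hrm1, two_mul]
        congr 1
        · exact hfst.lintegral_comp hrm
        · exact hsnd.lintegral_comp hrm

/-- The unnormalised Rademacher complexity of the class `V` for i.i.d. samples indexed by `κ`. -/
noncomputable def radInt (V : ι → 𝒳 → ℝ) (κ : Type*) [Fintype κ] [DecidableEq κ]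
    (ν : Measure 𝒳) : ℝ≥0∞ :=
  ∫⁻ z : κ → 𝒳, rad (fun i f => V f (z i)) ∂Measure.pi fun _ => ν

variable {V : ι → 𝒳 → ℝ}

lemma measurable_rad_eval (hV : ∀ f, Measurable (V f)) :
    Measurable fun x : κ → 𝒳 => rad (fun i f => V f (x i)) :=
  measurable_rad fun i f => (hV f).comp (measurable_pi_apply i)

omit [DecidableEq κ] in
lemma lintegral_rad_comp (hV : ∀ f, Measurable (V f)) (ν : κ → Measure 𝒳)
    [∀ i, IsProbabilityMeasure (ν i)] (e : κ' → κ) (he : Function.Injective e) (ν₀ : Measure 𝒳)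
    (h : ∀ i, ν (e i) = ν₀) :
    ∫⁻ x, rad (fun i f => V f (x (e i))) ∂Measure.pi ν = radInt V κ' ν₀ := by
  rw [radInt]
  have := (measurePreserving_comp_injective ν e he).lintegral_comp (measurable_rad_eval hV)
  simp only [h] at this
  exact this

lemma radInt_mono (hV : ∀ f, Measurable (V f)) (ν : Measure 𝒳) [IsProbabilityMeasure ν]
    (e : κ' → κ) (he : Function.Injective e) : radInt V κ' ν ≤ radInt V κ ν := by
  rw [← lintegral_rad_comp hV (fun _ : κ => ν) e he ν fun _ => rfl]
  exact lintegral_mono fun x => rad_comp_injective_le e he fun i f => V f (x i)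

lemma radInt_prod_le (hV : ∀ f, Measurable (V f)) (ν : Measure 𝒳) [IsProbabilityMeasure ν] :
    radInt V (κ' × κ) ν ≤ Fintype.card κ' * radInt V κ ν := by
  calc radInt V (κ' × κ) ν
      ≤ ∫⁻ x : κ' × κ → 𝒳, ∑ t, rad (fun i f => V f (x (t, i))) ∂Measure.pi fun _ => ν :=
        lintegral_mono fun x => rad_prod_le _
    _ = ∑ t : κ', radInt V κ ν := by
        have hm : ∀ t : κ', Measurable fun x : κ' × κ → 𝒳 => rad (fun i f => V f (x (t, i))) :=
          fun t => measurable_rad fun i f => (hV f).comp (measurable_pi_apply (t, i))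
        rw [lintegral_finsetSum _ fun t _ => hm t]
        exact Finset.sum_congr rfl fun t _ => lintegral_rad_comp hV _ (fun i => (t, i))
          (fun a b h => by simpa using h) ν fun _ => rfl
    _ = _ := by simp

/-- An `N`-sample is covered by `q = N / M + 1` blocks of size `M`. Since `M ≤ N` one has `q M ≤ 2
N`, so the factor `2` is the cost of rounding up. -/
lemma radInt_fin_le_two_mul (hV : ∀ f, Measurable (V f)) (ν : Measure 𝒳) [IsProbabilityMeasure ν]
    {M N : ℕ} (hM : 0 < M) (hMN : M ≤ N) :
    (N : ℝ≥0∞)⁻¹ * radInt V (Fin N) ν ≤ 2 * ((M : ℝ≥0∞)⁻¹ * radInt V (Fin M) ν) := by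
  set q := N / M + 1 with hq
  have h1 : N ≤ q * M := by
    have := Nat.lt_div_mul_add hM (a := N)
    rw [hq, add_mul, one_mul]; exact this.le
  have h2 : q * M ≤ 2 * N := by
    have := Nat.div_mul_le_self N M
    rw [hq, add_mul, one_mul]; omega
  have h3 : radInt V (Fin N) ν ≤ q * radInt V (Fin M) ν := by
    refine (radInt_mono hV ν (fun i : Fin N => finProdFinEquiv.symm (Fin.castLE h1 i))
      (finProdFinEquiv.symm.injective.comp (Fin.castLE_injective h1))).trans ?_
    simpa using radInt_prod_le (κ' := Fin q) (κ := Fin M) hV ν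
  have hN : (N : ℝ≥0∞) ≠ 0 := by simp; omega
  have hM' : (M : ℝ≥0∞) ≠ 0 := by simp; omega
  calc (N : ℝ≥0∞)⁻¹ * radInt V (Fin N) ν
      ≤ (N : ℝ≥0∞)⁻¹ * (q * radInt V (Fin M) ν) := by gcongr
    _ = (N : ℝ≥0∞)⁻¹ * ((q * M : ℕ) * ((M : ℝ≥0∞)⁻¹ * radInt V (Fin M) ν)) := by
        push_cast
        rw [mul_assoc (q : ℝ≥0∞), ← mul_assoc (M : ℝ≥0∞),
          ENNReal.mul_inv_cancel hM' (by simp), one_mul]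
    _ ≤ (N : ℝ≥0∞)⁻¹ * ((2 * N : ℕ) * ((M : ℝ≥0∞)⁻¹ * radInt V (Fin M) ν)) := by gcongr
    _ = 2 * ((M : ℝ≥0∞)⁻¹ * radInt V (Fin M) ν) := by
        push_cast
        rw [mul_comm (2 : ℝ≥0∞), mul_assoc, ← mul_assoc, ENNReal.inv_mul_cancel hN (by simp),
          one_mul]

/-- The law of a fair coin. -/
noncomputable def coin : Measure Bool :=
  (2 : ℝ≥0∞)⁻¹ • Measure.dirac true + (2 : ℝ≥0∞)⁻¹ • Measure.dirac false

instance : IsProbabilityMeasure coin := ⟨by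
  simp [coin, ENNReal.inv_two_add_inv_two]⟩

lemma measurePreserving_not_coin : MeasurePreserving not coin coin := by
  refine ⟨measurable_of_finite _, ?_⟩
  simp only [coin]
  rw [Measure.map_add _ _ (measurable_of_finite _), Measure.map_smul, Measure.map_smul,
    Measure.map_dirac, Measure.map_dirac, add_comm]
  rfl

lemma map_select_coin (A B : Measure 𝒳) [IsProbabilityMeasure A] [IsProbabilityMeasure B] :
    MeasurePreserving (fun p : (𝒳 × 𝒳) × Bool => if p.2 then p.1.1 else p.1.2)
      ((A.prod B).prod coin) ((2 : ℝ≥0∞)⁻¹ • A + (2 : ℝ≥0∞)⁻¹ • B) := by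
  have hm : Measurable fun p : (𝒳 × 𝒳) × Bool => if p.2 then p.1.1 else p.1.2 :=
    Measurable.ite (measurable_snd (measurableSet_singleton true)) (by fun_prop) (by fun_prop)
  refine ⟨hm, ?_⟩
  simp only [coin]
  rw [Measure.prod_add, Measure.prod_smul_right, Measure.prod_smul_right, Measure.prod_dirac,
    Measure.prod_dirac, Measure.map_add _ _ hm, Measure.map_smul, Measure.map_smul,
    Measure.map_map hm (by fun_prop), Measure.map_map hm (by fun_prop)]
  congr 2
  · simp [Function.comp_def]
  · simp [Function.comp_def]

/-- The complexity for a balanced mixture dominates that for either component. -/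
lemma radInt_le_two_mul_mixture (hV : ∀ f, Measurable (V f)) (A B : Measure 𝒳)
    [IsProbabilityMeasure A] [IsProbabilityMeasure B] :
    radInt V κ A ≤ 2 * radInt V κ ((2 : ℝ≥0∞)⁻¹ • A + (2 : ℝ≥0∞)⁻¹ • B) := by
  have : IsProbabilityMeasure ((2 : ℝ≥0∞)⁻¹ • A + (2 : ℝ≥0∞)⁻¹ • B) :=
    ⟨by simp [ENNReal.inv_two_add_inv_two]⟩
  -- Each coordinate carries a draw from `A`, a draw from `B` and a coin that selects one of them.
  -- The family built on the `A`-draws is the sum of its parts with coin `true` and with coin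
  -- `false`, which have equal complexity by flipping all coins; the first part is also a masked
  -- version of the mixture sample, so contraction applies.
  set τ : Measure (κ → (𝒳 × 𝒳) × Bool) := Measure.pi fun _ => (A.prod B).prod coin
  have hrm := measurable_rad_eval (κ := κ) hV
  have hsel := measurePreserving_pi (fun _ : κ => (A.prod B).prod coin) _
    fun _ => map_select_coin A B
  have hfst : MeasurePreserving (fun (p : κ → (𝒳 × 𝒳) × Bool) i => (p i).1.1) τ
      (Measure.pi fun _ => A) :=
    measurePreserving_pi _ _ fun _ => measurePreserving_fst.comp measurePreserving_fst
  have hflip : MeasurePreserving (fun (p : κ → (𝒳 × 𝒳) × Bool) i => ((p i).1, !(p i).2)) τ τ :=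
    measurePreserving_pi _ _ fun _ => (MeasurePreserving.id _).prod measurePreserving_not_coin
  set h : (κ → (𝒳 × 𝒳) × Bool) → ℝ≥0∞ :=
    fun p => rad (fun i f => if (p i).2 then V f (p i).1.1 else 0)
  have hhm : Measurable h := measurable_rad fun i f =>
    Measurable.ite ((measurable_snd.comp (measurable_pi_apply i)) (measurableSet_singleton true))
      ((hV f).comp (by fun_prop)) measurable_const
  have e1 : ∫⁻ p, rad (fun i f => V f (if (p i).2 then (p i).1.1 else (p i).1.2)) ∂τ =
      radInt V κ ((2 : ℝ≥0∞)⁻¹ • A + (2 : ℝ≥0∞)⁻¹ • B) := hsel.lintegral_comp hrm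
  have e2 : ∫⁻ p, rad (fun i f => V f (p i).1.1) ∂τ = radInt V κ A := hfst.lintegral_comp hrm
  have e3 : ∫⁻ p, rad (fun i f => if !(p i).2 then V f (p i).1.1 else 0) ∂τ = ∫⁻ p, h p ∂τ :=
    hflip.lintegral_comp hhm
  have h1 : ∫⁻ p, h p ∂τ ≤ radInt V κ ((2 : ℝ≥0∞)⁻¹ • A + (2 : ℝ≥0∞)⁻¹ • B) := by
    rw [← e1]
    refine lintegral_mono fun p => ?_
    have := rad_ite_le (fun i => (p i).2)
      (fun i f => V f (if (p i).2 then (p i).1.1 else (p i).1.2))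
    refine le_trans (le_of_eq ?_) this
    simp only [h]
    congr 1
    ext i f
    split_ifs <;> rfl
  have h2 : radInt V κ A ≤ ∫⁻ p, h p ∂τ + ∫⁻ p, h p ∂τ := by
    nth_rw 2 [← e3]
    rw [← lintegral_add_left hhm, ← e2]
    exact lintegral_mono fun p =>
      rad_le_ite_add_ite (fun i => (p i).2) (fun i f => V f (p i).1.1)
  rw [two_mul]
  exact h2.trans (add_le_add h1 h1)

end Product

/-! ### Rademacher averages of samples drawn with replacement from finitely many points. -/

section Resampling

variable {ι κ τ : Type*} [Fintype κ] [DecidableEq κ] [Fintype τ] [DecidableEq τ]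

/-- Multiplying the `i`-th draw by a further sign `s (j i)`, shared by all draws of the same point,
changes nothing. For fixed `ε`, grouping the draws by point leaves a Rademacher sum in `s` whose
weights are the signed multiplicities of the points. -/
lemma rad_comp_eq_sum (j : τ → κ) (v : κ → ι → ℝ) :
    rad (v ∘ j) = ((2 : ℝ≥0∞) ^ Fintype.card τ)⁻¹ * ∑ ε : τ → Bool,
      rad (fun a => (∑ i, if j i = a then sgn (ε i) else 0) • v a) := by
  calc rad (v ∘ j) = ((2 : ℝ≥0∞) ^ Fintype.card κ)⁻¹ * ∑ _s : κ → Bool, rad (v ∘ j) :=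
        (two_pow_inv_mul_card _).symm
    _ = ((2 : ℝ≥0∞) ^ Fintype.card κ)⁻¹ * ∑ s : κ → Bool,
          rad (fun i => sgn (s (j i)) • (v ∘ j) i) := by
        congr 1
        exact Finset.sum_congr rfl fun s _ => (rad_sgn_smul (fun i => s (j i)) _).symm
    _ = _ := by
        simp only [rad]
        rw [← Finset.mul_sum, ← Finset.mul_sum, mul_left_comm, Finset.sum_comm]
        congr 3
        ext ε
        refine Finset.sum_congr rfl fun s _ => ?_
        congr 1
        ext f
        simp only [Finset.sum_apply, Pi.smul_apply, smul_eq_mul, Function.comp_apply,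
          Finset.sum_mul, Finset.mul_sum]
        rw [Finset.sum_comm]
        refine Finset.sum_congr rfl fun i _ => ?_
        rw [Finset.sum_eq_single (j i)]
        · simp; ring
        · intro a _ ha
          simp [ha.symm]
        · simp

/-- The exponential moment of the signed number of draws of `a`, summed over all draws and signs. -/
lemma sum_exp_signed_count (J : ℕ) (a : κ) (t : ℝ) :
    ∑ j : Fin J → κ, ∑ ε : Fin J → Bool,
      Real.exp (t * ∑ i, if j i = a then sgn (ε i) else 0) =
    (2 * ((Fintype.card κ : ℝ) + (Real.cosh t - 1))) ^ J := by
  have h1 : ∑ p : κ × Bool, Real.exp (t * if p.1 = a then sgn p.2 else 0) =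
      2 * ((Fintype.card κ : ℝ) + (Real.cosh t - 1)) := by
    rw [Fintype.sum_prod_type, ← Finset.add_sum_erase _ _ (Finset.mem_univ a)]
    have h2 : ∑ b ∈ Finset.univ.erase a, ∑ s : Bool, Real.exp (t * if b = a then sgn s else 0) =
        ∑ b ∈ (Finset.univ.erase a : Finset κ), 2 := by
      refine Finset.sum_congr rfl fun b hb => ?_
      simp [Finset.ne_of_mem_erase hb]
    have hc : 1 ≤ Fintype.card κ := Fintype.card_pos_iff.2 ⟨a⟩
    simp only [h2]
    simp [sgn, Real.cosh_eq, Finset.card_erase_of_mem, Nat.cast_sub hc]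
    ring
  rw [← Fintype.sum_prod_type', ← h1, Fintype.sum_pow]
  refine (Fintype.sum_equiv (Equiv.arrowProdEquivProdArrow (Fin J) (fun _ => κ) (fun _ => Bool))
    _ _ fun p => ?_).symm
  simp only [Equiv.arrowProdEquivProdArrow, Equiv.coe_fn_mk, Finset.mul_sum, Real.exp_sum]
  rfl

/-- Combines `cosh t ≤ exp (t² / 2)` with the chord of `exp` over `[0, 1/2]`, whose slope is `2(√e -
1) ≤ 1.3`. -/
lemma cosh_sub_one_le {t : ℝ} (h0 : 0 ≤ t) (h1 : t ≤ 1) : Real.cosh t - 1 ≤ 0.65 * t ^ 2 := by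
  have hx : t ^ 2 ≤ 1 := by nlinarith
  have h2 := convexOn_exp.2 (mem_univ (0 : ℝ)) (mem_univ (1 / 2 : ℝ))
    (show 0 ≤ 1 - t ^ 2 by linarith) (sq_nonneg t) (by ring)
  have h3 : Real.exp (1 / 2) ≤ 1.65 := by
    have h4 : Real.exp (1 / 2) * Real.exp (1 / 2) = Real.exp 1 := by
      rw [← Real.exp_add]; norm_num
    have := Real.exp_one_lt_d9
    nlinarith [Real.exp_pos (1 / 2)]
  have h5 := Real.cosh_le_exp_half_sq t
  simp only [smul_eq_mul, mul_zero, zero_add, Real.exp_zero, mul_one] at h2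
  rw [show t ^ 2 * (1 / 2) = t ^ 2 / 2 by ring] at h2
  nlinarith [sq_nonneg t]

/-- The choice `t = √(A/s)` balances `A / t` against `s t`. It is admissible only while `t ≤ 1`; for
`A ≥ s` the value `t = 1` is used and the term `A` dominates. -/
lemma exists_exponent_le {A s : ℝ} (hA : 0 < A) (hs : 0 < s) :
    ∃ t : ℝ, 0 < t ∧ (A + s * (Real.cosh t - 1)) / t ≤ 1.65 * (√(s * A) + A) := by
  rcases le_total A s with h | h
  · refine ⟨√(A / s), by positivity, ?_⟩
    have h1 : √(A / s) ≤ 1 := by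
      exact Real.sqrt_le_one.2 ((div_le_one hs).2 h)
    have h2 := cosh_sub_one_le (Real.sqrt_nonneg (A / s)) h1
    have h3 : √(A / s) ^ 2 = A / s := Real.sq_sqrt (by positivity)
    have h4 : √(s * A) * √(A / s) = A := by
      rw [← Real.sqrt_mul (by positivity), show s * A * (A / s) = A ^ 2 by field_simp,
        Real.sqrt_sq hA.le]
    rw [div_le_iff₀ (by positivity)]
    rw [h3] at h2
    have h5 : s * (Real.cosh √(A / s) - 1) ≤ 0.65 * A := by
      calc _ ≤ s * (0.65 * (A / s)) := by gcongr
        _ = _ := by field_simp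
    nlinarith [Real.sqrt_nonneg (A / s)]
  · refine ⟨1, one_pos, ?_⟩
    have h2 := cosh_sub_one_le zero_le_one le_rfl
    rw [div_one]
    have : s * (Real.cosh 1 - 1) ≤ 0.65 * A := by
      calc _ ≤ s * (0.65 * 1 ^ 2) := by gcongr
        _ ≤ _ := by linarith
    have := Real.sqrt_nonneg (s * A)
    linarith

/-- The Rademacher average of a sample drawn with replacement from a finite family. -/
lemma sum_rad_comp_le [Nonempty κ] {J : ℕ} (hJ : 0 < J) (v : κ → ι → ℝ) :
    ((Fintype.card κ : ℝ≥0∞) ^ J)⁻¹ * ∑ j : Fin J → κ, rad (v ∘ j) ≤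
      ENNReal.ofReal (1.65 * (√((J : ℝ) / Fintype.card κ * Real.log (2 * Fintype.card κ)) +
        Real.log (2 * Fintype.card κ))) * rad v := by
  set m := Fintype.card κ with hm
  have hm0 : 0 < m := Fintype.card_pos
  have hm1 : (1 : ℝ) ≤ m := by exact_mod_cast hm0
  have hmpos : (0 : ℝ) < m := by linarith
  set A := Real.log (2 * m) with hA
  have hA0 : 0 < A := Real.log_pos (by linarith)
  obtain ⟨t, ht, htle⟩ := exists_exponent_le hA0 (s := (J : ℝ) / m) (by positivity)
  -- With this `c`, `exp (-c)` times the mean of `∑ a, (exp (t S a) + exp (-t S a))` is at most `1`;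
  -- see `e4` and `e5`.
  set c := A + (J : ℝ) / m * (Real.cosh t - 1) with hc
  set S : (Fin J → κ) → (Fin J → Bool) → κ → ℝ :=
    fun j ε a => ∑ i, if j i = a then sgn (ε i) else 0 with hS
  -- A majorant of `max |S a|`, from the tangent inequality `x ≤ c - 1 + exp (x - c)` at `x = t |S
  -- a|`, with the maximum of the exponentials replaced by their sum. It is linear in the
  -- exponentials, so its mean is computed exactly and is at most `c / t`.
  set Mx : (Fin J → κ) → (Fin J → Bool) → ℝ := fun j ε =>
    (c - 1 + Real.exp (-c) * ∑ a, (Real.exp (t * S j ε a) + Real.exp (-t * S j ε a))) / t with hMx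
  have hSM : ∀ j ε a, |S j ε a| ≤ Mx j ε := by
    intro j ε a
    rw [hMx]
    simp only
    rw [le_div_iff₀ ht]
    have h1 := Real.add_one_le_exp (|S j ε a| * t - c)
    have h2 : Real.exp (|S j ε a| * t - c) ≤
        Real.exp (-c) * ∑ a, (Real.exp (t * S j ε a) + Real.exp (-t * S j ε a)) := by
      rw [sub_eq_add_neg, Real.exp_add, mul_comm]
      gcongr
      refine le_trans ?_ (Finset.single_le_sum
        (f := fun a => Real.exp (t * S j ε a) + Real.exp (-t * S j ε a))
        (fun a _ => by positivity) (Finset.mem_univ a))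
      rcases abs_cases (S j ε a) with h | h
      · rw [h.1, mul_comm]; linarith [Real.exp_pos (-t * S j ε a)]
      · rw [h.1, show -S j ε a * t = -t * S j ε a by ring]; linarith [Real.exp_pos (t * S j ε a)]
    linarith
  have hMx0 : ∀ j ε, 0 ≤ Mx j ε := fun j ε =>
    (abs_nonneg _).trans (hSM j ε (Classical.arbitrary κ))
  have hsum : ((m : ℝ) ^ J * 2 ^ J)⁻¹ * ∑ j : Fin J → κ, ∑ ε : Fin J → Bool, Mx j ε ≤ c / t := by
    have e1 : ∑ j : Fin J → κ, ∑ ε : Fin J → Bool, Mx j ε = ((m : ℝ) ^ J * 2 ^ J * (c - 1) +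
        Real.exp (-c) * (2 * m * (2 * ((m : ℝ) + (Real.cosh t - 1))) ^ J)) / t := by
      simp only [hMx]
      simp_rw [← Finset.sum_div, Finset.sum_add_distrib, ← Finset.mul_sum]
      congr 2
      · simp [hm]; ring
      · congr 1
        have : ∀ r : ℝ, ∑ j : Fin J → κ, ∑ ε : Fin J → Bool, ∑ a, Real.exp (r * S j ε a) =
            m * (2 * ((m : ℝ) + (Real.cosh r - 1))) ^ J := by
          intro r
          simp_rw [fun j => Finset.sum_comm (s := (Finset.univ : Finset (Fin J → Bool)))
            (t := (Finset.univ : Finset κ)) (f := fun ε a => Real.exp (r * S j ε a))]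
          rw [Finset.sum_comm]
          simp_rw [hS, sum_exp_signed_count]
          simp [hm]
        simp_rw [Finset.sum_add_distrib]
        rw [this t, this (-t), Real.cosh_neg]
        ring
    rw [e1, ← mul_div_assoc]
    gcongr
    have e2 : (2 * ((m : ℝ) + (Real.cosh t - 1))) ^ J =
        (m : ℝ) ^ J * 2 ^ J * (1 + (Real.cosh t - 1) / m) ^ J := by
      rw [← mul_pow, ← mul_pow]; congr 1; field_simp
    have e3 : (1 + (Real.cosh t - 1) / m) ^ J ≤ Real.exp ((J : ℝ) / m * (Real.cosh t - 1)) := by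
      have h1 := Real.add_one_le_exp ((Real.cosh t - 1) / m)
      have h0 : 0 ≤ (Real.cosh t - 1) / m := div_nonneg (by linarith [Real.one_le_cosh t]) hmpos.le
      calc _ ≤ Real.exp ((Real.cosh t - 1) / m) ^ J := by gcongr; linarith
        _ = _ := by rw [← Real.exp_nat_mul]; congr 1; ring
    have e4 : Real.exp (-c) * (2 * m * Real.exp ((J : ℝ) / m * (Real.cosh t - 1))) = 1 := by
      rw [← Real.exp_log (show (0 : ℝ) < 2 * m by positivity), ← Real.exp_add, ← Real.exp_add,
        ← hA, hc]
      simp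
    have hP : (0 : ℝ) < (m : ℝ) ^ J * 2 ^ J := by positivity
    rw [e2, inv_mul_le_iff₀ hP]
    have e5 : Real.exp (-c) * (2 * m * (1 + (Real.cosh t - 1) / m) ^ J) ≤ 1 := by
      refine le_trans ?_ e4.le
      gcongr
    nlinarith
  calc _ = ((m : ℝ≥0∞) ^ J)⁻¹ * ∑ j : Fin J → κ, ((2 : ℝ≥0∞) ^ J)⁻¹ *
        ∑ ε : Fin J → Bool, rad (fun a => S j ε a • v a) := by
        simp_rw [rad_comp_eq_sum, Fintype.card_fin]
        rfl
    _ ≤ ((m : ℝ≥0∞) ^ J)⁻¹ * ∑ j : Fin J → κ, ((2 : ℝ≥0∞) ^ J)⁻¹ *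
        ∑ ε : Fin J → Bool, ENNReal.ofReal (Mx j ε) * rad v := by
        gcongr with j _ ε _
        exact rad_mul_le _ (hSM j ε) v
    _ = ENNReal.ofReal (((m : ℝ) ^ J * 2 ^ J)⁻¹ *
          ∑ j : Fin J → κ, ∑ ε : Fin J → Bool, Mx j ε) * rad v := by
        rw [ENNReal.ofReal_mul (by positivity), ENNReal.ofReal_inv_of_pos (by positivity),
          ENNReal.ofReal_mul (by positivity), ENNReal.ofReal_pow (by positivity),
          ENNReal.ofReal_pow (by positivity), ENNReal.ofReal_natCast, ENNReal.ofReal_ofNat,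
          ENNReal.ofReal_sum_of_nonneg fun j _ => Finset.sum_nonneg fun ε _ => hMx0 j ε,
          ENNReal.mul_inv (by simp) (by simp)]
        simp_rw [ENNReal.ofReal_sum_of_nonneg fun ε _ => hMx0 _ ε, ← Finset.sum_mul,
          ← Finset.mul_sum, ← Finset.sum_mul]
        ring
    _ ≤ _ := by
        exact mul_le_mul_left (ENNReal.ofReal_le_ofReal (hsum.trans htle)) _

end Resampling

/-! ### Geometry of nearest neighbours: a packing bound for the mean radius. -/

section NearestNeighbours

/-- The rank, i.e. the number of predecessors in `T`, is injective on `T` with values below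
`T.card`. It is therefore a bijection onto `range T.card`, and each of the values below `k` is taken
once. -/
lemma card_filter_rank_lt {α : Type*} (r : α → α → Prop) [DecidableRel r] (hirr : ∀ a, ¬ r a a)
    (htr : ∀ a b c, r a b → r b c → r a c) (htot : ∀ a b, a ≠ b → r a b ∨ r b a)
    (T : Finset α) {k : ℕ} (hk : k ≤ T.card) :
    (T.filter fun l => (T.filter fun i => r i l).card < k).card = k := by
  classical
  set rk : α → ℕ := fun l => (T.filter fun i => r i l).card
  have hlt : ∀ a ∈ T, ∀ b, r a b → rk a < rk b := by
    intro a ha b hab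
    have hsub : (T.filter fun i => r i a) ⊆ T.filter fun i => r i b := fun i hi => by
      simp only [Finset.mem_filter] at hi ⊢
      exact ⟨hi.1, htr _ _ _ hi.2 hab⟩
    exact Finset.card_lt_card ((Finset.ssubset_iff_of_subset hsub).2
      ⟨a, Finset.mem_filter.2 ⟨ha, hab⟩, fun h => hirr a (Finset.mem_filter.1 h).2⟩)
  have hinj : InjOn rk T := by
    intro a ha b hb hab
    by_contra hne
    rcases htot a b hne with h | h
    · exact (hlt a ha b h).ne hab
    · exact (hlt b hb a h).ne hab.symm
  have himg : T.image rk = Finset.range T.card := by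
    refine Finset.eq_of_subset_of_card_le ?_ ?_
    · intro c hc
      obtain ⟨a, ha, rfl⟩ := Finset.mem_image.1 hc
      rw [Finset.mem_range]
      exact Finset.card_lt_card ((Finset.ssubset_iff_of_subset (Finset.filter_subset _ _)).2
        ⟨a, ha, fun h => hirr a (Finset.mem_filter.1 h).2⟩)
    · rw [Finset.card_image_of_injOn hinj, Finset.card_range]
  have h2 : (T.filter fun l => rk l < k).image rk = Finset.range k := by
    ext c
    simp only [Finset.mem_image, Finset.mem_filter, Finset.mem_range]
    constructor
    · rintro ⟨a, ⟨_, h⟩, rfl⟩; exact h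
    · intro hc
      have : c ∈ T.image rk := by rw [himg, Finset.mem_range]; omega
      obtain ⟨a, ha, rfl⟩ := Finset.mem_image.1 this
      exact ⟨a, ⟨ha, hc⟩, rfl⟩
  have h3 := Finset.card_image_of_injOn (s := T.filter fun l => rk l < k) (f := rk)
    (hinj.mono fun a ha => (Finset.mem_filter.1 ha).1)
  rw [h2, Finset.card_range] at h3
  exact h3.symm

variable {d n : ℕ}

lemma mem_minority {y : Fin n → Bool} {i : Fin n} : i ∈ minority y ↔ y i = true := by
  simp [minority]

lemma card_knn {k : ℕ} {z : Fin n → Obs d} {j : Fin n} (hj : j ∈ minority (labels z))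
    (hk : k < numMin (labels z)) : (knn k z j).card = k := by
  classical
  unfold knn
  convert card_filter_rank_lt (Precedes z j) ?_ ?_ ?_ ((minority (labels z)).erase j) ?_
  · intro a h
    rcases h with h | h
    · exact lt_irrefl _ h
    · exact lt_irrefl _ h.2
  · rintro a b c (h | h) (h' | h')
    · exact Or.inl (h.trans h')
    · exact Or.inl (h'.1 ▸ h)
    · exact Or.inl (h.1 ▸ h')
    · exact Or.inr ⟨h.1.trans h'.1, h.2.trans h'.2⟩
  · intro a b hab
    rcases lt_trichotomy (dist (z a).1 (z j).1) (dist (z b).1 (z j).1) with h | h | h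
    · exact Or.inl (Or.inl h)
    · rcases lt_or_gt_of_ne hab with h' | h'
      · exact Or.inl (Or.inr ⟨h, h'⟩)
      · exact Or.inr (Or.inr ⟨h.symm, h'⟩)
    · exact Or.inr (Or.inl h)
  · rw [Finset.card_erase_of_mem hj]
    have : k < (minority (labels z)).card := hk
    omega

lemma knn_subset_minority (k : ℕ) (z : Fin n → Obs d) (j : Fin n) :
    knn k z j ⊆ minority (labels z) := by
  classical
  unfold knn
  exact (Finset.filter_subset _ _).trans (Finset.erase_subset _ _)

/-- The distance from observation `j` to the farthest of its `k` nearest neighbours. -/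
noncomputable def knnRadius (k : ℕ) (z : Fin n → Obs d) (j : Fin n) : ℝ≥0 :=
  (knn k z j).sup fun l => nndist (z l).1 (z j).1

lemma dist_le_knnRadius {k : ℕ} {z : Fin n → Obs d} {j l : Fin n} (hl : l ∈ knn k z j) :
    dist (z l).1 (z j).1 ≤ knnRadius k z j := by
  rw [dist_nndist, NNReal.coe_le_coe]
  exact Finset.le_sup (f := fun l => nndist (z l).1 (z j).1) hl

/-- The radius is attained at some neighbour `l`. Whatever is strictly closer precedes `l`, and
fewer than `k` points do. Positivity of the radius guarantees that there is a neighbour at all. -/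
lemma card_lt_of_lt_knnRadius {k : ℕ} {z : Fin n → Obs d} {j : Fin n} (h0 : 0 < knnRadius k z j) :
    (((minority (labels z)).erase j).filter fun l =>
      dist (z l).1 (z j).1 < knnRadius k z j).card < k := by
  classical
  have hne : (knn k z j).Nonempty := by
    by_contra h
    rw [Finset.not_nonempty_iff_eq_empty] at h
    simp [knnRadius, h] at h0
  obtain ⟨l, hl, hlr⟩ := Finset.exists_mem_eq_sup _ hne fun l => nndist (z l).1 (z j).1
  have hlr' : (knnRadius k z j : ℝ) = dist (z l).1 (z j).1 := by
    rw [dist_nndist]; exact congrArg _ hlr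
  have hl2 := hl
  unfold knn at hl2
  refine lt_of_le_of_lt (Finset.card_le_card ?_) (Finset.mem_filter.1 hl2).2
  intro i hi
  simp only [Finset.mem_filter] at hi ⊢
  exact ⟨hi.1, Or.inl (hlr' ▸ hi.2)⟩

lemma knnRadius_le_of_card {k : ℕ} {z : Fin n → Obs d} {j : Fin n} {r : ℝ} (hr : 0 ≤ r)
    (h : k ≤ (((minority (labels z)).erase j).filter fun l => dist (z l).1 (z j).1 ≤ r).card) :
    (knnRadius k z j : ℝ) ≤ r := by
  by_contra! hlt
  have h1 := card_lt_of_lt_knnRadius (k := k) (z := z) (j := j)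
    (by exact_mod_cast hr.trans_lt hlt)
  refine absurd (h.trans (Finset.card_le_card ?_)) (not_le.2 h1)
  exact Finset.monotone_filter_right _ fun l _ hl => lt_of_le_of_lt hl hlt

/-- The balls of half the nearest-neighbour radius cover every point at most `k` times. -/
lemma card_filter_mem_ball_le {k : ℕ} (z : Fin n → Obs d) (x : Cov d) :
    ((minority (labels z)).filter fun j => dist x (z j).1 < knnRadius k z j / 2).card ≤ k := by
  classical
  set A := (minority (labels z)).filter fun j => dist x (z j).1 < knnRadius k z j / 2 with hA
  rcases A.eq_empty_or_nonempty with h | h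
  · simp [h]
  -- Let `j` have the largest radius `r_j` among the centres whose ball contains `x`. Any other such
  -- centre `i` is at distance less than `r_i / 2 + r_j / 2 ≤ r_j` from `j`, and there are fewer
  -- than `k` of those.
  obtain ⟨j, hj, hmax⟩ := A.exists_max_image (fun j => knnRadius k z j) h
  have hjA := (Finset.mem_filter.1 hj).2
  have h0 : 0 < knnRadius k z j := by
    have := dist_nonneg.trans_lt hjA
    rw [← NNReal.coe_pos]; linarith
  have h1 := card_lt_of_lt_knnRadius h0
  have h2 : (A.erase j).card < k := by
    refine lt_of_le_of_lt (Finset.card_le_card ?_) h1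
    intro i hi
    obtain ⟨hij, hiA⟩ := Finset.mem_erase.1 hi
    have hi2 := Finset.mem_filter.1 hiA
    refine Finset.mem_filter.2 ⟨Finset.mem_erase.2 ⟨hij, hi2.1⟩, ?_⟩
    have h3 := dist_triangle_left (z i).1 (z j).1 x
    have h4 : (knnRadius k z i : ℝ) ≤ knnRadius k z j := by exact_mod_cast hmax i hiA
    linarith [hi2.2]
  rw [Finset.card_erase_of_mem hj] at h2
  omega

lemma knnRadius_le_two_mul {k : ℕ} {z : Fin n → Obs d} {D : ℝ} (hD : 0 < D)
    (hz : ∀ j ∈ minority (labels z), ‖(z j).1‖ ≤ D) {j : Fin n} (hj : j ∈ minority (labels z)) :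
    (knnRadius k z j : ℝ) ≤ 2 * D := by
  rw [← Real.coe_toNNReal (2 * D) (by positivity), NNReal.coe_le_coe]
  refine Finset.sup_le fun l hl => ?_
  rw [← NNReal.coe_le_coe, coe_nndist, Real.coe_toNNReal _ (by positivity), dist_eq_norm]
  have := norm_sub_le (z l).1 (z j).1
  linarith [hz j hj, hz l (knn_subset_minority _ _ _ hl)]

/-- A packing bound for the nearest-neighbour radii of points of a ball. -/
lemma sum_knnRadius_pow_le {k : ℕ} {z : Fin n → Obs d} {D : ℝ} (hd : 0 < d) (hD : 0 < D)
    (hz : ∀ j ∈ minority (labels z), ‖(z j).1‖ ≤ D) :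
    ∑ j ∈ minority (labels z), (knnRadius k z j : ℝ) ^ d ≤ k * (4 * D) ^ d := by
  classical
  have : Nonempty (Fin d) := ⟨⟨0, hd⟩⟩
  have hball : ∀ (x : Cov d) {r : ℝ}, 0 ≤ r → volume (Metric.ball x r) =
      ENNReal.ofReal (r ^ d) * volume (Metric.ball (0 : Cov d) 1) := by
    intro x r hr
    rw [Measure.addHaar_ball _ _ hr, finrank_euclideanSpace_fin]
  have hsub : ∀ j ∈ minority (labels z),
      Metric.ball (z j).1 (knnRadius k z j / 2 : ℝ) ⊆ Metric.ball 0 (2 * D) := by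
    intro j hj
    refine Metric.ball_subset_ball' ?_
    rw [dist_zero_right]
    have := knnRadius_le_two_mul (k := k) hD hz hj
    linarith [hz j hj]
  -- The covering bound is integrated. The half balls lie in the ball of radius `2D`, because the
  -- centres have norm at most `D` and the radii are at most `2D`. Undoing the halving turns `2D`
  -- into `4D`.
  have h1 : ∑ j ∈ minority (labels z), volume (Metric.ball (z j).1 (knnRadius k z j / 2 : ℝ)) ≤
      k * volume (Metric.ball (0 : Cov d) (2 * D)) := by
    calc _ = ∫⁻ x, ∑ j ∈ minority (labels z),
          (Metric.ball (z j).1 (knnRadius k z j / 2 : ℝ)).indicator 1 x := by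
          rw [lintegral_finsetSum _ fun j _ => measurable_one.indicator measurableSet_ball]
          refine Finset.sum_congr rfl fun j _ => ?_
          rw [lintegral_indicator_one measurableSet_ball]
      _ ≤ ∫⁻ x, (Metric.ball (0 : Cov d) (2 * D)).indicator (fun _ => (k : ℝ≥0∞)) x := by
          refine lintegral_mono fun x => ?_
          by_cases hx : x ∈ Metric.ball (0 : Cov d) (2 * D)
          · rw [indicator_of_mem hx]
            calc _ = ((((minority (labels z)).filter fun j =>
                  dist x (z j).1 < knnRadius k z j / 2).card : ℕ) : ℝ≥0∞) := by
                  simp [indicator_apply, Metric.mem_ball]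
              _ ≤ _ := by exact_mod_cast card_filter_mem_ball_le z x
          · rw [indicator_of_notMem hx]
            refine le_of_eq (Finset.sum_eq_zero fun j hj => ?_)
            exact indicator_of_notMem (fun h => hx (hsub j hj h)) _
      _ = _ := by rw [lintegral_indicator_const measurableSet_ball]
  rw [hball 0 (by positivity)] at h1
  rw [Finset.sum_congr rfl fun j _ => hball (z j).1 (by positivity), ← Finset.sum_mul,
    ← mul_assoc, ENNReal.mul_le_mul_iff_left (Metric.measure_ball_pos _ _ one_pos).ne'
      measure_ball_lt_top.ne, ← ENNReal.ofReal_sum_of_nonneg fun j _ => by positivity,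
    ← ENNReal.ofReal_natCast, ← ENNReal.ofReal_mul (by positivity),
    ENNReal.ofReal_le_ofReal_iff (by positivity)] at h1
  have h2 : ∀ j, (knnRadius k z j / 2 : ℝ) ^ d = (knnRadius k z j : ℝ) ^ d / 2 ^ d :=
    fun j => div_pow _ _ _
  simp_rw [h2, ← Finset.sum_div] at h1
  rw [div_le_iff₀ (by positivity), mul_assoc, ← mul_pow] at h1
  rwa [show 2 * D * 2 = 4 * D by ring] at h1

/-- The mean nearest-neighbour radius over the minority class. -/
noncomputable def meanRadius (k : ℕ) (z : Fin n → Obs d) : ℝ :=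
  (numMin (labels z) : ℝ)⁻¹ * ∑ j ∈ minority (labels z), (knnRadius k z j : ℝ)

lemma meanRadius_nonneg (k : ℕ) (z : Fin n → Obs d) : 0 ≤ meanRadius k z := by
  unfold meanRadius; positivity

/-- The power-mean inequality converts the packing bound for the `d`-th powers into one for the
radii. No probability is involved. -/
lemma meanRadius_le {k : ℕ} {z : Fin n → Obs d} {D : ℝ} (hd : 0 < d) (hD : 0 < D)
    (hm : 0 < numMin (labels z)) (hz : ∀ j ∈ minority (labels z), ‖(z j).1‖ ≤ D) :
    meanRadius k z ≤ 4 * D * ((k : ℝ) / numMin (labels z)) ^ (1 / d : ℝ) := by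
  set m := numMin (labels z) with hmdef
  have hm' : (0 : ℝ) < m := by exact_mod_cast hm
  have h2 : meanRadius k z ^ d ≤ (k : ℝ) / m * (4 * D) ^ d := by
    have := Real.pow_arith_mean_le_arith_mean_pow (minority (labels z)) (fun _ => (m : ℝ)⁻¹)
      (fun j => (knnRadius k z j : ℝ)) (fun _ _ => by positivity)
      (by rw [Finset.sum_const, nsmul_eq_mul]; exact mul_inv_cancel₀ hm'.ne')
      (fun _ _ => by positivity) d
    rw [← Finset.mul_sum, ← Finset.mul_sum] at this
    refine this.trans ?_
    rw [div_mul_eq_mul_div, div_eq_inv_mul]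
    gcongr
    exact sum_knnRadius_pow_le hd hD hz
  have h3 : (4 * D * ((k : ℝ) / m) ^ (1 / d : ℝ)) ^ d = (k : ℝ) / m * (4 * D) ^ d := by
    rw [mul_pow, ← Real.rpow_natCast (_ ^ (1 / d : ℝ)), ← Real.rpow_mul (by positivity),
      one_div, inv_mul_cancel₀ (by positivity), Real.rpow_one, mul_comm]
  rw [← h3] at h2
  exact le_of_pow_le_pow_left₀ hd.ne' (by positivity) h2

end NearestNeighbours

/-! ### A Chernoff bound for the number of neighbours within a given distance. -/

section SmallBalls

variable {𝒳 : Type*} [MeasurableSpace 𝒳]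

/-- A Chernoff bound for the number of coordinates `l ∈ S` that are close to coordinate `j`. -/
lemma measure_card_filter_lt_le {n : ℕ} (ν : Fin n → Measure 𝒳) [∀ i, IsProbabilityMeasure (ν i)]
    (B : Set (𝒳 × 𝒳)) (hB : MeasurableSet B) [DecidablePred (· ∈ B)] (j : Fin n)
    (S : Finset (Fin n)) (hj : j ∉ S) {q : ℝ} (hq : q ≤ 1)
    (h : ∀ᵐ a ∂ν j, ∀ l ∈ S, ENNReal.ofReal q ≤ ν l {x | (x, a) ∈ B}) {k : ℕ} :
    Measure.pi ν {x | (S.filter fun l => (x l, x j) ∈ B).card < k} ≤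
      ENNReal.ofReal (2 ^ k / 2 * (1 - q / 2) ^ S.card) := by
  classical
  obtain _ | n := n
  · exact j.elim0
  set φ : 𝒳 × 𝒳 → ℝ≥0∞ := fun p => if p ∈ B then 2⁻¹ else 1 with hφ
  have hφm : Measurable φ := Measurable.ite hB measurable_const measurable_const
  set S' : Finset (Fin n) := Finset.univ.filter fun l => j.succAbove l ∈ S with hS'
  have hSS' : S = S'.map (Fin.succAboveEmb j) := by
    ext l
    simp only [hS', Finset.mem_map, Finset.mem_filter, Finset.mem_univ, true_and]
    constructor
    · intro hl
      obtain ⟨l', rfl⟩ := Fin.exists_succAbove_eq (x := l) (y := j) (fun h => hj (h ▸ hl))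
      exact ⟨l', hl, rfl⟩
    · rintro ⟨l', h, rfl⟩; exact h
  -- If `N` points are close, the indicator of `N < k` is at most `2^{k-1} 2^{-N}`, and `2^{-N}` is
  -- the product of the factors `φ`. Given coordinate `j` these factors are independent, with means
  -- at most `1 - q/2`.
  have hpoint : ∀ x : Fin (n + 1) → 𝒳,
      ({x | (S.filter fun l => (x l, x j) ∈ B).card < k} : Set _).indicator 1 x ≤
        (2 ^ k / 2 : ℝ≥0∞) * ∏ l ∈ S, φ (x l, x j) := by
    intro x
    by_cases hx : (S.filter fun l => (x l, x j) ∈ B).card < k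
    · rw [indicator_of_mem (by exact hx), Pi.one_apply]
      have h1 : ∏ l ∈ S, φ (x l, x j) = 2⁻¹ ^ (S.filter fun l => (x l, x j) ∈ B).card := by
        simp only [hφ]
        rw [Finset.prod_ite]
        simp
      rw [h1]
      obtain ⟨c, hc⟩ : ∃ c, k = (S.filter fun l => (x l, x j) ∈ B).card + 1 + c :=
        ⟨k - ((S.filter fun l => (x l, x j) ∈ B).card + 1), by omega⟩
      set N := (S.filter fun l => (x l, x j) ∈ B).card
      have h2 : (2 ^ k / 2 : ℝ≥0∞) * 2⁻¹ ^ N = 2 ^ c := by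
        rw [hc, pow_add, pow_add, pow_one, ← ENNReal.inv_pow, div_eq_mul_inv]
        calc (2 : ℝ≥0∞) ^ N * 2 * 2 ^ c * 2⁻¹ * (2 ^ N)⁻¹ =
            (2 ^ N * (2 ^ N)⁻¹) * (2 * 2⁻¹) * 2 ^ c := by ring
          _ = 2 ^ c := by
            rw [ENNReal.mul_inv_cancel (by positivity) (by simp),
              ENNReal.mul_inv_cancel (by simp) (by simp), one_mul, one_mul]
      rw [h2]
      exact one_le_pow₀ (by norm_num)
    · rw [indicator_of_notMem (by exact hx)]; simp
  have hmeasS : MeasurableSet {x : Fin (n + 1) → 𝒳 |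
      (S.filter fun l => (x l, x j) ∈ B).card < k} := by
    have : Measurable fun x : Fin (n + 1) → 𝒳 => ∑ l ∈ S, if (x l, x j) ∈ B then 1 else 0 :=
      Finset.measurable_sum _ fun l _ => Measurable.ite
        ((by fun_prop : Measurable fun x : Fin (n + 1) → 𝒳 => (x l, x j)) hB)
        measurable_const measurable_const
    simp only [Finset.card_filter]
    exact measurableSet_lt this measurable_const
  have hprodm : Measurable fun x : Fin (n + 1) → 𝒳 => ∏ l ∈ S, φ (x l, x j) :=
    Finset.measurable_prod _ fun l _ => hφm.comp (by fun_prop)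
  have hq' : ∀ᵐ a ∂ν j, ∀ l ∈ S, ∫⁻ x, φ (x, a) ∂ν l ≤ ENNReal.ofReal (1 - q / 2) := by
    filter_upwards [h] with a ha l hl
    have hset : MeasurableSet {x | (x, a) ∈ B} := measurable_prodMk_right hB
    have e1 : ∫⁻ x, φ (x, a) ∂ν l = 2⁻¹ * ν l {x | (x, a) ∈ B} + ν l {x | (x, a) ∈ B}ᶜ := by
      have : ∀ x, φ (x, a) = {x | (x, a) ∈ B}.indicator (fun _ => 2⁻¹) x +
          {x | (x, a) ∈ B}ᶜ.indicator (fun _ => 1) x := by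
        intro x
        by_cases hx : (x, a) ∈ B <;> simp [hφ, hx]
      simp_rw [this]
      rw [lintegral_add_left (measurable_const.indicator hset), lintegral_indicator_const hset,
        lintegral_indicator_const hset.compl, one_mul]
    set p := (ν l).real {x | (x, a) ∈ B} with hp
    have hpe : ν l {x | (x, a) ∈ B} = ENNReal.ofReal p := by simp [hp]
    have hp1 : p ≤ 1 := measureReal_le_one
    have hp0 : 0 ≤ p := measureReal_nonneg
    have hqp : q ≤ p := by
      have := ha l hl
      rw [hpe] at this
      exact (ENNReal.ofReal_le_ofReal_iff hp0).1 this
    rw [e1, prob_compl_eq_one_sub hset, hpe, ← ENNReal.ofReal_one, ← ENNReal.ofReal_sub _ hp0,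
      show (2⁻¹ : ℝ≥0∞) = ENNReal.ofReal (2⁻¹) by
        rw [ENNReal.ofReal_inv_of_pos (by norm_num)]; simp,
      ← ENNReal.ofReal_mul (by norm_num), ← ENNReal.ofReal_add (by positivity) (by linarith)]
    exact ENNReal.ofReal_le_ofReal (by linarith)
  calc Measure.pi ν {x | (S.filter fun l => (x l, x j) ∈ B).card < k}
      = ∫⁻ x, ({x | (S.filter fun l => (x l, x j) ∈ B).card < k} : Set _).indicator 1 x
          ∂Measure.pi ν := (lintegral_indicator_one hmeasS).symm
    _ ≤ ∫⁻ x, (2 ^ k / 2 : ℝ≥0∞) * ∏ l ∈ S, φ (x l, x j) ∂Measure.pi ν := lintegral_mono hpoint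
    _ = (2 ^ k / 2 : ℝ≥0∞) * ∫⁻ x, ∏ l ∈ S, φ (x l, x j) ∂Measure.pi ν :=
        lintegral_const_mul _ hprodm
    _ = (2 ^ k / 2 : ℝ≥0∞) * ∫⁻ a, ∫⁻ x', ∏ l ∈ S', φ (x' l, a)
          ∂Measure.pi (fun l => ν (j.succAbove l)) ∂ν j := by
        congr 1
        have hm2 : Measurable fun a : 𝒳 × (Fin n → 𝒳) => ∏ l ∈ S,
            φ ((MeasurableEquiv.piFinSuccAbove (fun _ => 𝒳) j).symm a l,
              (MeasurableEquiv.piFinSuccAbove (fun _ => 𝒳) j).symm a j) :=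
          hprodm.comp (MeasurableEquiv.measurable _)
        rw [← (measurePreserving_piFinSuccAbove ν j).symm.lintegral_comp hprodm,
          lintegral_prod _ hm2.aemeasurable]
        refine lintegral_congr fun a => lintegral_congr fun x' => ?_
        rw [hSS', Finset.prod_map]
        refine Finset.prod_congr rfl fun l _ => ?_
        simp [MeasurableEquiv.piFinSuccAbove_symm_apply, Fin.insertNthEquiv]
    _ ≤ (2 ^ k / 2 : ℝ≥0∞) * ∫⁻ a, ENNReal.ofReal (1 - q / 2) ^ S.card ∂ν j := by
        gcongr 1
        refine lintegral_mono_ae ?_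
        filter_upwards [hq'] with a ha
        rw [ProbabilityTheory.lintegral_prod_eq_prod_lintegral_of_indepFun S'
          (fun l (x' : Fin n → 𝒳) => φ (x' l, a))
          (ProbabilityTheory.iIndepFun_pi (μ := fun l => ν (j.succAbove l))
            (X := fun _ x => φ (x, a)) fun l => (hφm.comp measurable_prodMk_right).aemeasurable)
          fun l => (hφm.comp measurable_prodMk_right).comp (measurable_pi_apply l)]
        rw [hSS', Finset.card_map]
        refine Finset.prod_le_pow_card _ _ _ fun l hl => ?_
        rw [lintegral_pi_eval (fun l => ν (j.succAbove l)) l (g := fun x => φ (x, a))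
          (hφm.comp measurable_prodMk_right)]
        exact ha _ (Finset.mem_filter.1 hl).2
    _ = _ := by
        rw [lintegral_const, measure_univ, mul_one, ENNReal.ofReal_mul (by positivity),
          ENNReal.ofReal_pow (by linarith), ENNReal.ofReal_div_of_pos (by norm_num)]
        simp

/-- The factor `1/2 ≤ exp (-1/2)` compensates for there being only `m - 1` other points: since `q ≤
1`, the exponent `-1/2 - q (m - 1) / 2` is at most `-q m / 2`. Half of the assumed lower bound on `q
m` then absorbs `2^k ≤ exp k` and leaves at least the logarithm of `32 m / δ`. The bound `δ / (32
m)` anticipates a union over `m` base points. -/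
lemma small_ball_numerics {d k m : ℕ} (hd : 0 < d) (hm : 0 < m) {δ q : ℝ} (hδ0 : 0 < δ)
    (hδ1 : δ < 1) (hq1 : q ≤ 1)
    (hq : 3 * k + 4 * d * Real.log (32 * m / δ) ≤ q * m) :
    (2 : ℝ) ^ k / 2 * (1 - q / 2) ^ (m - 1) ≤ δ / (32 * m) := by
  have hm' : (1 : ℝ) ≤ m := by exact_mod_cast hm
  have hd' : (1 : ℝ) ≤ d := by exact_mod_cast hd
  set x := 32 * (m : ℝ) / δ with hx
  have hx1 : 1 ≤ x := by rw [hx, le_div_iff₀ hδ0]; nlinarith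
  have hlog : 0 ≤ Real.log x := Real.log_nonneg hx1
  have h1 : (1 - q / 2) ^ (m - 1) ≤ Real.exp (-(q * (m - 1) / 2)) := by
    calc (1 - q / 2) ^ (m - 1) ≤ Real.exp (-(q / 2)) ^ (m - 1) :=
          pow_le_pow_left₀ (by linarith) (by linarith [Real.add_one_le_exp (-(q / 2))]) _
      _ = _ := by
        rw [← Real.exp_nat_mul, Nat.cast_sub hm, Nat.cast_one]; congr 1; ring
  have h2 : (2 : ℝ) ^ k ≤ Real.exp k := by
    calc (2 : ℝ) ^ k ≤ Real.exp 1 ^ k := by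
          gcongr; linarith [Real.add_one_le_exp (1 : ℝ)]
      _ = _ := by rw [← Real.exp_nat_mul, mul_one]
  have h3 : (1 : ℝ) / 2 ≤ Real.exp (-(1 / 2)) := by linarith [Real.add_one_le_exp (-(1 / 2 : ℝ))]
  have h4 : δ / (32 * m) = Real.exp (-Real.log x) := by
    rw [Real.exp_neg, Real.exp_log (by positivity), hx, inv_div]
  rw [h4]
  have h5 : (2 : ℝ) ^ k / 2 * (1 - q / 2) ^ (m - 1) ≤
      Real.exp k * Real.exp (-(1 / 2)) * Real.exp (-(q * (m - 1) / 2)) := by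
    rw [div_eq_mul_one_div]
    have : 0 ≤ 1 - q / 2 := by linarith
    gcongr
  refine h5.trans ?_
  rw [← Real.exp_add, ← Real.exp_add, Real.exp_le_exp]
  have h6 : Real.log x ≤ d * Real.log x := le_mul_of_one_le_left hlog hd'
  have : (0 : ℝ) ≤ k := by positivity
  nlinarith

end SmallBalls

/-! ### Complexities and means of coupled laws. -/

section Transport

variable {ι κ 𝒜 𝒳 : Type*} [Countable ι] [Fintype κ] [DecidableEq κ] [MeasurableSpace 𝒜]
  [MeasurableSpace 𝒳] {V : ι → 𝒳 → ℝ} {V' : ι → 𝒜 → ℝ}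

lemma radInt_map (hV : ∀ f, Measurable (V f)) (ν : Measure 𝒜) [IsProbabilityMeasure ν]
    {g : 𝒜 → 𝒳} (hg : Measurable g) :
    radInt V κ (ν.map g) = radInt (fun f a => V f (g a)) κ ν := by
  have : IsProbabilityMeasure (ν.map g) := Measure.isProbabilityMeasure_map hg.aemeasurable
  exact ((measurePreserving_pi (fun _ : κ => ν) (fun _ => ν.map g)
    fun _ => hg.measurePreserving ν).lintegral_comp (measurable_rad_eval hV)).symm

omit [Countable ι] in
lemma radInt_congr_ae (ν : Measure 𝒳) [IsProbabilityMeasure ν] {V₂ : ι → 𝒳 → ℝ}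
    (h : ∀ᵐ x ∂ν, ∀ f, V f x = V₂ f x) : radInt V κ ν = radInt V₂ κ ν := by
  refine lintegral_congr_ae ?_
  filter_upwards [eventually_all.2 fun i => ae_pi_eval (fun _ : κ => ν) i h] with x hx
  congr 1
  ext i f
  exact hx i f

/-- Coupled laws have close Rademacher complexities. -/
lemma radInt_snd_le (hV : ∀ f, Measurable (V f)) (hV' : ∀ f, Measurable (V' f))
    (σ : Measure (𝒜 × 𝒳)) [IsProbabilityMeasure σ] {c : 𝒜 → ℝ≥0∞} (hc : Measurable c)
    (h : ∀ᵐ p ∂σ, supE (fun f => V f p.2 - V' f p.1) ≤ c p.1) :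
    radInt V κ (σ.map Prod.snd) ≤
      radInt V' κ (σ.map Prod.fst) + Fintype.card κ * ∫⁻ a, c a ∂(σ.map Prod.fst) := by
  rw [radInt_map hV σ measurable_snd, radInt_map hV' σ measurable_fst,
    lintegral_map hc measurable_fst]
  have hm1 : Measurable fun x : κ → 𝒜 × 𝒳 => rad (fun i f => V' f (x i).1) :=
    measurable_rad fun i f => (hV' f).comp (by fun_prop)
  have hm2 : ∀ i, Measurable fun x : κ → 𝒜 × 𝒳 => c (x i).1 := fun i => hc.comp (by fun_prop)
  calc radInt (fun f (p : 𝒜 × 𝒳) => V f p.2) κ σ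
      ≤ ∫⁻ x : κ → 𝒜 × 𝒳, (rad (fun i f => V' f (x i).1) + ∑ i, c (x i).1)
          ∂Measure.pi fun _ => σ := by
        refine lintegral_mono_ae ?_
        filter_upwards [eventually_all.2 fun i => ae_pi_eval (fun _ : κ => σ) i h] with x hx
        refine (rad_le_add_sum _ (fun i f => V' f (x i).1)).trans ?_
        gcongr with i
        exact hx i
    _ = _ := by
        rw [lintegral_add_left hm1, lintegral_finsetSum _ fun i _ => hm2 i]
        congr 1
        rw [Finset.sum_congr rfl fun i _ => lintegral_pi_eval (fun _ : κ => σ) i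
          (g := fun p => c p.1) (hc.comp measurable_fst)]
        simp

omit [Countable ι] in
lemma supE_integral_snd_sub_le (hV : ∀ f, Measurable (V f)) (hV' : ∀ f, Measurable (V' f))
    (σ : Measure (𝒜 × 𝒳)) [IsProbabilityMeasure σ] {c : 𝒜 → ℝ≥0∞} (hc : Measurable c)
    (h : ∀ᵐ p ∂σ, supE (fun f => V f p.2 - V' f p.1) ≤ c p.1)
    (hi : ∀ f, Integrable (V f) (σ.map Prod.snd)) (hi' : ∀ f, Integrable (V' f) (σ.map Prod.fst)) :
    supE (fun f => ∫ x, V f x ∂(σ.map Prod.snd) - ∫ a, V' f a ∂(σ.map Prod.fst)) ≤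
      ∫⁻ a, c a ∂(σ.map Prod.fst) := by
  refine supE_le fun f => ?_
  rw [integral_map measurable_snd.aemeasurable (hV f).aestronglyMeasurable,
    integral_map measurable_fst.aemeasurable (hV' f).aestronglyMeasurable,
    lintegral_map hc measurable_fst]
  have h1 : Integrable (fun p : 𝒜 × 𝒳 => V f p.2) σ :=
    (integrable_map_measure (hV f).aestronglyMeasurable measurable_snd.aemeasurable).1 (hi f)
  have h2 : Integrable (fun p : 𝒜 × 𝒳 => V' f p.1) σ :=
    (integrable_map_measure (hV' f).aestronglyMeasurable measurable_fst.aemeasurable).1 (hi' f)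
  rw [← integral_sub h1 h2]
  refine (enorm_integral_le_lintegral_enorm _).trans (lintegral_mono_ae ?_)
  filter_upwards [h] with p hp
  exact (le_supE (fun f => V f p.2 - V' f p.1) f).trans hp

end Transport

/-! ### The uniform law on a finite type. -/

section Uniform

variable {ι κ : Type*} [Fintype κ] [MeasurableSpace κ] [DiscreteMeasurableSpace κ]

/-- The uniform law on a finite type. -/
noncomputable def unif (κ : Type*) [Fintype κ] [MeasurableSpace κ] : Measure κ :=
  (Fintype.card κ : ℝ≥0∞)⁻¹ • ∑ a, Measure.dirac a

instance [Nonempty κ] : IsProbabilityMeasure (unif κ) := ⟨by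
  simp only [unif, Measure.smul_apply, Measure.finsetSum_apply, measure_univ, smul_eq_mul]
  rw [Finset.sum_const, Finset.card_univ, nsmul_eq_mul, mul_one]
  exact ENNReal.inv_mul_cancel (by simp) (by simp)⟩

omit [DiscreteMeasurableSpace κ] in
lemma lintegral_unif [MeasurableSingletonClass κ] (g : κ → ℝ≥0∞) :
    ∫⁻ a, g a ∂unif κ = (Fintype.card κ : ℝ≥0∞)⁻¹ * ∑ a, g a := by
  simp [unif, lintegral_finsetSum_measure]

lemma integral_unif (g : κ → ℝ) :
    ∫ a, g a ∂unif κ = (Fintype.card κ : ℝ)⁻¹ * ∑ a, g a := by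
  rw [unif, integral_smul_measure, integral_finsetSum_measure fun _ _ => integrable_dirac (by simp)]
  simp

lemma unif_singleton (a : κ) : unif κ {a} = (Fintype.card κ : ℝ≥0∞)⁻¹ := by
  classical
  simp [unif, indicator_apply]

lemma radInt_unif [Nonempty κ] (V : ι → κ → ℝ) (J : ℕ) :
    radInt V (Fin J) (unif κ) =
      ((Fintype.card κ : ℝ≥0∞) ^ J)⁻¹ * ∑ j : Fin J → κ, rad ((fun a f => V f a) ∘ j) := by
  classical
  rw [radInt, lintegral_fintype, mul_comm, Finset.sum_mul]
  refine Finset.sum_congr rfl fun j _ => ?_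
  rw [Measure.pi_singleton]
  simp only [unif_singleton, Finset.prod_const, Finset.card_univ, Fintype.card_fin,
    ENNReal.inv_pow]
  rfl

end Uniform

/-! ### The SMOTE law and its coupling with the base point. -/

section Smote

variable {d n : ℕ}

/-- The law of one SMOTE sample given the data and the base point `j`. -/
noncomputable def smoteAt (k : ℕ) (z : Fin n → Obs d) (j : Fin n) : Measure (Cov d) :=
  (k : ℝ≥0∞)⁻¹ • ∑ l ∈ knn k z j,
    (volume.restrict (Icc (0 : ℝ) 1)).map fun t => (z j).1 + t • ((z l).1 - (z j).1)

lemma measurable_segment (x v : Cov d) : Measurable fun t : ℝ => x + t • v := by fun_prop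

instance : IsProbabilityMeasure (volume.restrict (Icc (0 : ℝ) 1)) := ⟨by simp⟩

lemma isProbabilityMeasure_smoteAt {k : ℕ} {z : Fin n → Obs d} {j : Fin n} (hk : 0 < k)
    (hj : j ∈ minority (labels z)) (hkm : k < numMin (labels z)) :
    IsProbabilityMeasure (smoteAt k z j) := ⟨by
  have : ∀ l, ((volume.restrict (Icc (0 : ℝ) 1)).map
      fun t => (z j).1 + t • ((z l).1 - (z j).1)) univ = 1 := fun l => by
    rw [Measure.map_apply (measurable_segment _ _) MeasurableSet.univ]; simp
  simp only [smoteAt, Measure.smul_apply, Measure.finsetSum_apply, smul_eq_mul, this]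
  rw [Finset.sum_const, card_knn hj hkm, nsmul_eq_mul, mul_one]
  exact ENNReal.inv_mul_cancel (by simp; omega) (by simp)⟩

/-- Properties of all points of the segments from `j` to its neighbours hold almost surely. -/
lemma ae_smoteAt {k : ℕ} {z : Fin n → Obs d} {j : Fin n} {p : Cov d → Prop}
    (hp : MeasurableSet {x | p x})
    (h : ∀ l ∈ knn k z j, ∀ t ∈ Icc (0 : ℝ) 1, p ((z j).1 + t • ((z l).1 - (z j).1))) :
    ∀ᵐ x ∂smoteAt k z j, p x := by
  refine Measure.ae_smul_measure ?_ _
  rw [ae_finsetSum_measure_iff]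
  intro l hl
  rw [ae_map_iff (measurable_segment _ _).aemeasurable hp]
  exact (ae_restrict_iff' measurableSet_Icc).2 (ae_of_all _ fun t ht => h l hl t ht)

/-- The joint law of the base point and the synthetic point. -/
noncomputable def smoteCoupling (k : ℕ) (z : Fin n → Obs d) :
    Measure (minority (labels z) × Cov d) :=
  (numMin (labels z) : ℝ≥0∞)⁻¹ • ∑ j : minority (labels z),
    (smoteAt k z j).map fun x => (j, x)

lemma map_snd_smoteCoupling (k : ℕ) (z : Fin n → Obs d) :
    (smoteCoupling k z).map Prod.snd = smote k z := by
  rw [smoteCoupling, smote, Measure.map_smul, Measure.map_finset_sum measurable_snd.aemeasurable]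
  congr 1
  rw [← Finset.sum_coe_sort (minority (labels z))]
  refine Finset.sum_congr rfl fun j _ => ?_
  rw [Measure.map_map measurable_snd measurable_prodMk_left]
  simp [Function.comp_def, smoteAt]

variable {k : ℕ} {z : Fin n → Obs d}

lemma map_fst_smoteCoupling (hk : 0 < k) (hkm : k < numMin (labels z)) :
    (smoteCoupling k z).map Prod.fst = unif (minority (labels z)) := by
  rw [smoteCoupling, unif, Measure.map_smul, Measure.map_finset_sum measurable_fst.aemeasurable,
    Fintype.card_coe, numMin]
  congr 1
  refine Finset.sum_congr rfl fun j _ => ?_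
  have := isProbabilityMeasure_smoteAt hk j.2 hkm
  rw [Measure.map_map measurable_fst measurable_prodMk_left]
  simp [Function.comp_def]

lemma nonempty_minority (hkm : k < numMin (labels z)) : Nonempty (minority (labels z)) := by
  have : (minority (labels z)).Nonempty := Finset.card_pos.1 (lt_of_le_of_lt (Nat.zero_le k) hkm)
  exact this.to_subtype

lemma isProbabilityMeasure_smoteCoupling (hk : 0 < k) (hkm : k < numMin (labels z)) :
    IsProbabilityMeasure (smoteCoupling k z) := by
  have := nonempty_minority hkm
  have h : IsProbabilityMeasure ((smoteCoupling k z).map Prod.fst) := by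
    rw [map_fst_smoteCoupling hk hkm]; infer_instance
  exact Measure.isProbabilityMeasure_of_map (f := Prod.fst)

lemma isProbabilityMeasure_smote (hk : 0 < k) (hkm : k < numMin (labels z)) :
    IsProbabilityMeasure (smote k z) := by
  have := isProbabilityMeasure_smoteCoupling hk hkm
  rw [← map_snd_smoteCoupling]
  exact Measure.isProbabilityMeasure_map measurable_snd.aemeasurable

lemma ae_smoteCoupling {p : minority (labels z) × Cov d → Prop}
    (hp : ∀ j, MeasurableSet {x | p (j, x)})
    (h : ∀ j : minority (labels z), ∀ l ∈ knn k z j, ∀ t ∈ Icc (0 : ℝ) 1,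
      p (j, (z j).1 + t • ((z l).1 - (z j).1))) :
    ∀ᵐ q ∂smoteCoupling k z, p q := by
  refine Measure.ae_smul_measure ?_ _
  rw [ae_finsetSum_measure_iff]
  intro j _
  have hpm : MeasurableSet {q | p q} := by
    have : {q | p q} = ⋃ j, Prod.fst ⁻¹' {j} ∩ Prod.snd ⁻¹' {x | p (j, x)} := by
      ext ⟨j, x⟩; simp
    rw [this]
    exact MeasurableSet.iUnion fun j =>
      (measurable_fst (measurableSet_singleton j)).inter (measurable_snd (hp j))
  rw [ae_map_iff measurable_prodMk_left.aemeasurable hpm]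
  exact ae_smoteAt (hp j) (h j)

/-- Synthetic points lie in the convex hull of any set that contains the minority points. -/
lemma ae_smote_mem_convexHull {K : Set (Cov d)}
    (hz : ∀ j ∈ minority (labels z), (z j).1 ∈ K) : ∀ᵐ x ∂smote k z, x ∈ convexHull ℝ K := by
  -- The hull of the finite set `T` is compact, hence measurable, whereas that of `K` need not be.
  set T : Set (Cov d) := (fun j => (z j).1) '' (minority (labels z) : Set (Fin n)) with hT
  have hm : MeasurableSet (convexHull ℝ T) :=
    (((Finset.finite_toSet _).image _).isCompact_convexHull ℝ).isClosed.measurableSet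
  have hTK : convexHull ℝ T ⊆ convexHull ℝ K := by
    refine convexHull_mono ?_
    rintro _ ⟨j, hj, rfl⟩
    exact hz j hj
  suffices h : ∀ᵐ x ∂smote k z, x ∈ convexHull ℝ T from h.mono fun x hx => hTK hx
  rw [← map_snd_smoteCoupling, ae_map_iff (p := fun x => x ∈ convexHull ℝ T)
    measurable_snd.aemeasurable hm]
  refine ae_smoteCoupling (fun j => hm) fun j l hl t ht => ?_
  have h1 := subset_convexHull ℝ T (mem_image_of_mem (fun j => (z j).1) j.2)
  have h2 := subset_convexHull ℝ T (mem_image_of_mem (fun j => (z j).1)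
    (knn_subset_minority _ _ _ hl))
  exact (convex_convexHull ℝ T).add_smul_sub_mem h1 h2 ht

section Lipschitz

variable {ι : Type*} [Countable ι] {V : ι → Cov d → ℝ} {K : Set (Cov d)} {L : ℝ}

/-- A synthetic point is on the segment from its base point to one of the nearest neighbours, hence
within the radius, and the segment stays in the hull, where the Lipschitz bound holds. -/
lemma ae_supE_sub_le (hV : ∀ f, Measurable (V f)) (hL : 0 ≤ L)
    (hLip : ∀ f, ∀ x ∈ convexHull ℝ K, ∀ x' ∈ convexHull ℝ K, |V f x - V f x'| ≤ L * ‖x - x'‖)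
    (hz : ∀ j ∈ minority (labels z), (z j).1 ∈ K) :
    ∀ᵐ q ∂smoteCoupling k z, supE (fun f => V f q.2 - V f (z q.1).1) ≤
      ENNReal.ofReal (L * knnRadius k z q.1) := by
  refine ae_smoteCoupling (fun j => ?_) fun j l hl t ht => ?_
  · dsimp only
    exact measurableSet_le (measurable_supE fun f => (hV f).sub_const _)
      (measurable_const (a := ENNReal.ofReal (L * knnRadius k z j)))
  · have h1 := subset_convexHull ℝ K (hz j j.2)
    have h2 := subset_convexHull ℝ K (hz l (knn_subset_minority _ _ _ hl))
    refine supE_le_ofReal fun f => (hLip f _ ((convex_convexHull ℝ K).add_smul_sub_mem h1 h2 ht)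
      _ h1).trans ?_
    gcongr
    rw [add_sub_cancel_left, norm_smul, Real.norm_of_nonneg ht.1, ← dist_eq_norm]
    have := dist_le_knnRadius hl
    calc t * dist (z l).1 (z j).1 ≤ 1 * dist (z l).1 (z j).1 := by gcongr; exact ht.2
      _ ≤ _ := by rw [one_mul]; exact this

lemma lintegral_knnRadius (hL : 0 ≤ L) :
    ∫⁻ j : minority (labels z), ENNReal.ofReal (L * knnRadius k z j) ∂unif (minority (labels z)) =
      ENNReal.ofReal (L * meanRadius k z) := by
  rw [lintegral_unif, Finset.sum_coe_sort (minority (labels z))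
    (fun j => ENNReal.ofReal (L * knnRadius k z j)),
    ← ENNReal.ofReal_sum_of_nonneg fun j _ => by positivity, ← Finset.mul_sum, meanRadius,
    mul_left_comm, Fintype.card_coe, ← numMin]
  rcases Nat.eq_zero_or_pos (numMin (labels z)) with h | h
  · have : minority (labels z) = ∅ := Finset.card_eq_zero.1 h
    simp [this]
  · rw [ENNReal.ofReal_mul (p := (numMin (labels z) : ℝ)⁻¹) (by positivity),
      ENNReal.ofReal_inv_of_pos (by exact_mod_cast h), ENNReal.ofReal_natCast]

/-- The complexity for the SMOTE law is at most that of a bootstrap sample, up to the mean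
nearest-neighbour radius. -/
lemma radInt_smote_le (hV : ∀ f, Measurable (V f)) (hL : 0 ≤ L)
    (hLip : ∀ f, ∀ x ∈ convexHull ℝ K, ∀ x' ∈ convexHull ℝ K, |V f x - V f x'| ≤ L * ‖x - x'‖)
    (hz : ∀ j ∈ minority (labels z), (z j).1 ∈ K) (hk : 0 < k) (hkm : k < numMin (labels z))
    (J : ℕ) :
    radInt V (Fin J) (smote k z) ≤
      radInt (fun f (j : minority (labels z)) => V f (z j).1) (Fin J) (unif _) +
        J * ENNReal.ofReal (L * meanRadius k z) := by
  have := nonempty_minority hkm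
  have := isProbabilityMeasure_smoteCoupling hk hkm
  have h := radInt_snd_le (κ := Fin J) hV
    (V' := fun f (j : minority (labels z)) => V f (z j).1) (fun f => measurable_of_finite _)
    (smoteCoupling k z) (c := fun j => ENNReal.ofReal (L * knnRadius k z j))
    (measurable_of_finite _) (ae_supE_sub_le hV hL hLip hz)
  rw [map_snd_smoteCoupling, map_fst_smoteCoupling hk hkm, lintegral_knnRadius hL,
    Fintype.card_fin] at h
  exact h

lemma supE_integral_smote_sub_le (hV : ∀ f, Measurable (V f)) (hL : 0 ≤ L)
    (hLip : ∀ f, ∀ x ∈ convexHull ℝ K, ∀ x' ∈ convexHull ℝ K, |V f x - V f x'| ≤ L * ‖x - x'‖)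
    (hz : ∀ j ∈ minority (labels z), (z j).1 ∈ K) (hk : 0 < k) (hkm : k < numMin (labels z))
    (hi : ∀ f, Integrable (V f) (smote k z)) :
    supE (fun f => ∫ x, V f x ∂smote k z -
      (numMin (labels z) : ℝ)⁻¹ * ∑ j ∈ minority (labels z), V f (z j).1) ≤
      ENNReal.ofReal (L * meanRadius k z) := by
  have := nonempty_minority hkm
  have := isProbabilityMeasure_smoteCoupling hk hkm
  have h := supE_integral_snd_sub_le hV
    (V' := fun f (j : minority (labels z)) => V f (z j).1) (fun f => measurable_of_finite _)
    (smoteCoupling k z) (c := fun j => ENNReal.ofReal (L * knnRadius k z j))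
    (measurable_of_finite _) (ae_supE_sub_le hV hL hLip hz)
    (by rwa [map_snd_smoteCoupling])
    (fun f => by rw [map_fst_smoteCoupling hk hkm]; exact Integrable.of_finite)
  rw [map_snd_smoteCoupling, map_fst_smoteCoupling hk hkm, lintegral_knnRadius hL] at h
  simp_rw [integral_unif] at h
  rw [Fintype.card_coe] at h
  convert h using 4
  rw [← Finset.sum_coe_sort (minority (labels z))]
  rfl

end Lipschitz

end Smote

/-! ### Concentration for empirical means and bootstrap complexities over a subset of the
coordinates. -/

section Samples

variable {ι 𝒳 : Type*} [Countable ι] [MeasurableSpace 𝒳] {n : ℕ}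

/-- The uniform deviation of a sum of independent terms from its mean. -/
noncomputable def sampleDev (U : Fin n → ι → 𝒳 → ℝ) (ν : Fin n → Measure 𝒳) (x : Fin n → 𝒳) :
    ℝ≥0∞ :=
  supE fun f => ∑ i, (U i f (x i) - ∫ a, U i f a ∂ν i)

lemma measurable_sampleDev {U : Fin n → ι → 𝒳 → ℝ} (hU : ∀ i f, Measurable (U i f))
    (ν : Fin n → Measure 𝒳) : Measurable (sampleDev U ν) :=
  measurable_supE fun f => Finset.measurable_sum _ fun i _ =>
    ((hU i f).comp (measurable_pi_apply i)).sub_const _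

/-- Concentration of the uniform deviation. -/
lemma measure_sampleDev_gt_le {U : Fin n → ι → 𝒳 → ℝ} (hU : ∀ i f, Measurable (U i f))
    (ν : Fin n → Measure 𝒳) [∀ i, IsProbabilityMeasure (ν i)] {β : Fin n → ℝ} (hβ : ∀ i, 0 ≤ β i)
    (hb : ∀ i f x, |U i f x| ≤ β i) {σ t : ℝ} (hσ : 0 < σ) (hs : ∑ i, (2 * β i) ^ 2 ≤ σ)
    (ht : 0 ≤ t) :
    Measure.pi ν {x | (∫⁻ y, sampleDev U ν y ∂Measure.pi ν) + ENNReal.ofReal t <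
      sampleDev U ν x} ≤ ENNReal.ofReal (Real.exp (-2 * t ^ 2 / σ)) := by
  have hint : ∀ i f, |∫ a, U i f a ∂ν i| ≤ β i := fun i f => by
    have := norm_integral_le_of_norm_le_const (μ := ν i) (f := U i f) (C := β i)
      (ae_of_all _ (hb i f))
    simpa using this
  refine measure_gt_le_of_update ν (measurable_sampleDev hU ν) (fun x => ?_)
    (fun i => mul_nonneg zero_le_two (hβ i)) (fun x i a => ?_) hσ hs ht
  · refine ne_top_of_le_ne_top (ENNReal.ofReal_ne_top (r := ∑ i, (2 * β i))) ?_
    refine supE_le_ofReal fun f => (Finset.abs_sum_le_sum_abs _ _).trans ?_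
    refine Finset.sum_le_sum fun i _ => (abs_sub _ _).trans ?_
    linarith [hb i f (x i), hint i f]
  · have : (fun f => ∑ i, (U i f (x i) - ∫ a, U i f a ∂ν i)) =
        (fun f => ∑ j, (U j f (Function.update x i a j) - ∫ a, U j f a ∂ν j)) +
          fun f => U i f (x i) - U i f a := by
      ext f
      simp only [Pi.add_apply]
      rw [← Finset.add_sum_erase _ _ (Finset.mem_univ i),
        ← Finset.add_sum_erase Finset.univ (fun j => U j f (Function.update x i a j) - _)
          (Finset.mem_univ i), Function.update_self]
      have : ∑ j ∈ Finset.univ.erase i, (U j f (Function.update x i a j) - ∫ a, U j f a ∂ν j) =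
          ∑ j ∈ Finset.univ.erase i, (U j f (x j) - ∫ a, U j f a ∂ν j) :=
        Finset.sum_congr rfl fun j hj => by
          rw [Function.update_of_ne (Finset.ne_of_mem_erase hj)]
      rw [this]; ring
    rw [sampleDev, this]
    refine (supE_add_le _ _).trans (add_le_add le_rfl (supE_le_ofReal fun f => ?_))
    refine (abs_sub _ _).trans ?_
    linarith [hb i f (x i), hb i f a]

lemma lintegral_sampleDev_le {U : Fin n → ι → 𝒳 → ℝ} (hU : ∀ i f, Measurable (U i f))
    (ν : Fin n → Measure 𝒳) [∀ i, IsProbabilityMeasure (ν i)] {β : Fin n → ℝ}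
    (hb : ∀ i f x, |U i f x| ≤ β i) :
    ∫⁻ x, sampleDev U ν x ∂Measure.pi ν ≤ 2 * ∫⁻ x, rad (fun i f => U i f (x i)) ∂Measure.pi ν :=
  lintegral_supE_sum_sub_le ν U hU fun i f =>
    Integrable.of_bound (hU i f).aestronglyMeasurable (β i) (ae_of_all _ (hb i f))

variable {V : ι → 𝒳 → ℝ} {P : Measure 𝒳} {b : ℝ}

lemma radInt_equiv [IsProbabilityMeasure P] {κ κ' : Type*} [Fintype κ] [DecidableEq κ] [Fintype κ'] [DecidableEq κ']
    (hV : ∀ f, Measurable (V f)) (e : κ ≃ κ') : radInt V κ P = radInt V κ' P :=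
  le_antisymm (radInt_mono hV P e e.injective) (radInt_mono hV P e.symm e.symm.injective)

lemma lintegral_rad_subtype [IsProbabilityMeasure P] (hV : ∀ f, Measurable (V f)) (ν : Fin n → Measure 𝒳)
    [∀ i, IsProbabilityMeasure (ν i)] (I : Finset (Fin n)) (hν : ∀ i ∈ I, ν i = P) :
    ∫⁻ x, rad (fun (i : I) f => V f (x i)) ∂Measure.pi ν = radInt V (Fin I.card) P := by
  rw [lintegral_rad_comp hV ν (Subtype.val : I → Fin n) Subtype.val_injective P
    fun i => hν i i.2]
  exact radInt_equiv hV (I.equivFin)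

/-- The uniform deviation of the empirical mean over the coordinates in `I`. -/
noncomputable def subDev (V : ι → 𝒳 → ℝ) (P : Measure 𝒳) (I : Finset (Fin n)) (x : Fin n → 𝒳) :
    ℝ≥0∞ :=
  supE fun f => (I.card : ℝ)⁻¹ * ∑ i ∈ I, V f (x i) - ∫ a, V f a ∂P

omit [Countable ι] in
-- Assigning the zero function to the coordinates outside `I` presents the deviation over `I` as one
-- over all coordinates, to which symmetrization and McDiarmid apply.
lemma subDev_eq (V : ι → 𝒳 → ℝ) {I : Finset (Fin n)} (hI : 0 < I.card)
    (ν : Fin n → Measure 𝒳) [∀ i, IsProbabilityMeasure (ν i)] (hν : ∀ i ∈ I, ν i = P) :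
    subDev V P I =
      sampleDev (fun i f a => if i ∈ I then (I.card : ℝ)⁻¹ * V f a else 0) ν := by
  ext x
  rw [subDev, sampleDev]
  congr 1
  ext f
  have hm : (I.card : ℝ) ≠ 0 := by exact_mod_cast hI.ne'
  have h1 : ∀ i, ((if i ∈ I then (I.card : ℝ)⁻¹ * V f (x i) else 0) -
      ∫ a, (if i ∈ I then (I.card : ℝ)⁻¹ * V f a else 0) ∂ν i) =
      if i ∈ I then (I.card : ℝ)⁻¹ * V f (x i) - (I.card : ℝ)⁻¹ * ∫ a, V f a ∂P else 0 := by
    intro i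
    split_ifs with h
    · rw [hν i h, integral_const_mul]
    · simp
  simp_rw [h1]
  rw [Finset.sum_ite_mem, Finset.univ_inter, Finset.sum_sub_distrib, ← Finset.mul_sum,
    Finset.sum_const, nsmul_eq_mul, ← mul_assoc, mul_inv_cancel₀ hm, one_mul]

lemma measurable_subDev (hV : ∀ f, Measurable (V f)) (I : Finset (Fin n)) :
    Measurable (subDev V P I) :=
  measurable_supE fun f => ((Finset.measurable_sum _ fun i _ =>
    (hV f).comp (measurable_pi_apply i)).const_mul _).sub_const _

/-- The `|I|` active coordinates have differences `2b/|I|`, so the sum of squares is `4b²/|I|` and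
the chosen deviation makes the exponent equal to `-2s²`. -/
lemma measure_subDev_gt_le [IsProbabilityMeasure P] (hV : ∀ f, Measurable (V f)) (hb : ∀ f x, |V f x| ≤ b) (hb0 : 0 < b)
    {I : Finset (Fin n)} (hI : 0 < I.card) (ν : Fin n → Measure 𝒳)
    [∀ i, IsProbabilityMeasure (ν i)] (hν : ∀ i ∈ I, ν i = P) {s : ℝ} (hs : 0 ≤ s) :
    Measure.pi ν {x | (∫⁻ y, subDev V P I y ∂Measure.pi ν) +
      ENNReal.ofReal (2 * s * (b / √I.card)) < subDev V P I x} ≤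
        ENNReal.ofReal (Real.exp (-2 * s ^ 2)) := by
  have hm : (0 : ℝ) < I.card := by exact_mod_cast hI
  rw [subDev_eq V hI ν hν]
  have := measure_sampleDev_gt_le
    (U := fun i f a => if i ∈ I then (I.card : ℝ)⁻¹ * V f a else 0) (fun i f => by
      split_ifs
      · exact (hV f).const_mul _
      · exact measurable_const) ν (β := fun i => if i ∈ I then (I.card : ℝ)⁻¹ * b else 0)
      (fun i => by split_ifs <;> positivity) (fun i f x => by
        split_ifs
        · rw [abs_mul, abs_of_pos (by positivity)]; gcongr; exact hb f x
        · simp) (σ := 4 * b ^ 2 / I.card) (t := 2 * s * (b / √I.card)) (by positivity)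
      (by
        have : ∀ i : Fin n, (2 * if i ∈ I then (I.card : ℝ)⁻¹ * b else 0) ^ 2 =
            if i ∈ I then 4 * b ^ 2 / (I.card : ℝ) ^ 2 else 0 := by
          intro i
          split_ifs
          · field_simp; norm_num
          · simp
        simp_rw [this]
        rw [Finset.sum_ite_mem, Finset.univ_inter, Finset.sum_const, nsmul_eq_mul]
        apply le_of_eq; field_simp) (by positivity)
  refine this.trans (ENNReal.ofReal_le_ofReal (Real.exp_le_exp.2 (le_of_eq ?_)))
  rw [mul_pow, div_pow, Real.sq_sqrt hm.le]
  field_simp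
  ring

lemma lintegral_subDev_le [IsProbabilityMeasure P] (hV : ∀ f, Measurable (V f)) (hb : ∀ f x, |V f x| ≤ b)
    {I : Finset (Fin n)} (hI : 0 < I.card) (ν : Fin n → Measure 𝒳)
    [∀ i, IsProbabilityMeasure (ν i)] (hν : ∀ i ∈ I, ν i = P) :
    ∫⁻ x, subDev V P I x ∂Measure.pi ν ≤
      2 * ((I.card : ℝ≥0∞)⁻¹ * radInt V (Fin I.card) P) := by
  rw [subDev_eq V hI ν hν]
  have hm : (0 : ℝ) < I.card := by exact_mod_cast hI
  refine (lintegral_sampleDev_le (fun i f => by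
      split_ifs
      · exact (hV f).const_mul _
      · exact measurable_const) ν (β := fun i => if i ∈ I then (I.card : ℝ)⁻¹ * b else 0)
      (fun i f x => by
        split_ifs
        · rw [abs_mul, abs_of_pos (by positivity)]; gcongr; exact hb f x
        · simp)).trans ?_
  gcongr 2 * ?_
  rw [← lintegral_rad_subtype hV ν I hν, ← lintegral_const_mul]
  · refine lintegral_mono fun x => le_of_eq ?_
    classical
    have h1 := rad_indicator_range (Subtype.val : I → Fin n) Subtype.val_injective
      (fun i f => (I.card : ℝ)⁻¹ * V f (x i))
    have h2 : (fun i => if i ∈ range (Subtype.val : I → Fin n) then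
        (fun f => (I.card : ℝ)⁻¹ * V f (x i)) else 0) =
        fun i f => if i ∈ I then (I.card : ℝ)⁻¹ * V f (x i) else 0 := by
      ext i f
      by_cases h : i ∈ I <;> simp [h]
    rw [h2] at h1
    rw [h1]
    have h3 := rad_smul (I.card : ℝ)⁻¹ (fun (i : I) f => V f (x i))
    rw [Real.enorm_eq_ofReal (by positivity), ENNReal.ofReal_inv_of_pos hm,
      ENNReal.ofReal_natCast] at h3
    exact h3
  · exact measurable_rad fun i f => (hV f).comp (measurable_pi_apply _)

/-- The unnormalised complexity of a bootstrap sample of size `J` from the coordinates in `I`. -/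
noncomputable def boot (V : ι → 𝒳 → ℝ) (J : ℕ) (I : Finset (Fin n)) (x : Fin n → 𝒳) : ℝ≥0∞ :=
  radInt (fun f (a : I) => V f (x a)) (Fin J) (unif I)

omit [Countable ι] [MeasurableSpace 𝒳] in
lemma boot_eq (V : ι → 𝒳 → ℝ) (J : ℕ) {I : Finset (Fin n)} (hI : 0 < I.card) (x : Fin n → 𝒳) :
    boot V J I x = ((I.card : ℝ≥0∞) ^ J)⁻¹ * ∑ j : Fin J → I,
      rad ((fun (a : I) f => V f (x a)) ∘ j) := by
  have : Nonempty I := (Finset.card_pos.1 hI).to_subtype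
  rw [boot, radInt_unif, Fintype.card_coe]

lemma measurable_boot (hV : ∀ f, Measurable (V f)) (J : ℕ) {I : Finset (Fin n)}
    (hI : 0 < I.card) : Measurable (boot V J I) := by
  simp_rw [funext (boot_eq V J hI)]
  exact (Finset.measurable_sum _ fun j _ => measurable_rad fun i f =>
    (hV f).comp (measurable_pi_apply _)).const_mul _

omit [Countable ι] [MeasurableSpace 𝒳] in
lemma boot_le_ofReal (hb : ∀ f x, |V f x| ≤ b) (J : ℕ) {I : Finset (Fin n)} (hI : 0 < I.card)
    (x : Fin n → 𝒳) : boot V J I x ≤ J * ENNReal.ofReal b := by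
  have : Nonempty I := (Finset.card_pos.1 hI).to_subtype
  calc boot V J I x ≤ ∫⁻ _j : Fin J → I, J * ENNReal.ofReal b ∂Measure.pi fun _ => unif I := by
        refine lintegral_mono fun j => (rad_le_sum _).trans ?_
        refine (Finset.sum_le_sum fun i _ => supE_le_ofReal fun f => hb f (x (j i))).trans ?_
        simp
    _ = _ := by simp

omit [MeasurableSpace 𝒳] in
-- A draw hits the altered point with probability `1/|I|` and then changes the loss by at most `2b`;
-- there are `J` draws. The two data sets are compared by using the same draws for both, that is,
-- through the diagonal coupling of the uniform law with itself.
lemma boot_le_update (hb : ∀ f x, |V f x| ≤ b) (J : ℕ) {I : Finset (Fin n)}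
    (hI : 0 < I.card) (x : Fin n → 𝒳) (i : Fin n) (a : 𝒳) :
    boot V J I x ≤ boot V J I (Function.update x i a) +
      ENNReal.ofReal (if i ∈ I then J * (2 * b) / I.card else 0) := by
  classical
  have : Nonempty I := (Finset.card_pos.1 hI).to_subtype
  have hm : (0 : ℝ) < I.card := by exact_mod_cast hI
  set σ : Measure (I × I) := (unif I).map fun a => (a, a)
  have hσ : IsProbabilityMeasure σ :=
    Measure.isProbabilityMeasure_map (measurable_of_finite _).aemeasurable
  have h1 : σ.map Prod.fst = unif I := by
    rw [Measure.map_map (measurable_of_finite _) (measurable_of_finite _)]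
    exact Measure.map_id
  have h2 : σ.map Prod.snd = unif I := by
    rw [Measure.map_map (measurable_of_finite _) (measurable_of_finite _)]
    exact Measure.map_id
  have h := radInt_snd_le (κ := Fin J) (V := fun f (c : I) => V f (x c))
    (V' := fun f (c : I) => V f (Function.update x i a c))
    (fun f => measurable_of_finite _) (fun f => measurable_of_finite _) σ
    (c := fun c : I => if (c : Fin n) = i then ENNReal.ofReal (2 * b) else 0)
    (measurable_of_finite _) (by
      rw [ae_map_iff (measurable_of_finite _).aemeasurable (Set.toFinite _).measurableSet]
      refine ae_of_all _ fun c => ?_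
      by_cases hc : (c : Fin n) = i
      · simp only [hc, if_true]
        refine supE_le_ofReal fun f => (abs_sub _ _).trans ?_
        linarith [hb f (x i), hb f (Function.update x i a i)]
      · simp [hc, Function.update_of_ne, supE])
  rw [h1, h2, lintegral_unif, Fintype.card_coe, Fintype.card_fin] at h
  refine h.trans (add_le_add le_rfl (le_of_eq ?_))
  rw [Finset.sum_coe_sort I (fun c => if c = i then ENNReal.ofReal (2 * b) else 0),
    Finset.sum_ite_eq']
  split_ifs
  · rw [ENNReal.ofReal_div_of_pos hm, ENNReal.ofReal_mul (p := (J : ℝ)) (by positivity), ENNReal.ofReal_natCast,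
      ENNReal.ofReal_natCast, div_eq_mul_inv]
    ring
  · simp

lemma measure_boot_gt_le (hV : ∀ f, Measurable (V f)) (hb : ∀ f x, |V f x| ≤ b) (hb0 : 0 < b)
    {J : ℕ} (hJ : 0 < J) {I : Finset (Fin n)} (hI : 0 < I.card) (ν : Fin n → Measure 𝒳)
    [∀ i, IsProbabilityMeasure (ν i)] {s : ℝ} (hs : 0 ≤ s) :
    Measure.pi ν {x | (∫⁻ y, boot V J I y ∂Measure.pi ν) +
      ENNReal.ofReal (J * (2 * s * (b / √I.card))) < boot V J I x} ≤
        ENNReal.ofReal (Real.exp (-2 * s ^ 2)) := by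
  have hm : (0 : ℝ) < I.card := by exact_mod_cast hI
  have hJ' : (0 : ℝ) < J := by exact_mod_cast hJ
  refine (measure_gt_le_of_update ν (measurable_boot hV J hI) (fun x => ?_)
    (c := fun i => if i ∈ I then J * (2 * b) / I.card else 0)
    (fun i => by split_ifs <;> positivity) (boot_le_update hb J hI)
    (σ := J ^ 2 * (4 * b ^ 2) / I.card) (by positivity) ?_ (by positivity)).trans
    (ENNReal.ofReal_le_ofReal (Real.exp_le_exp.2 (le_of_eq ?_)))
  · exact ne_top_of_le_ne_top (by finiteness) (boot_le_ofReal hb J hI x)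
  · have : ∀ i : Fin n, (if i ∈ I then J * (2 * b) / (I.card : ℝ) else 0) ^ 2 =
        if i ∈ I then J ^ 2 * (4 * b ^ 2) / (I.card : ℝ) ^ 2 else 0 := by
      intro i
      split_ifs
      · field_simp; norm_num
      · simp
    simp_rw [this]
    rw [Finset.sum_ite_mem, Finset.univ_inter, Finset.sum_const, nsmul_eq_mul]
    apply le_of_eq; field_simp
  · rw [mul_pow, mul_pow, div_pow, Real.sq_sqrt hm.le]
    field_simp
    ring

/-- The factor by which resampling `J` points out of `m` enlarges the complexity. -/
noncomputable def resampleFactor (m J : ℕ) : ℝ :=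
  √((m : ℝ) / J * Real.log (2 * m)) + (m : ℝ) / J * Real.log (2 * m)

lemma resampleFactor_nonneg {m J : ℕ} (hm : 0 < m) : 0 ≤ resampleFactor m J := by
  have hm1 : (1 : ℝ) ≤ m := by exact_mod_cast hm
  have : 0 ≤ Real.log (2 * m) := Real.log_nonneg (by linarith)
  unfold resampleFactor; positivity

lemma lintegral_boot_le [IsProbabilityMeasure P] (hV : ∀ f, Measurable (V f)) {J : ℕ} (hJ : 0 < J) {I : Finset (Fin n)}
    (hI : 0 < I.card) (ν : Fin n → Measure 𝒳) [∀ i, IsProbabilityMeasure (ν i)]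
    (hν : ∀ i ∈ I, ν i = P) :
    ∫⁻ x, boot V J I x ∂Measure.pi ν ≤
      J * (ENNReal.ofReal (1.65 * resampleFactor I.card J) *
        ((I.card : ℝ≥0∞)⁻¹ * radInt V (Fin I.card) P)) := by
  have : Nonempty I := (Finset.card_pos.1 hI).to_subtype
  have hm : (0 : ℝ) < I.card := by exact_mod_cast hI
  have hJ' : (0 : ℝ) < J := by exact_mod_cast hJ
  set m := I.card with hmdef
  set A := Real.log (2 * m) with hA
  have hA0 : 0 ≤ A := Real.log_nonneg (by
    have : (1 : ℝ) ≤ m := by exact_mod_cast hI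
    linarith)
  have hpt : ∀ x, boot V J I x ≤ ENNReal.ofReal (1.65 * (√((J : ℝ) / m * A) + A)) *
      rad (fun (a : I) f => V f (x a)) := by
    intro x
    rw [boot_eq V J hI]
    have := sum_rad_comp_le hJ (fun (a : I) f => V f (x a))
    rwa [Fintype.card_coe] at this
  refine (lintegral_mono hpt).trans (le_of_eq ?_)
  have hrm : Measurable fun x : Fin n → 𝒳 => rad (fun (a : I) f => V f (x a)) :=
    measurable_rad fun i f => (hV f).comp (measurable_pi_apply _)
  rw [lintegral_const_mul _ hrm, lintegral_rad_subtype hV ν I hν, ← mul_assoc, ← mul_assoc, ← hmdef]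
  congr 1
  rw [← ENNReal.ofReal_natCast J, ← ENNReal.ofReal_natCast m, ← ENNReal.ofReal_inv_of_pos hm,
    ← ENNReal.ofReal_mul hJ'.le, ← ENNReal.ofReal_mul
      (mul_nonneg hJ'.le (mul_nonneg (by norm_num) (resampleFactor_nonneg hI)))]
  congr 1
  -- Passing from `J/m` to `m/J` under the root extracts the factor `J/m`: the `J` normalises the
  -- bootstrap sample and the `1/m` the original one.
  have h1 : √((J : ℝ) / m * A) = J / m * √(m / J * A) := by
    rw [show (J : ℝ) / m * A = (J / m) ^ 2 * (m / J * A) by field_simp,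
      Real.sqrt_mul (by positivity), Real.sqrt_sq (by positivity)]
  rw [resampleFactor, h1, ← hA]
  field_simp

end Samples

/-! ### Conditioning on the labels. -/

section LabelMixture

variable {d n : ℕ} {p : ℝ} {P₀ P₁ : Measure (Cov d)}

lemma measurable_pair_label (y : Bool) : Measurable fun x : Cov d => (x, y) :=
  measurable_prodMk_right

lemma isProbabilityMeasure_labelMixture [IsProbabilityMeasure P₀] [IsProbabilityMeasure P₁]
    (hp0 : 0 ≤ p) (hp1 : p ≤ 1) : IsProbabilityMeasure (labelMixture p P₀ P₁) := ⟨by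
  have h0 := Measure.isProbabilityMeasure_map (μ := P₀) (measurable_pair_label false).aemeasurable
  have h1 := Measure.isProbabilityMeasure_map (μ := P₁) (measurable_pair_label true).aemeasurable
  simp only [labelMixture, Measure.add_apply, Measure.smul_apply, measure_univ, smul_eq_mul,
    mul_one]
  rw [← ENNReal.ofReal_add (by linarith) hp0]
  simp⟩

lemma ae_of_ae_labelMixture (hp0 : 0 < p) (hp1 : p < 1) {q : Obs d → Prop}
    (h : ∀ᵐ z ∂labelMixture p P₀ P₁, q z) :
    (∀ᵐ x ∂P₀, q (x, false)) ∧ ∀ᵐ x ∂P₁, q (x, true) := by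
  rw [labelMixture, ae_add_measure_iff, Measure.ae_ennreal_smul_measure_iff (by simpa using hp1),
    Measure.ae_ennreal_smul_measure_iff (by simpa using hp0)] at h
  exact ⟨ae_of_ae_map (measurable_pair_label false).aemeasurable h.1,
    ae_of_ae_map (measurable_pair_label true).aemeasurable h.2⟩

lemma ae_labelMixture {q : Obs d → Prop} (hq : MeasurableSet {z | q z})
    (h0 : ∀ᵐ x ∂P₀, q (x, false)) (h1 : ∀ᵐ x ∂P₁, q (x, true)) :
    ∀ᵐ z ∂labelMixture p P₀ P₁, q z := by
  rw [labelMixture, ae_add_measure_iff]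
  exact ⟨Measure.ae_smul_measure
    ((ae_map_iff (measurable_pair_label false).aemeasurable hq).2 h0) _,
    Measure.ae_smul_measure ((ae_map_iff (measurable_pair_label true).aemeasurable hq).2 h1) _⟩

/-- The laws of the covariates given the labels. -/
noncomputable def condLaw (P₀ P₁ : Measure (Cov d)) (y : Fin n → Bool) (i : Fin n) :
    Measure (Cov d) :=
  if y i then P₁ else P₀

instance [IsProbabilityMeasure P₀] [IsProbabilityMeasure P₁] (y : Fin n → Bool) (i : Fin n) :
    IsProbabilityMeasure (condLaw P₀ P₁ y i) := by
  unfold condLaw; split_ifs <;> infer_instance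

lemma condLaw_of_mem {y : Fin n → Bool} {i : Fin n} (hi : i ∈ minority y) :
    condLaw P₀ P₁ y i = P₁ := by
  simp [condLaw, mem_minority.1 hi]

lemma labelMixture_apply_inter (s : Set (Cov d)) (hs : MeasurableSet s) (y : Bool) :
    labelMixture p P₀ P₁ {z | z.2 = y ∧ z.1 ∈ s} =
      ENNReal.ofReal (if y then p else 1 - p) * (if y then P₁ else P₀) s := by
  have hm : MeasurableSet {z : Obs d | z.2 = y ∧ z.1 ∈ s} :=
    (measurable_snd (measurableSet_singleton y)).inter (measurable_fst hs)
  rw [labelMixture, Measure.add_apply, Measure.smul_apply, Measure.smul_apply,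
    Measure.map_apply (measurable_pair_label _) hm, Measure.map_apply (measurable_pair_label _) hm]
  cases y <;> simp

/-- Given the labels, the covariates are independent with laws `condLaw`. -/
lemma pi_labelMixture_apply [IsProbabilityMeasure P₀] [IsProbabilityMeasure P₁]
    (hp0 : 0 ≤ p) (hp1 : p ≤ 1) (y : Fin n → Bool)
    {A : Set (Fin n → Cov d)} (hA : MeasurableSet A) :
    Measure.pi (fun _ => labelMixture p P₀ P₁) {z | labels z = y ∧ (fun i => (z i).1) ∈ A} =
      (∏ i, ENNReal.ofReal (if y i then p else 1 - p)) * Measure.pi (condLaw P₀ P₁ y) A := by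
  have := isProbabilityMeasure_labelMixture (P₀ := P₀) (P₁ := P₁) hp0 hp1
  set w : ℝ≥0∞ := ∏ i, ENNReal.ofReal (if y i then p else 1 - p)
  -- Restricting the mixture to the event that the label is `y i` leaves a multiple of the
  -- conditional law, and restriction to a box commutes with products.
  set ρ : Fin n → Measure (Cov d) := fun i =>
    ((labelMixture p P₀ P₁).restrict {z | z.2 = y i}).map Prod.fst with hρ
  have hset : ∀ i, MeasurableSet {z : Obs d | z.2 = y i} := fun i =>
    measurable_snd (measurableSet_singleton (y i))
  have hρ' : ∀ i s, MeasurableSet s → ρ i s =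
      ENNReal.ofReal (if y i then p else 1 - p) * condLaw P₀ P₁ y i s := by
    intro i s hs
    rw [hρ, Measure.map_apply measurable_fst hs, Measure.restrict_apply (measurable_fst hs),
      condLaw, ← labelMixture_apply_inter s hs]
    congr 1
    ext z
    simp [and_comm]
  have h1 : Measure.pi ρ = w • Measure.pi (condLaw P₀ P₁ y) := by
    refine Measure.pi_eq fun s hs => ?_
    rw [Measure.smul_apply, Measure.pi_pi, smul_eq_mul, ← Finset.prod_mul_distrib]
    exact Finset.prod_congr rfl fun i _ => (hρ' i _ (hs i)).symm
  have h2 : (Measure.pi fun i => (labelMixture p P₀ P₁).restrict {z | z.2 = y i}).map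
      (fun z i => (z i).1) = Measure.pi ρ :=
    Measure.pi_map_pi fun i => measurable_fst.aemeasurable
  rw [← smul_eq_mul, ← Measure.smul_apply, ← h1, ← h2, Measure.map_apply (by fun_prop) hA,
    ← Measure.restrict_pi_pi, Measure.restrict_apply (by
      exact (by fun_prop : Measurable fun (z : Fin n → Obs d) i => (z i).1) hA)]
  congr 1
  ext z
  simp [labels, funext_iff, and_comm]

variable {Ω : Type*} [MeasurableSpace Ω] {μ : Measure Ω} {Z : Ω → Fin n → Obs d}

/-- Bounds under the conditional law give bounds on the sample space. -/
lemma measure_labels_inter_le [IsProbabilityMeasure P₀] [IsProbabilityMeasure P₁]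
    (hp0 : 0 ≤ p) (hp1 : p ≤ 1) (hZ : Measurable Z)
    (hlaw : μ.map Z = Measure.pi fun _ => labelMixture p P₀ P₁) (y : Fin n → Bool)
    (A : Set (Fin n → Cov d)) :
    μ {ω | labels (Z ω) = y ∧ (fun i => (Z ω i).1) ∈ A} ≤
      Measure.pi (condLaw P₀ P₁ y) A * μ {ω | labels (Z ω) = y} := by
  have hcov : Measurable fun (z : Fin n → Obs d) i => (z i).1 := by fun_prop
  have hlab : MeasurableSet {z : Fin n → Obs d | labels z = y} := by
    have : Measurable (labels : (Fin n → Obs d) → Fin n → Bool) :=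
      measurable_pi_iff.2 fun i => measurable_snd.comp (measurable_pi_apply i)
    exact this (measurableSet_singleton y)
  -- The events to come involve suprema over a possibly uncountable class and need not be
  -- measurable, so a measurable hull of the same conditional measure replaces `A`.
  set A' := toMeasurable (Measure.pi (condLaw P₀ P₁ y)) A
  have hA' : MeasurableSet A' := measurableSet_toMeasurable _ _
  have h1 : μ {ω | labels (Z ω) = y} = ∏ i, ENNReal.ofReal (if y i then p else 1 - p) := by
    have := pi_labelMixture_apply (P₀ := P₀) (P₁ := P₁) hp0 hp1 y (A := univ) MeasurableSet.univ
    rw [← hlaw, Measure.map_apply hZ (by simpa using hlab), measure_univ, mul_one] at this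
    rw [← this]
    congr 1
    ext ω
    simp
  have h2 := pi_labelMixture_apply (P₀ := P₀) (P₁ := P₁) hp0 hp1 y hA'
  have hm : MeasurableSet {z : Fin n → Obs d | labels z = y ∧ (fun i => (z i).1) ∈ A'} :=
    hlab.inter (hcov hA')
  rw [← hlaw, Measure.map_apply hZ hm, ← h1, measure_toMeasurable,
    mul_comm] at h2
  rw [← h2]
  refine measure_mono fun ω hω => ?_
  exact ⟨hω.1, subset_toMeasurable _ _ hω.2⟩

/-- Failure probabilities that are small given any admissible labels are small overall. -/
lemma measure_exists_labels_le [IsProbabilityMeasure P₀] [IsProbabilityMeasure P₁]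
    [IsProbabilityMeasure μ] (hp0 : 0 ≤ p) (hp1 : p ≤ 1) (hZ : Measurable Z)
    (hlaw : μ.map Z = Measure.pi fun _ => labelMixture p P₀ P₁) {k : ℕ} {η : ℝ≥0∞}
    (A : (Fin n → Bool) → Set (Fin n → Cov d))
    (hA : ∀ y, k < numMin y → Measure.pi (condLaw P₀ P₁ y) (A y) ≤ η) :
    μ {ω | k < numMin (labels (Z ω)) ∧ (fun i => (Z ω i).1) ∈ A (labels (Z ω))} ≤ η := by
  have hlab : ∀ y, MeasurableSet {ω | labels (Z ω) = y} := fun y => by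
    have : Measurable fun ω => labels (Z ω) :=
      measurable_pi_iff.2 fun i => measurable_snd.comp ((measurable_pi_apply i).comp hZ)
    exact this (measurableSet_singleton y)
  have hsub : {ω | k < numMin (labels (Z ω)) ∧ (fun i => (Z ω i).1) ∈ A (labels (Z ω))} ⊆
      ⋃ y ∈ (Finset.univ.filter fun y : Fin n → Bool => k < numMin y),
        {ω | labels (Z ω) = y ∧ (fun i => (Z ω i).1) ∈ A y} := by
    intro ω hω
    simp only [mem_iUnion, Finset.mem_filter, Finset.mem_univ, true_and]
    exact ⟨labels (Z ω), hω.1, rfl, hω.2⟩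
  calc _ ≤ ∑ y ∈ (Finset.univ.filter fun y : Fin n → Bool => k < numMin y),
        μ {ω | labels (Z ω) = y ∧ (fun i => (Z ω i).1) ∈ A y} :=
        (measure_mono hsub).trans (measure_biUnion_finset_le _ _)
    _ ≤ ∑ y ∈ (Finset.univ.filter fun y : Fin n → Bool => k < numMin y),
        η * μ {ω | labels (Z ω) = y} := by
        refine Finset.sum_le_sum fun y hy => ?_
        refine (measure_labels_inter_le hp0 hp1 hZ hlaw y (A y)).trans ?_
        gcongr
        exact hA y (Finset.mem_filter.1 hy).2
    _ ≤ η * 1 := by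
        rw [← Finset.mul_sum, ← measure_biUnion_finset (fun a _ c _ hac => ?_) fun y _ => hlab y]
        · gcongr
          exact prob_le_one
        · refine Set.disjoint_left.2 fun ω h1 h2 => hac ?_
          exact h1.symm.trans h2
    _ = η := mul_one η

end LabelMixture

/-! ### From the class `F` to a countable dense subclass. -/

section Bridge

variable {d : ℕ} {ℓ : Bool → ℝ → ℝ} {F F₀ : Set (Cov d → ℝ)}

/-- The losses, as a class of functions on labelled observations. -/
def lossFn (ℓ : Bool → ℝ → ℝ) (F₀ : Set (Cov d → ℝ)) (f : F₀) (z : Obs d) : ℝ := ℓ z.2 (f.1 z.1)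

/-- `F₀` is a subclass of `F` whose losses are pointwise dense. -/
def DenseSubclass (ℓ : Bool → ℝ → ℝ) (F F₀ : Set (Cov d → ℝ)) : Prop :=
  F₀ ⊆ F ∧ ∀ f ∈ F, ∃ u : ℕ → Cov d → ℝ, (∀ m, u m ∈ F₀) ∧
    ∀ (x : Cov d) (y : Bool), Tendsto (fun m => ℓ y (u m x)) atTop (𝓝 (ℓ y (f x)))

lemma radInt_le_of_ae_bound {ι κ 𝒳 : Type*} [MeasurableSpace 𝒳] [Fintype κ] [DecidableEq κ]
    {V : ι → 𝒳 → ℝ} {ν : Measure 𝒳} [IsProbabilityMeasure ν] {B : ℝ}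
    (h : ∀ᵐ x ∂ν, ∀ f, |V f x| ≤ B) : radInt V κ ν ≤ Fintype.card κ * ENNReal.ofReal B := by
  calc radInt V κ ν ≤ ∫⁻ _x : κ → 𝒳, Fintype.card κ * ENNReal.ofReal B
        ∂Measure.pi fun _ => ν := by
        refine lintegral_mono_ae ?_
        filter_upwards [eventually_all.2 fun i => ae_pi_eval (fun _ : κ => ν) i h] with x hx
        refine (rad_le_sum _).trans
          ((Finset.sum_le_sum fun i _ => supE_le_ofReal fun f => hx i f).trans ?_)
        simp
    _ = _ := by simp

/-- Losses in `F` are pointwise limits of losses in `F₀`, so both classes have the same suprema, and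
those over the countable one are measurable. The almost sure bound makes all integrals finite, so
that `toReal` commutes with the sum over sign patterns. -/
lemma radComplexity_eq [Countable F₀] (hF : DenseSubclass ℓ F F₀)
    (hm : ∀ f, Measurable (lossFn ℓ F₀ f)) {N : ℕ} (hN : 0 < N) {ν : Measure (Obs d)}
    [IsProbabilityMeasure ν] {B : ℝ} (hB : ∀ᵐ z ∂ν, ∀ f, |lossFn ℓ F₀ f z| ≤ B) :
    radComplexity ℓ F N ν =
      ((N : ℝ≥0∞)⁻¹ * radInt (lossFn ℓ F₀) (Fin N) ν).toReal := by
  have hN' : (0 : ℝ) < N := by exact_mod_cast hN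
  have hsup : ∀ (ε : Fin N → Bool) (z : Fin N → Obs d),
      (⨆ f ∈ F, ENNReal.ofReal |(1 / N : ℝ) * ∑ i, sgn (ε i) * ℓ (z i).2 (f (z i).1)|) =
        (N : ℝ≥0∞)⁻¹ * supE (∑ i, sgn (ε i) • fun f => lossFn ℓ F₀ f (z i)) := by
    intro ε z
    have hval : ∀ f : Cov d → ℝ, ENNReal.ofReal |(1 / N : ℝ) *
        ∑ i, sgn (ε i) * ℓ (z i).2 (f (z i).1)| =
        (N : ℝ≥0∞)⁻¹ * ‖∑ i, sgn (ε i) * ℓ (z i).2 (f (z i).1)‖ₑ := by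
      intro f
      rw [← Real.enorm_eq_ofReal_abs, enorm_mul, Real.enorm_eq_ofReal (by positivity), one_div,
        ENNReal.ofReal_inv_of_pos hN', ENNReal.ofReal_natCast]
    simp_rw [hval]
    refine le_antisymm (iSup₂_le fun f hf => ?_) ?_
    · obtain ⟨u, hu, hlim⟩ := hF.2 f hf
      gcongr
      have ht : Tendsto (fun m => ‖∑ i, sgn (ε i) * ℓ (z i).2 (u m (z i).1)‖ₑ) atTop
          (𝓝 ‖∑ i, sgn (ε i) * ℓ (z i).2 (f (z i).1)‖ₑ) :=
        (tendsto_finsetSum _ fun i _ => (hlim (z i).1 (z i).2).const_mul _).enorm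
      refine le_of_tendsto' ht fun m => ?_
      have := le_supE (∑ i, sgn (ε i) • fun f => lossFn ℓ F₀ f (z i)) ⟨u m, hu m⟩
      simpa [lossFn] using this
    · rw [supE, ENNReal.mul_iSup]
      refine iSup_le fun f => ?_
      refine le_trans (le_of_eq ?_) (le_iSup₂ (f := fun f (_ : f ∈ F) =>
        (N : ℝ≥0∞)⁻¹ * ‖∑ i, sgn (ε i) * ℓ (z i).2 (f (z i).1)‖ₑ) f.1 (hF.1 f.2))
      simp [lossFn]
  have hmS : ∀ ε : Fin N → Bool, Measurable fun z : Fin N → Obs d =>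
      supE (∑ i, sgn (ε i) • fun f => lossFn ℓ F₀ f (z i)) := fun ε =>
    measurable_supE fun f => by
      simp only [Finset.sum_apply, Pi.smul_apply, smul_eq_mul]
      exact Finset.measurable_sum _ fun i _ => ((hm f).comp (measurable_pi_apply i)).const_mul _
  have hfin : ∀ ε : Fin N → Bool, ∫⁻ z, supE (∑ i, sgn (ε i) • fun f => lossFn ℓ F₀ f (z i))
      ∂(Measure.pi fun _ : Fin N => ν) ≠ ∞ := by
    intro ε
    refine ne_top_of_le_ne_top (b := ∫⁻ _z : Fin N → Obs d, N * ENNReal.ofReal B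
      ∂(Measure.pi fun _ : Fin N => ν)) (by simp; finiteness) (lintegral_mono_ae ?_)
    filter_upwards [eventually_all.2 fun i => ae_pi_eval (fun _ : Fin N => ν) i hB] with z hz
    refine (supE_sum_le _ _).trans ?_
    refine (Finset.sum_le_sum fun i _ => ?_).trans (le_of_eq
      (by simp : ∑ _i : Fin N, ENNReal.ofReal B = N * ENNReal.ofReal B))
    rw [supE_smul, enorm_sgn, one_mul]
    exact supE_le_ofReal fun f => hz i f
  have hint : ∀ ε : Fin N → Bool, (∫⁻ z : Fin N → Obs d,
      ⨆ f ∈ F, ENNReal.ofReal |(1 / N : ℝ) * ∑ i, sgn (ε i) * ℓ (z i).2 (f (z i).1)|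
      ∂(Measure.pi fun _ => ν)) = (N : ℝ≥0∞)⁻¹ *
        ∫⁻ z, supE (∑ i, sgn (ε i) • fun f => lossFn ℓ F₀ f (z i)) ∂Measure.pi fun _ => ν :=
    fun ε => by rw [lintegral_congr (hsup ε), lintegral_const_mul _ (hmS ε)]
  rw [radComplexity, Finset.sum_congr rfl fun ε _ => congrArg ENNReal.toReal (hint ε), radInt]
  unfold rad
  rw [lintegral_const_mul _ (Finset.measurable_sum _ fun ε _ => hmS ε),
    lintegral_finsetSum _ fun ε _ => hmS ε]
  simp only [ENNReal.toReal_mul, ENNReal.toReal_inv, ENNReal.toReal_pow, ENNReal.toReal_natCast,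
    ENNReal.toReal_ofNat, Fintype.card_fin]
  rw [ENNReal.toReal_sum fun ε _ => hfin ε, ← Finset.mul_sum]
  ring

lemma radComplexity_nonneg (N : ℕ) (ν : Measure (Obs d)) : 0 ≤ radComplexity ℓ F N ν := by
  unfold radComplexity; positivity

end Bridge

/-! ### Standing assumptions, truncated losses, and their complexities. -/

section RegularClass

variable {d : ℕ} {ℓ : Bool → ℝ → ℝ} {F F₀ : Set (Cov d → ℝ)} {P₀ P₁ : Measure (Cov d)}
  {b L D : ℝ}

/-- The standing assumptions on the class of losses, in the form in which they are used. -/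
structure RegularClass (ℓ : Bool → ℝ → ℝ) (F F₀ : Set (Cov d → ℝ)) (P₀ P₁ : Measure (Cov d))
    (b L D : ℝ) : Prop where
  dense : DenseSubclass ℓ F F₀
  countable : Countable F₀
  measurable : ∀ f : F₀, Measurable (lossFn ℓ F₀ f)
  bound_false : ∀ᵐ x ∂P₀, ∀ f ∈ F, |ℓ false (f x)| ≤ b
  bound_true : ∀ x ∈ P₁.support, ∀ f ∈ F, |ℓ true (f x)| ≤ b
  norm_le : ∀ x ∈ P₁.support, ‖x‖ ≤ D
  lipschitz : ∀ f ∈ F, ∀ x ∈ convexHull ℝ P₁.support, ∀ x' ∈ convexHull ℝ P₁.support,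
    |ℓ true (f x) - ℓ true (f x')| ≤ L * ‖x - x'‖
  b_pos : 0 < b
  L_pos : 0 < L
  D_pos : 0 < D

/-- Every ball around a support point has positive mass, so it contains support points at which the
almost sure bound is true; the Lipschitz condition carries the bound to the centre in the limit. -/
lemma abs_le_of_mem_support {P : Measure (Cov d)} {g : Cov d → ℝ}
    (hb : ∀ᵐ x ∂P, |g x| ≤ b)
    (hlip : ∀ x ∈ P.support, ∀ x' ∈ P.support, |g x - g x'| ≤ L * ‖x - x'‖) (hL : 0 < L)
    {x : Cov d} (hx : x ∈ P.support) : |g x| ≤ b := by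
  refine le_of_forall_pos_le_add fun ε hε => ?_
  have h1 : 0 < P (Metric.ball x (ε / L)) :=
    (Measure.mem_support_iff_forall x).1 hx _ (Metric.ball_mem_nhds x (by positivity))
  obtain ⟨x', hx', hx's, hx'b⟩ : ∃ x' ∈ Metric.ball x (ε / L), x' ∈ P.support ∧ |g x'| ≤ b := by
    by_contra! hcon
    have h2 : ∀ᵐ x ∂P, x ∈ P.support ∧ |g x| ≤ b := by
      filter_upwards [Measure.support_mem_ae (μ := P), hb] with x h1 h2 using ⟨h1, h2⟩
    refine h1.ne' (measure_mono_null (fun x' hx' => ?_) h2)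
    exact fun h => absurd h.2 (not_le.2 (hcon x' hx' h.1))
  have h3 := hlip x hx x' hx's
  have h4 : L * ‖x - x'‖ ≤ ε := by
    rw [← dist_eq_norm, dist_comm]
    have := (Metric.mem_ball.1 hx').le
    rw [le_div_iff₀ hL] at this
    linarith
  have := abs_sub_abs_le_abs_sub (g x) (g x')
  linarith

lemma RegularClass.mk' (hsep : F₀.Countable) (hdense : DenseSubclass ℓ F F₀) {p : ℝ}
    (hp0 : 0 < p) (hp1 : p < 1)
    (hmeas : ∀ f ∈ F, Measurable fun z : Obs d => ℓ z.2 (f z.1))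
    (hb : ∀ᵐ z ∂(labelMixture p P₀ P₁), ∀ f ∈ F, |ℓ z.2 (f z.1)| ≤ b)
    (hD : ∀ᵐ z ∂(labelMixture p P₀ P₁), ‖z.1‖ ≤ D)
    (hlip : ∀ f ∈ F, ∀ x ∈ convexHull ℝ P₁.support, ∀ x' ∈ convexHull ℝ P₁.support,
      |ℓ true (f x) - ℓ true (f x')| ≤ L * ‖x - x'‖) (hb0 : 0 < b) (hL0 : 0 < L) (hD0 : 0 < D) :
    RegularClass ℓ F F₀ P₀ P₁ b L D where
  dense := hdense
  countable := hsep.to_subtype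
  measurable f := hmeas f (hdense.1 f.2)
  bound_false := (ae_of_ae_labelMixture hp0 hp1 hb).1
  bound_true x hx f hf := abs_le_of_mem_support
    ((ae_of_ae_labelMixture hp0 hp1 hb).2.mono fun x h => h f hf)
    (fun x hx x' hx' => hlip f hf x (subset_convexHull ℝ _ hx) x' (subset_convexHull ℝ _ hx'))
    hL0 hx
  norm_le x hx := by
    have h : P₁.support ⊆ Metric.closedBall 0 D :=
      Measure.support_subset_of_isClosed Metric.isClosed_closedBall
        ((ae_of_ae_labelMixture hp0 hp1 hD).2.mono fun x h => by simpa using h)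
    simpa using h hx
  lipschitz := hlip
  b_pos := hb0
  L_pos := hL0
  D_pos := hD0

/-- The losses, truncated to `[-b, b]`. -/
noncomputable def clampLoss (ℓ : Bool → ℝ → ℝ) (F₀ : Set (Cov d → ℝ)) (b : ℝ) (f : F₀)
    (z : Obs d) : ℝ :=
  max (-b) (min b (lossFn ℓ F₀ f z))

lemma clampLoss_eq {f : F₀} {z : Obs d} (h : |lossFn ℓ F₀ f z| ≤ b) :
    clampLoss ℓ F₀ b f z = lossFn ℓ F₀ f z := by
  rw [abs_le] at h
  rw [clampLoss, min_eq_right h.2, max_eq_right h.1]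

lemma abs_clampLoss_le (hb : 0 < b) (f : F₀) (z : Obs d) : |clampLoss ℓ F₀ b f z| ≤ b :=
  abs_le.2 ⟨le_max_left _ _, max_le (by linarith) (min_le_left _ _)⟩

/-- The truncated losses at label `true`. -/
noncomputable def clampOne (ℓ : Bool → ℝ → ℝ) (F₀ : Set (Cov d → ℝ)) (b : ℝ) (f : F₀)
    (x : Cov d) : ℝ :=
  clampLoss ℓ F₀ b f (x, true)

/-- The losses at label `true`. -/
def lossOne (ℓ : Bool → ℝ → ℝ) (F₀ : Set (Cov d → ℝ)) (f : F₀) (x : Cov d) : ℝ := ℓ true (f.1 x)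

namespace RegularClass

variable (h : RegularClass ℓ F F₀ P₀ P₁ b L D)
include h

lemma measurable_clampLoss (f : F₀) : Measurable (clampLoss ℓ F₀ b f) :=
  measurable_const.max (measurable_const.min (h.measurable f))

lemma measurable_clampOne (f : F₀) : Measurable (clampOne ℓ F₀ b f) :=
  (h.measurable_clampLoss f).comp (measurable_pair_label true)

lemma measurable_lossOne (f : F₀) : Measurable (lossOne ℓ F₀ f) :=
  (h.measurable f).comp (measurable_pair_label true)

lemma abs_clampOne_le (f : F₀) (x : Cov d) : |clampOne ℓ F₀ b f x| ≤ b :=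
  abs_clampLoss_le h.b_pos f _

lemma clampOne_eq {x : Cov d} (hx : x ∈ P₁.support) (f : F₀) :
    clampOne ℓ F₀ b f x = lossOne ℓ F₀ f x :=
  clampLoss_eq (h.bound_true x hx f (h.dense.1 f.2))

lemma norm_le_of_mem_convexHull {x : Cov d} (hx : x ∈ convexHull ℝ P₁.support) : ‖x‖ ≤ D := by
  have : convexHull ℝ P₁.support ⊆ Metric.closedBall 0 D :=
    convexHull_min (fun x hx => by simpa using h.norm_le x hx) (convex_closedBall _ _)
  simpa using this hx

/-- Synthetic points need not lie in the support, so the bound `b` is not available there. It is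
transported from a support point by the Lipschitz condition, at distance at most `2D`. -/
lemma abs_loss_le_of_mem_convexHull [IsProbabilityMeasure P₁] {x : Cov d}
    (hx : x ∈ convexHull ℝ P₁.support) {f : Cov d → ℝ} (hf : f ∈ F) :
    |ℓ true (f x)| ≤ b + 2 * L * D := by
  obtain ⟨x₀, hx₀⟩ := Measure.nonempty_support (IsProbabilityMeasure.ne_zero P₁)
  have h1 := h.lipschitz f hf x hx x₀ (subset_convexHull ℝ _ hx₀)
  have h2 := h.bound_true x₀ hx₀ f hf
  have h3 := norm_sub_le x x₀
  have h4 := h.norm_le_of_mem_convexHull hx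
  have h5 := h.norm_le x₀ hx₀
  have h6 := abs_sub_abs_le_abs_sub (ℓ true (f x)) (ℓ true (f x₀))
  have h7 : L * ‖x - x₀‖ ≤ L * (2 * D) := mul_le_mul_of_nonneg_left (by linarith) h.L_pos.le
  linarith

lemma ae_clampOne_eq : ∀ᵐ x ∂P₁, ∀ f, clampOne ℓ F₀ b f x = lossOne ℓ F₀ f x := by
  filter_upwards [Measure.support_mem_ae (μ := P₁)] with x hx f using h.clampOne_eq hx f

lemma ofReal_radComplexity_minority [IsProbabilityMeasure P₁] {m : ℕ} (hm : 0 < m) :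
    (m : ℝ≥0∞)⁻¹ * radInt (clampOne ℓ F₀ b) (Fin m) P₁ =
      ENNReal.ofReal (radComplexity ℓ F m (withLabelOne P₁)) := by
  have := h.countable
  have hP : IsProbabilityMeasure (withLabelOne P₁) :=
    Measure.isProbabilityMeasure_map (measurable_pair_label true).aemeasurable
  have hset : MeasurableSet {z : Obs d | ∀ f, |lossFn ℓ F₀ f z| ≤ b} := by
    simp only [ofPred_forall]
    exact MeasurableSet.iInter fun f => measurableSet_le (h.measurable f).abs measurable_const
  have hae : ∀ᵐ z ∂withLabelOne P₁, ∀ f, |lossFn ℓ F₀ f z| ≤ b := by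
    rw [withLabelOne, ae_map_iff (measurable_pair_label true).aemeasurable hset]
    filter_upwards [Measure.support_mem_ae (μ := P₁)] with x hx f
      using h.bound_true x hx f (h.dense.1 f.2)
  rw [radComplexity_eq h.dense h.measurable hm hae, withLabelOne,
    radInt_map h.measurable P₁ (measurable_pair_label true), ENNReal.ofReal_toReal]
  · congr 1
    exact radInt_congr_ae P₁ h.ae_clampOne_eq
  · refine ENNReal.mul_ne_top (by simp; omega) (ne_top_of_le_ne_top ?_
      (radInt_le_of_ae_bound (B := b) ?_))
    · finiteness
    · filter_upwards [Measure.support_mem_ae (μ := P₁)] with x hx f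
        using h.bound_true x hx f (h.dense.1 f.2)

lemma ofReal_radComplexity_balanced [IsProbabilityMeasure P₀] [IsProbabilityMeasure P₁] {N : ℕ}
    (hN : 0 < N) :
    (N : ℝ≥0∞)⁻¹ * radInt (clampLoss ℓ F₀ b) (Fin N) (balanced P₀ P₁) =
      ENNReal.ofReal (radComplexity ℓ F N (balanced P₀ P₁)) := by
  have := h.countable
  have hP : IsProbabilityMeasure (balanced P₀ P₁) :=
    isProbabilityMeasure_labelMixture (by norm_num) (by norm_num)
  have hset : MeasurableSet {z : Obs d | ∀ f, |lossFn ℓ F₀ f z| ≤ b} := by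
    simp only [ofPred_forall]
    exact MeasurableSet.iInter fun f => measurableSet_le (h.measurable f).abs measurable_const
  have hae : ∀ᵐ z ∂balanced P₀ P₁, ∀ f, |lossFn ℓ F₀ f z| ≤ b := by
    refine ae_labelMixture hset ?_ ?_
    · filter_upwards [h.bound_false] with x hx f using hx f (h.dense.1 f.2)
    · filter_upwards [Measure.support_mem_ae (μ := P₁)] with x hx f
        using h.bound_true x hx f (h.dense.1 f.2)
  rw [radComplexity_eq h.dense h.measurable hN hae, ENNReal.ofReal_toReal]
  · congr 1
    refine radInt_congr_ae _ ?_
    filter_upwards [hae] with z hz f using clampLoss_eq (hz f)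
  · exact ENNReal.mul_ne_top (by simp; omega) (ne_top_of_le_ne_top (by finiteness)
      (radInt_le_of_ae_bound hae))

section Data

variable {n k : ℕ} {z : Fin n → Obs d} [IsProbabilityMeasure P₁]
  (hz : ∀ j ∈ minority (labels z), (z j).1 ∈ P₁.support) (hk : 0 < k)
  (hkm : k < numMin (labels z))

include hz in
lemma ae_smote_bound :
    ∀ᵐ x ∂smote k z, ∀ f ∈ F, |ℓ true (f x)| ≤ b + 2 * L * D := by
  filter_upwards [ae_smote_mem_convexHull hz] with x hx f hf
    using h.abs_loss_le_of_mem_convexHull hx hf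

include hz hk hkm

lemma integrable_lossOne_smote (f : F₀) : Integrable (lossOne ℓ F₀ f) (smote k z) := by
  have := isProbabilityMeasure_smote hk hkm
  refine Integrable.of_bound (h.measurable_lossOne f).aestronglyMeasurable (b + 2 * L * D) ?_
  filter_upwards [h.ae_smote_bound (k := k) hz] with x hx using hx f (h.dense.1 f.2)

lemma ofReal_radComplexity_smote {J : ℕ} (hJ : 0 < J) :
    (J : ℝ≥0∞)⁻¹ * radInt (lossOne ℓ F₀) (Fin J) (smote k z) =
      ENNReal.ofReal (radComplexity ℓ F J (withLabelOne (smote k z))) := by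
  have := h.countable
  have := isProbabilityMeasure_smote hk hkm
  have hP : IsProbabilityMeasure (withLabelOne (smote k z)) :=
    Measure.isProbabilityMeasure_map (measurable_pair_label true).aemeasurable
  have hset : MeasurableSet {z : Obs d | ∀ f, |lossFn ℓ F₀ f z| ≤ b + 2 * L * D} := by
    simp only [ofPred_forall]
    exact MeasurableSet.iInter fun f => measurableSet_le (h.measurable f).abs measurable_const
  have hae : ∀ᵐ z ∂withLabelOne (smote k z), ∀ f, |lossFn ℓ F₀ f z| ≤ b + 2 * L * D := by
    rw [withLabelOne, ae_map_iff (measurable_pair_label true).aemeasurable hset]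
    filter_upwards [h.ae_smote_bound (k := k) hz] with x hx f using hx f (h.dense.1 f.2)
  rw [radComplexity_eq h.dense h.measurable hJ hae, withLabelOne,
    radInt_map h.measurable (smote k z) (measurable_pair_label true), ENNReal.ofReal_toReal]
  · rfl
  · refine ENNReal.mul_ne_top (by simp; omega) (ne_top_of_le_ne_top ?_
      (radInt_le_of_ae_bound (B := b + 2 * L * D) ?_))
    · finiteness
    · filter_upwards [h.ae_smote_bound (k := k) hz] with x hx f using hx f (h.dense.1 f.2)

/-- The bias of the SMOTE law is controlled by the deviation of the minority sample and the mean
nearest-neighbour radius. -/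
lemma supE_smote_sub_le :
    supE (fun f => ∫ x, lossOne ℓ F₀ f x ∂smote k z - ∫ x, lossOne ℓ F₀ f x ∂P₁) ≤
      ENNReal.ofReal (L * meanRadius k z) +
        subDev (clampOne ℓ F₀ b) P₁ (minority (labels z)) fun i => (z i).1 := by
  have := h.countable
  have h1 := supE_integral_smote_sub_le h.measurable_lossOne h.L_pos.le
    (fun f => h.lipschitz f (h.dense.1 f.2)) hz hk hkm
    (h.integrable_lossOne_smote hz hk hkm)
  refine le_trans (le_of_eq ?_) ((supE_add_le _ _).trans (add_le_add h1 le_rfl))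
  congr 1
  ext f
  have e1 : ∫ x, clampOne ℓ F₀ b f x ∂P₁ = ∫ x, lossOne ℓ F₀ f x ∂P₁ :=
    integral_congr_ae (h.ae_clampOne_eq.mono fun x hx => hx f)
  have e2 : ∑ i ∈ minority (labels z), clampOne ℓ F₀ b f (z i).1 =
      ∑ i ∈ minority (labels z), lossOne ℓ F₀ f (z i).1 :=
    Finset.sum_congr rfl fun i hi => h.clampOne_eq (hz i hi) f
  simp only [Pi.add_apply, e1, e2, numMin]
  ring

omit [IsProbabilityMeasure P₁] in
lemma radInt_smote_le_boot (J : ℕ) :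
    radInt (lossOne ℓ F₀) (Fin J) (smote k z) ≤
      boot (clampOne ℓ F₀ b) J (minority (labels z)) (fun i => (z i).1) +
        J * ENNReal.ofReal (L * meanRadius k z) := by
  have := h.countable
  refine (radInt_smote_le h.measurable_lossOne h.L_pos.le
    (fun f => h.lipschitz f (h.dense.1 f.2)) hz hk hkm J).trans (le_of_eq ?_)
  congr 2
  ext f j
  exact (h.clampOne_eq (hz j j.2) f).symm

end Data

end RegularClass

end RegularClass

/-! ### Probabilities of the exceptional events given the labels. -/

section Events

/-- Failure is bounded either by Markov, because the level exceeds `a` times the mean, or by the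
tail estimate. The first is needed for `δ` near `1`, where a deviation proportional to `√(log
(1/δ))` tends to zero and McDiarmid is of no use. -/
lemma measure_not_le_le_of_tail {α : Type*} [MeasurableSpace α] (ν : Measure α)
    [IsProbabilityMeasure ν] {G : α → ℝ≥0∞} (hG : Measurable G) {a t e T : ℝ} (ha : 1 ≤ a)
    (htail : ν {x | (∫⁻ y, G y ∂ν) + ENNReal.ofReal t < G x} ≤ ENNReal.ofReal e)
    {c : ℝ≥0∞} (hc : ENNReal.ofReal a * (∫⁻ y, G y ∂ν) + ENNReal.ofReal t ≤ c)
    (hT : a⁻¹ ≤ T ∨ e ≤ T) :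
    ν {x | ¬ G x ≤ c} ≤ ENNReal.ofReal T := by
  have ha1 : (1 : ℝ≥0∞) ≤ ENNReal.ofReal a := by simpa using ENNReal.ofReal_le_ofReal ha
  rcases hT with hT | hT
  · have h1 := measure_gt_le_of_mul_lintegral ν hG (a := ENNReal.ofReal a)
      (by positivity) ENNReal.ofReal_ne_top
    rw [← ENNReal.ofReal_inv_of_pos (by linarith)] at h1
    refine (measure_mono fun x hx => ?_).trans (h1.trans (ENNReal.ofReal_le_ofReal hT))
    exact lt_of_le_of_lt (le_self_add.trans hc) (not_le.1 hx)
  · refine (measure_mono fun x hx => ?_).trans (htail.trans (ENNReal.ofReal_le_ofReal hT))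
    refine lt_of_le_of_lt (le_trans ?_ hc) (not_le.1 hx)
    gcongr
    exact le_mul_of_one_le_left (zero_le) ha1

variable {d n k : ℕ} {ℓ : Bool → ℝ → ℝ} {F F₀ : Set (Cov d → ℝ)} {P₀ P₁ : Measure (Cov d)}
  {b L D δ : ℝ}

/-- A data set from its labels and its covariates. -/
def mkData (y : Fin n → Bool) (x : Fin n → Cov d) (i : Fin n) : Obs d := (x i, y i)

lemma ae_mem_support [IsProbabilityMeasure P₀] [IsProbabilityMeasure P₁] (y : Fin n → Bool) :
    ∀ᵐ x ∂Measure.pi (condLaw P₀ P₁ y), ∀ i ∈ minority y, x i ∈ P₁.support := by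
  rw [ae_all_iff]
  intro i
  by_cases hi : i ∈ minority y
  · have := ae_pi_eval (condLaw P₀ P₁ y) i (p := fun a => a ∈ P₁.support)
      (by rw [condLaw_of_mem hi]; exact Measure.support_mem_ae)
    filter_upwards [this] with x hx _ using hx
  · filter_upwards with x h using absurd h hi

/-- `H₁` is the radius at which the lower bound `c r ^ d` for the mass of a ball meets the
requirement of `small_ball_numerics` with equality. -/
lemma smoteH1_pow {c : ℝ} {m : ℕ} (hd : 0 < d) (hc : 0 < c) (hm : 0 < m) (hδ0 : 0 < δ)
    (hδ1 : δ < 1) :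
    0 < smoteH1 d k c δ m ∧
      c * smoteH1 d k c δ m ^ d * m = 3 * k + 4 * d * Real.log (32 * m / δ) := by
  have hm' : (1 : ℝ) ≤ m := by exact_mod_cast hm
  have hlog : 0 < Real.log (32 * m / δ) := by
    refine Real.log_pos ?_
    rw [lt_div_iff₀ hδ0]
    linarith
  have hd' : (0 : ℝ) < d := by exact_mod_cast hd
  have hpos : 0 < (3 * k + 4 * d * Real.log (32 * m / δ)) / (c * m) := by positivity
  refine ⟨Real.rpow_pos_of_pos hpos _, ?_⟩
  rw [smoteH1, ← Real.rpow_natCast, ← Real.rpow_mul hpos.le, one_div_mul_cancel hd'.ne',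
    Real.rpow_one]
  field_simp

lemma meanRadius_le_of_forall {z : Fin n → Obs d} {r : ℝ} (hm : 0 < numMin (labels z))
    (h : ∀ j ∈ minority (labels z), (knnRadius k z j : ℝ) ≤ r) : meanRadius k z ≤ r := by
  have hm' : (0 : ℝ) < numMin (labels z) := by exact_mod_cast hm
  rw [meanRadius, inv_mul_le_iff₀ hm']
  refine (Finset.sum_le_sum h).trans ?_
  rw [Finset.sum_const, nsmul_eq_mul]
  exact le_rfl

/-- The mean nearest-neighbour radius is at most `H₁`, up to an event of small probability. -/
lemma measure_meanRadius_le_smoteH1 [IsProbabilityMeasure P₀] [IsProbabilityMeasure P₁]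
    (hd : 0 < d) {y : Fin n → Bool} (hky : k < numMin y) {c : ℝ} (hc : 0 < c)
    (hball : BallLowerBound c P₁) (hδ0 : 0 < δ) (hδ1 : δ < 1) :
    Measure.pi (condLaw P₀ P₁ y) {x | ¬ meanRadius k (mkData y x) ≤ smoteH1 d k c δ (numMin y)} ≤
      ENNReal.ofReal (δ / 32) := by
  classical
  have hm : 0 < numMin y := by omega
  obtain ⟨hr, hr'⟩ := smoteH1_pow (d := d) (k := k) hd hc hm hδ0 hδ1
  set r := smoteH1 d k c δ (numMin y)
  set I := minority y with hI
  have hIc : I.card = numMin y := rfl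
  set B : Set (Cov d × Cov d) := {p | dist p.1 p.2 ≤ r} with hB
  have hBm : MeasurableSet B := measurableSet_le (by fun_prop) measurable_const
  -- If the mean radius exceeds `r`, so does some radius, and that base point has fewer than `k`
  -- other minority points within distance `r`.
  have key : ∀ x : Fin n → Cov d, ¬ meanRadius k (mkData y x) ≤ r →
      ∃ j ∈ I, ((I.erase j).filter fun l => (x l, x j) ∈ B).card < k := by
    intro x hx
    by_contra! hcon
    refine hx (meanRadius_le_of_forall hm fun j hj => ?_)
    exact knnRadius_le_of_card hr.le (hcon j hj)
  -- If `c r ^ d ≥ 1`, closed balls of radius `r` centred in the support have full mass and contain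
  -- the whole support, so almost surely all `n₁ - 1 ≥ k` other minority points are within `r`.
  -- Otherwise the Chernoff bound applies with `q = c r ^ d`.
  rcases le_or_gt 1 (c * r ^ d) with h1 | h1
  · refine le_trans (le_of_eq ?_) (zero_le)
    have hsub : ∀ a ∈ P₁.support, P₁.support ⊆ Metric.closedBall a r := by
      intro a ha
      have := hball a ha r hr
      rw [min_eq_right h1, ENNReal.ofReal_one] at this
      refine Measure.support_subset_of_isClosed Metric.isClosed_closedBall ?_
      exact (prob_compl_eq_zero_iff Metric.isClosed_closedBall.measurableSet).2
        (le_antisymm prob_le_one this)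
    refine measure_mono_null (t := {x | ¬ ∀ i ∈ I, x i ∈ P₁.support}) (fun x hx => ?_)
      (ae_mem_support y)
    intro hs
    obtain ⟨j, hj, hjk⟩ := key x hx
    rw [Finset.filter_true_of_mem, Finset.card_erase_of_mem hj, hIc] at hjk
    · omega
    · intro l hl
      exact hsub _ (hs j hj) (hs l (Finset.mem_of_mem_erase hl))
  · have hj : ∀ j ∈ I, Measure.pi (condLaw P₀ P₁ y)
        {x | ((I.erase j).filter fun l => (x l, x j) ∈ B).card < k} ≤
        ENNReal.ofReal (δ / (32 * numMin y)) := by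
      intro j hj
      refine (measure_card_filter_lt_le (condLaw P₀ P₁ y) B hBm j (I.erase j)
        (Finset.notMem_erase j I) h1.le ?_).trans ?_
      · rw [condLaw_of_mem hj]
        filter_upwards [Measure.support_mem_ae (μ := P₁)] with a ha l hl
        rw [condLaw_of_mem (Finset.mem_of_mem_erase hl)]
        have := hball a ha r hr
        rw [min_eq_left h1.le] at this
        exact this
      · rw [Finset.card_erase_of_mem hj, hIc]
        exact ENNReal.ofReal_le_ofReal (small_ball_numerics hd hm hδ0 hδ1 h1.le hr'.ge)
    have hsub : {x | ¬ meanRadius k (mkData y x) ≤ r} ⊆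
        ⋃ j ∈ I, {x : Fin n → Cov d | ((I.erase j).filter fun l => (x l, x j) ∈ B).card < k} := by
      intro x hx
      obtain ⟨j, hj, hjk⟩ := key x hx
      exact mem_biUnion (s := (I : Set (Fin n))) hj hjk
    refine (measure_mono hsub).trans ((measure_biUnion_finset_le _ _).trans
      ((Finset.sum_le_sum hj).trans (le_of_eq ?_)))
    rw [Finset.sum_const, nsmul_eq_mul, ← ENNReal.ofReal_natCast,
      ← ENNReal.ofReal_mul (by positivity), hIc]
    have : (numMin y : ℝ) ≠ 0 := by positivity
    congr 1
    field_simp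

/-- The admissible bandwidths. -/
def IsBandwidth (k : ℕ) (P₁ : Measure (Cov d)) (D δ : ℝ) (m : ℕ) (H : ℝ) : Prop :=
  H = smoteH2 d k D δ m ∨
    ∃ c : ℝ, 0 < c ∧ BallLowerBound c P₁ ∧ H = min (smoteH1 d k c δ m) (smoteH2 d k D δ m)

/-- The packing bound, with constant `4` in place of `6`, already suffices; the second term of `H₂`
only adds slack. -/
lemma meanRadius_le_smoteH2 (hd : 0 < d) (hD : 0 < D) {z : Fin n → Obs d}
    (hkm : k < numMin (labels z)) (hz : ∀ j ∈ minority (labels z), ‖(z j).1‖ ≤ D) :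
    meanRadius k z ≤ smoteH2 d k D δ (numMin (labels z)) := by
  refine (meanRadius_le hd hD (by omega) hz).trans ?_
  rw [smoteH2]
  have h1 : 0 ≤ D * ((k : ℝ) / numMin (labels z)) ^ (1 / d : ℝ) := by positivity
  have h2 : 0 ≤ 2 * D * √(2 * Real.log (2 / δ)) *
    ((k * 5 ^ d + 1) / √(numMin (labels z) : ℝ)) := by positivity
  nlinarith

lemma measure_meanRadius_le [IsProbabilityMeasure P₀] [IsProbabilityMeasure P₁]
    (hd : 0 < d) (hD : 0 < D) (hsupp : ∀ x ∈ P₁.support, ‖x‖ ≤ D) {y : Fin n → Bool}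
    (hky : k < numMin y) (hδ0 : 0 < δ) (hδ1 : δ < 1) {H : ℝ}
    (hH : IsBandwidth k P₁ D δ (numMin y) H) :
    Measure.pi (condLaw P₀ P₁ y) {x | ¬ meanRadius k (mkData y x) ≤ H} ≤
      ENNReal.ofReal (δ / 32) := by
  have h2 : Measure.pi (condLaw P₀ P₁ y)
      {x | ¬ meanRadius k (mkData y x) ≤ smoteH2 d k D δ (numMin y)} = 0 := by
    refine measure_mono_null (t := {x | ¬ ∀ i ∈ minority y, x i ∈ P₁.support}) (fun x hx hs => hx ?_)
      (ae_mem_support y)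
    exact meanRadius_le_smoteH2 hd hD (z := mkData y x) hky fun j hj => hsupp _ (hs j hj)
  rcases hH with rfl | ⟨c, hc, hball, rfl⟩
  · rw [h2]; exact zero_le
  · have h1 := measure_meanRadius_le_smoteH1 (P₀ := P₀) hd hky hc hball hδ0 hδ1
    calc _ ≤ Measure.pi (condLaw P₀ P₁ y)
          ({x | ¬ meanRadius k (mkData y x) ≤ smoteH1 d k c δ (numMin y)} ∪
            {x | ¬ meanRadius k (mkData y x) ≤ smoteH2 d k D δ (numMin y)}) := by
          refine measure_mono fun x hx => ?_
          by_contra hcon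
          rw [mem_union, not_or] at hcon
          exact hx (le_min (not_not.1 hcon.1) (not_not.1 hcon.2))
      _ ≤ _ := (measure_union_le _ _).trans (by rw [h2, add_zero]; exact h1)

namespace RegularClass

variable (h : RegularClass ℓ F F₀ P₀ P₁ b L D) [IsProbabilityMeasure P₀] [IsProbabilityMeasure P₁]
include h

lemma measure_subDev_le {y : Fin n → Bool} (hm : 0 < numMin y) {a s T : ℝ} (ha : 1 ≤ a)
    (hs : 0 ≤ s) (hT : a⁻¹ ≤ T ∨ Real.exp (-2 * s ^ 2) ≤ T) :
    Measure.pi (condLaw P₀ P₁ y) {x | ¬ subDev (clampOne ℓ F₀ b) P₁ (minority y) x ≤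
      ENNReal.ofReal (2 * a * radComplexity ℓ F (numMin y) (withLabelOne P₁) +
        2 * s * (b / √(numMin y : ℝ)))} ≤ ENNReal.ofReal T := by
  have := h.countable
  have hb := h.b_pos
  have hR := radComplexity_nonneg (ℓ := ℓ) (F := F) (numMin y) (withLabelOne P₁)
  have hν : ∀ i ∈ minority y, condLaw P₀ P₁ y i = P₁ := fun i hi => condLaw_of_mem hi
  refine measure_not_le_le_of_tail _ (measurable_subDev h.measurable_clampOne _) ha
    (measure_subDev_gt_le h.measurable_clampOne h.abs_clampOne_le h.b_pos hm _ hν hs) ?_ hT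
  have h1 := lintegral_subDev_le h.measurable_clampOne h.abs_clampOne_le hm (condLaw P₀ P₁ y) hν
  change _ ≤ 2 * (((numMin y : ℕ) : ℝ≥0∞)⁻¹ * radInt _ (Fin (numMin y)) P₁) at h1
  rw [h.ofReal_radComplexity_minority hm] at h1
  refine (add_le_add (mul_le_mul_right h1 _) le_rfl).trans (le_of_eq ?_)
  rw [ENNReal.ofReal_add (by positivity) (by positivity), mul_assoc 2 a,
    ENNReal.ofReal_mul (p := 2) (q := a * _) (by norm_num), ENNReal.ofReal_mul (p := a)
    (by positivity), ENNReal.ofReal_ofNat, mul_left_comm]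
  rfl

lemma measure_boot_le {J : ℕ} (hJ : 0 < J) {y : Fin n → Bool} (hm : 0 < numMin y) {a s T : ℝ}
    (ha : 1 ≤ a) (hs : 0 ≤ s) (hT : a⁻¹ ≤ T ∨ Real.exp (-2 * s ^ 2) ≤ T) :
    Measure.pi (condLaw P₀ P₁ y) {x | ¬ boot (clampOne ℓ F₀ b) J (minority y) x ≤
      J * ENNReal.ofReal (a * (1.65 * resampleFactor (numMin y) J) *
        radComplexity ℓ F (numMin y) (withLabelOne P₁) +
        2 * s * (b / √(numMin y : ℝ)))} ≤ ENNReal.ofReal T := by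
  have := h.countable
  have hb := h.b_pos
  have hR := radComplexity_nonneg (ℓ := ℓ) (F := F) (numMin y) (withLabelOne P₁)
  have hrf := resampleFactor_nonneg (J := J) hm
  have hν : ∀ i ∈ minority y, condLaw P₀ P₁ y i = P₁ := fun i hi => condLaw_of_mem hi
  refine measure_not_le_le_of_tail _ (measurable_boot h.measurable_clampOne J hm) ha
    (measure_boot_gt_le h.measurable_clampOne h.abs_clampOne_le h.b_pos hJ hm _ hs) ?_ hT
  have h1 := lintegral_boot_le h.measurable_clampOne hJ hm (condLaw P₀ P₁ y) hν
  change _ ≤ J * (ENNReal.ofReal (1.65 * resampleFactor (numMin y) J) *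
    (((numMin y : ℕ) : ℝ≥0∞)⁻¹ * radInt _ (Fin (numMin y)) P₁)) at h1
  rw [h.ofReal_radComplexity_minority hm] at h1
  refine (add_le_add (mul_le_mul_right h1 _) le_rfl).trans (le_of_eq ?_)
  rw [ENNReal.ofReal_add (by positivity) (by positivity), mul_add,
    ENNReal.ofReal_mul (p := a * _) (by positivity), ENNReal.ofReal_mul (p := a) (by positivity),
    ENNReal.ofReal_mul (p := (J : ℝ)) (by positivity), ENNReal.ofReal_natCast]
  change _ + _ * ENNReal.ofReal (2 * s * (b / √(numMin y : ℝ))) = _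
  congr 1
  ring

end RegularClass

end Events

/-! ### Bias and Rademacher complexity of the SMOTE law. -/

section SmoteBounds

lemma abs_le_of_enorm_le {x c : ℝ} (hc : 0 ≤ c) (h : ‖x‖ₑ ≤ ENNReal.ofReal c) : |x| ≤ c := by
  rwa [Real.enorm_eq_ofReal_abs, ENNReal.ofReal_le_ofReal_iff hc] at h

lemma tendsto_integral_of_bound {𝒳 : Type*} [MeasurableSpace 𝒳] {ν : Measure 𝒳}
    [IsFiniteMeasure ν] {u : ℕ → 𝒳 → ℝ} {g : 𝒳 → ℝ} {B : ℝ} (hu : ∀ m, Measurable (u m))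
    (hB : ∀ᵐ x ∂ν, ∀ m, |u m x| ≤ B) (hlim : ∀ x, Tendsto (u · x) atTop (𝓝 (g x))) :
    Tendsto (fun m => ∫ x, u m x ∂ν) atTop (𝓝 (∫ x, g x ∂ν)) :=
  tendsto_integral_of_dominated_convergence (fun _ => B) (fun m => (hu m).aestronglyMeasurable)
    (integrable_const B) (fun m => hB.mono fun _ hx => hx m) (Eventually.of_forall hlim)

variable {d n k : ℕ} {ℓ : Bool → ℝ → ℝ} {F F₀ : Set (Cov d → ℝ)} {P₀ P₁ : Measure (Cov d)}
  {b L D δ p : ℝ} {Ω : Type*} [MeasurableSpace Ω] {μ : Measure Ω} {Z : Ω → Fin n → Obs d}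

lemma exp_neg_two_mul_sq_sqrt {c a : ℝ} (hc : 0 ≤ c) (ha : 1 ≤ a) (N : ℕ) (hN : (N : ℝ) = 2 * c) :
    Real.exp (-2 * √(c * Real.log a) ^ 2) = (a⁻¹) ^ N := by
  have hlog := Real.log_nonneg ha
  have ha0 : 0 < a := by linarith
  rw [Real.sq_sqrt (by positivity), ← Real.rpow_natCast, Real.rpow_def_of_pos (by positivity),
    Real.log_inv, hN]
  congr 1
  ring

namespace RegularClass

variable (h : RegularClass ℓ F F₀ P₀ P₁ b L D) [IsProbabilityMeasure P₁]
include h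

/-- The bound passes from `F₀` to `F` by dominated convergence, under `P₁` with the constant `b` and
under the SMOTE law with `b + 2LD`. -/
lemma abs_integral_smote_sub_le {z : Fin n → Obs d}
    (hz : ∀ j ∈ minority (labels z), (z j).1 ∈ P₁.support) (hk : 0 < k)
    (hkm : k < numMin (labels z)) {c : ℝ} (hc : 0 ≤ c)
    (hle : supE (fun f => ∫ x, lossOne ℓ F₀ f x ∂smote k z - ∫ x, lossOne ℓ F₀ f x ∂P₁) ≤
      ENNReal.ofReal c) {f : Cov d → ℝ} (hf : f ∈ F) :
    |∫ x, ℓ true (f x) ∂smote k z - ∫ x, ℓ true (f x) ∂P₁| ≤ c := by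
  have := isProbabilityMeasure_smote hk hkm
  obtain ⟨u, hu, hlim⟩ := h.dense.2 f hf
  have h1 : Tendsto (fun m => ∫ x, lossOne ℓ F₀ ⟨u m, hu m⟩ x ∂smote k z) atTop
      (𝓝 (∫ x, ℓ true (f x) ∂smote k z)) :=
    tendsto_integral_of_bound (fun m => h.measurable_lossOne _)
      ((h.ae_smote_bound hz).mono fun x hx m => hx _ (h.dense.1 (hu m))) fun x => hlim x true
  have h2 : Tendsto (fun m => ∫ x, lossOne ℓ F₀ ⟨u m, hu m⟩ x ∂P₁) atTop
      (𝓝 (∫ x, ℓ true (f x) ∂P₁)) :=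
    tendsto_integral_of_bound (B := b) (fun m => h.measurable_lossOne _)
      (by filter_upwards [Measure.support_mem_ae (μ := P₁)] with x hx m
            using h.bound_true x hx _ (h.dense.1 (hu m))) fun x => hlim x true
  exact le_of_tendsto (h1.sub h2).abs
    (Eventually.of_forall fun m => abs_le_of_enorm_le hc
      ((le_supE (fun f => ∫ x, lossOne ℓ F₀ f x ∂smote k z - ∫ x, lossOne ℓ F₀ f x ∂P₁)
        ⟨u m, hu m⟩).trans hle))

variable [IsProbabilityMeasure P₀]

theorem measure_smote_deviation_le (hd : 0 < d) (hk : 0 < k) (hp0 : 0 < p) (hp1 : p < 1)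
    (hδ0 : 0 < δ) (hδ1 : δ < 1) (hZ : Measurable Z)
    (hlaw : μ.map Z = Measure.pi fun _ => labelMixture p P₀ P₁) {y : Fin n → Bool}
    (hky : k < numMin y) {H : ℝ} (hH : IsBandwidth k P₁ D δ (numMin y) H) :
    μ {ω | labels (Z ω) = y ∧
        ¬ ∀ f ∈ F, |∫ x, ℓ true (f x) ∂(smote k (Z ω)) - ∫ x, ℓ true (f x) ∂P₁| ≤
          2 * radComplexity ℓ F (numMin y) (withLabelOne P₁) + L * H +
            2 * √(2 * Real.log (2 / δ)) * (b / √(numMin y : ℝ))}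
      ≤ ENNReal.ofReal δ * μ {ω | labels (Z ω) = y} := by
  have hL := h.L_pos
  have hb := h.b_pos
  have hR := radComplexity_nonneg (ℓ := ℓ) (F := F) (numMin y) (withLabelOne P₁)
  set ν := Measure.pi (condLaw P₀ P₁ y)
  set s := √(2 * Real.log (2 / δ)) with hs
  have hm : 0 < numMin y := by omega
  set A₁ : Set (Fin n → Cov d) := {x | ¬ ∀ i ∈ minority y, x i ∈ P₁.support}
  set A₂ : Set (Fin n → Cov d) := {x | ¬ meanRadius k (mkData y x) ≤ H}
  set A₃ : Set (Fin n → Cov d) := {x | ¬ subDev (clampOne ℓ F₀ b) P₁ (minority y) x ≤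
      ENNReal.ofReal (2 * 1 * radComplexity ℓ F (numMin y) (withLabelOne P₁) +
        2 * s * (b / √(numMin y : ℝ)))}
  have h1 : ν A₁ = 0 := ae_mem_support y
  have h2 : ν A₂ ≤ ENNReal.ofReal (δ / 32) :=
    measure_meanRadius_le hd h.D_pos h.norm_le hky hδ0 hδ1 hH
  -- With `s² = 2 log (2/δ)` McDiarmid gives `(δ/2)⁴`, and the constant `a = 1` makes the Markov
  -- alternative unnecessary.
  have h3 : ν A₃ ≤ ENNReal.ofReal (δ / 2) := by
    refine h.measure_subDev_le hm le_rfl (Real.sqrt_nonneg _) (Or.inr ?_)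
    rw [exp_neg_two_mul_sq_sqrt (by norm_num) (by rw [le_div_iff₀ hδ0]; linarith) 4 (by norm_num),
      inv_div]
    exact pow_le_of_le_one (by positivity) (by linarith) (by norm_num)
  have hA : ν (A₁ ∪ A₂ ∪ A₃) ≤ ENNReal.ofReal δ := by
    refine (measure_union_le _ _).trans ((add_le_add ((measure_union_le _ _).trans
      (add_le_add h1.le h2)) h3).trans ?_)
    rw [zero_add, ← ENNReal.ofReal_add (by positivity) (by positivity)]
    exact ENNReal.ofReal_le_ofReal (by linarith)
  refine (measure_mono fun ω hω => ?_).trans ((measure_labels_inter_le hp0.le hp1.le hZ hlaw y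
    (A₁ ∪ A₂ ∪ A₃)).trans (mul_le_mul_left hA _))
  obtain ⟨rfl, hω⟩ := hω
  refine ⟨rfl, ?_⟩
  by_contra hcon
  rw [mem_union, mem_union, not_or, not_or] at hcon
  obtain ⟨⟨g1, g2⟩, g3⟩ := hcon
  have g1 := not_not.1 g1
  have g2 : meanRadius k (Z ω) ≤ H := not_not.1 g2
  have g3 := not_not.1 g3
  have hH0 := (meanRadius_nonneg k (Z ω)).trans g2
  refine hω fun f hf => h.abs_integral_smote_sub_le g1 hk hky (by positivity) ?_ hf
  refine (h.supE_smote_sub_le g1 hk hky).trans ((add_le_add (ENNReal.ofReal_le_ofReal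
    (mul_le_mul_of_nonneg_left g2 hL.le)) g3).trans (le_of_eq ?_))
  rw [← ENNReal.ofReal_add (by positivity) (by positivity)]
  congr 1
  ring

theorem measure_smote_complexity_le {J : ℕ} (hJ : 0 < J) (hd : 0 < d) (hk : 0 < k) (hp0 : 0 < p)
    (hp1 : p < 1) (hδ0 : 0 < δ) (hδ1 : δ < 1) (hZ : Measurable Z)
    (hlaw : μ.map Z = Measure.pi fun _ => labelMixture p P₀ P₁) {y : Fin n → Bool}
    (hky : k < numMin y) {H : ℝ} (hH : IsBandwidth k P₁ D δ (numMin y) H) :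
    μ {ω | labels (Z ω) = y ∧
        ¬ radComplexity ℓ F J (withLabelOne (smote k (Z ω))) ≤
          4 * (√((numMin y : ℝ) / J * Real.log (2 * numMin y)) +
              (numMin y : ℝ) / J * Real.log (2 * numMin y)) *
            radComplexity ℓ F (numMin y) (withLabelOne P₁) + L * H +
            2 * √(2 * Real.log (1 / δ)) * (b / √(numMin y : ℝ))}
      ≤ ENNReal.ofReal δ * μ {ω | labels (Z ω) = y} := by
  have hL := h.L_pos
  have hb := h.b_pos
  have hR := radComplexity_nonneg (ℓ := ℓ) (F := F) (numMin y) (withLabelOne P₁)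
  set ν := Measure.pi (condLaw P₀ P₁ y)
  set s := √(2 * Real.log (1 / δ)) with hs
  have hm : 0 < numMin y := by omega
  have hrf := resampleFactor_nonneg (J := J) hm
  set A₁ : Set (Fin n → Cov d) := {x | ¬ ∀ i ∈ minority y, x i ∈ P₁.support}
  set A₂ : Set (Fin n → Cov d) := {x | ¬ meanRadius k (mkData y x) ≤ H}
  set A₃ : Set (Fin n → Cov d) := {x | ¬ boot (clampOne ℓ F₀ b) J (minority y) x ≤
      J * ENNReal.ofReal (2.4 * (1.65 * resampleFactor (numMin y) J) *
        radComplexity ℓ F (numMin y) (withLabelOne P₁) +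
        2 * s * (b / √(numMin y : ℝ)))}
  have h1 : ν A₁ = 0 := ae_mem_support y
  have h2 : ν A₂ ≤ ENNReal.ofReal (δ / 32) :=
    measure_meanRadius_le hd h.D_pos h.norm_le hky hδ0 hδ1 hH
  -- The Markov factor `2.4` is admissible because `2.4 · 1.65 ≤ 4`. For `δ > 1/2` its failure
  -- probability `5/12` is below `5δ/6`; for `δ ≤ 1/2` McDiarmid gives `δ⁴`. Together with `δ/32`
  -- for the radius the total is below `δ`.
  have h3 : ν A₃ ≤ ENNReal.ofReal (5 / 6 * δ) := by
    refine h.measure_boot_le hJ hm (by norm_num) (Real.sqrt_nonneg _) ?_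
    rcases le_or_gt δ (1 / 2) with hδ | hδ
    · right
      rw [exp_neg_two_mul_sq_sqrt (by norm_num) (by rw [le_div_iff₀ hδ0]; linarith) 4
        (by norm_num), inv_div, div_one]
      have : δ ^ 3 ≤ (1 / 2) ^ 3 := by gcongr
      nlinarith
    · left
      norm_num
      linarith
  have hA : ν (A₁ ∪ A₂ ∪ A₃) ≤ ENNReal.ofReal δ := by
    refine (measure_union_le _ _).trans ((add_le_add ((measure_union_le _ _).trans
      (add_le_add h1.le h2)) h3).trans ?_)
    rw [zero_add, ← ENNReal.ofReal_add (by positivity) (by positivity)]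
    exact ENNReal.ofReal_le_ofReal (by linarith)
  refine (measure_mono fun ω hω => ?_).trans ((measure_labels_inter_le hp0.le hp1.le hZ hlaw y
    (A₁ ∪ A₂ ∪ A₃)).trans (mul_le_mul_left hA _))
  obtain ⟨rfl, hω⟩ := hω
  refine ⟨rfl, ?_⟩
  by_contra hcon
  rw [mem_union, mem_union, not_or, not_or] at hcon
  obtain ⟨⟨g1, g2⟩, g3⟩ := hcon
  have g1 := not_not.1 g1
  have g2 : meanRadius k (Z ω) ≤ H := not_not.1 g2
  have g3 := not_not.1 g3
  have hH0 := (meanRadius_nonneg k (Z ω)).trans g2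
  change 0 ≤ resampleFactor (numMin (labels (Z ω))) J at hrf
  refine hω ?_
  change _ ≤ 4 * resampleFactor (numMin (labels (Z ω))) J * _ + _ + _
  refine (ENNReal.ofReal_le_ofReal_iff (by positivity)).1 ?_
  rw [← h.ofReal_radComplexity_smote g1 hk hky hJ]
  have hJ0 : (J : ℝ≥0∞) ≠ 0 := by simpa using hJ.ne'
  refine (mul_le_mul_right ((h.radInt_smote_le_boot g1 hk hky J).trans (add_le_add g3
    (mul_le_mul_right (ENNReal.ofReal_le_ofReal (mul_le_mul_of_nonneg_left g2 hL.le)) _))) _).trans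
    ?_
  rw [← mul_add, ← mul_assoc, ENNReal.inv_mul_cancel hJ0 (ENNReal.natCast_ne_top J), one_mul,
    ← ENNReal.ofReal_add (by positivity) (by positivity)]
  refine ENNReal.ofReal_le_ofReal ?_
  have : 2.4 * (1.65 * resampleFactor (numMin (labels (Z ω))) J) *
      radComplexity ℓ F (numMin (labels (Z ω))) (withLabelOne P₁) ≤
      4 * resampleFactor (numMin (labels (Z ω))) J *
      radComplexity ℓ F (numMin (labels (Z ω))) (withLabelOne P₁) := by
    refine mul_le_mul_of_nonneg_right ?_ hR
    linarith
  linarith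

end RegularClass

end SmoteBounds

/-! ### Measurable dependence of the SMOTE law on the data. -/

section SmoteMeasurable

variable {d n : ℕ}

lemma measurable_labels : Measurable (labels : (Fin n → Obs d) → Fin n → Bool) :=
  measurable_pi_iff.2 fun i => measurable_snd.comp (measurable_pi_apply i)

lemma measurableSet_mem_minority (i : Fin n) :
    MeasurableSet {z : Fin n → Obs d | i ∈ minority (labels z)} := by
  have : {z : Fin n → Obs d | i ∈ minority (labels z)} = labels ⁻¹' {y | i ∈ minority y} := rfl
  rw [this]
  exact measurable_labels (Set.toFinite _).measurableSet

lemma measurableSet_precedes (j i l : Fin n) :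
    MeasurableSet {z : Fin n → Obs d | Precedes z j i l} := by
  have hm : ∀ i, Measurable fun z : Fin n → Obs d => dist (z i).1 (z j).1 := fun i => by fun_prop
  exact (measurableSet_lt (hm i) (hm l)).union
    ((measurableSet_eq_fun (hm i) (hm l)).inter (MeasurableSet.const _))

lemma measurableSet_mem_knn (k : ℕ) (j l : Fin n) :
    MeasurableSet {z : Fin n → Obs d | l ∈ knn k z j} := by
  classical
  have h1 : ∀ i, MeasurableSet {z : Fin n → Obs d | i ∈ (minority (labels z)).erase j} := by
    intro i
    simp only [Finset.mem_erase]
    exact (MeasurableSet.const _).inter (measurableSet_mem_minority i)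
  have h2 : Measurable fun z : Fin n → Obs d =>
      (((minority (labels z)).erase j).filter fun i => Precedes z j i l).card := by
    have : (fun z : Fin n → Obs d =>
        (((minority (labels z)).erase j).filter fun i => Precedes z j i l).card) =
        fun z => ∑ i, if i ∈ (minority (labels z)).erase j ∧ Precedes z j i l then 1 else 0 := by
      ext z
      rw [Finset.sum_boole, Nat.cast_id]
      congr 1
      ext i
      simp
    rw [this]
    exact Finset.measurable_sum _ fun i _ =>
      Measurable.ite ((h1 i).inter (measurableSet_precedes j i l)) measurable_const measurable_const
  have : {z : Fin n → Obs d | l ∈ knn k z j} =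
      {z | l ∈ (minority (labels z)).erase j} ∩
        {z | (((minority (labels z)).erase j).filter fun i => Precedes z j i l).card < k} := by
    ext z
    simp only [knn, mem_ofPred_eq, Finset.mem_filter, mem_inter_iff]
  rw [this]
  exact (h1 l).inter (measurableSet_lt h2 measurable_const)

/-- Needed because `IsSmoteSample` only concerns measurable joint events of data and synthetic
points, and these involve SMOTE means. -/
lemma measurable_smote (k : ℕ) : Measurable (smote k : (Fin n → Obs d) → Measure (Cov d)) := by
  classical
  refine Measure.measurable_of_measurable_coe _ fun s hs => ?_
  have hseg : ∀ j l : Fin n, Measurable fun q : (Fin n → Obs d) × ℝ =>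
      (q.1 j).1 + q.2 • ((q.1 l).1 - (q.1 j).1) := fun j l => by fun_prop
  have hz : ∀ (z : Fin n → Obs d) (j l : Fin n), Measurable fun t : ℝ =>
      (z j).1 + t • ((z l).1 - (z j).1) := fun z j l => by fun_prop
  have : (fun z : Fin n → Obs d => smote k z s) = fun z =>
      (numMin (labels z) : ℝ≥0∞)⁻¹ * ∑ j, if j ∈ minority (labels z) then
        (k : ℝ≥0∞)⁻¹ * ∑ l, if l ∈ knn k z j then
          (volume.restrict (Icc (0 : ℝ) 1)) {t | (z j).1 + t • ((z l).1 - (z j).1) ∈ s}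
        else 0 else 0 := by
    ext z
    rw [smote, Measure.smul_apply, Measure.finsetSum_apply, smul_eq_mul, Finset.sum_ite_mem,
      Finset.univ_inter]
    congr 1
    refine Finset.sum_congr rfl fun j _ => ?_
    rw [Measure.smul_apply, Measure.finsetSum_apply, smul_eq_mul, Finset.sum_ite_mem,
      Finset.univ_inter]
    congr 1
    exact Finset.sum_congr rfl fun l _ => Measure.map_apply (hz z j l) hs
  rw [this]
  have hnum : Measurable fun z : Fin n → Obs d => (numMin (labels z) : ℝ≥0∞)⁻¹ :=
    (Measurable.of_discrete (f := fun y : Fin n → Bool => (numMin y : ℝ≥0∞)⁻¹)).comp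
      measurable_labels
  refine hnum.mul (Finset.measurable_sum _ fun j _ =>
    Measurable.ite (measurableSet_mem_minority j) (measurable_const.mul
      (Finset.measurable_sum _ fun l _ => Measurable.ite (measurableSet_mem_knn k j l) ?_
        measurable_const)) measurable_const)
  exact measurable_measure_prodMk_left (ν := volume.restrict (Icc (0 : ℝ) 1)) (hseg j l hs)

/-- A measurable version of the integral of a bounded function under the SMOTE law. -/
noncomputable def smoteMean (k : ℕ) (B : ℝ) (g : Cov d → ℝ) (z : Fin n → Obs d) : ℝ :=
  (∫⁻ x, ENNReal.ofReal (g x + B) ∂smote k z).toReal - B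

/-- The shift by `B` in the definition allows measurability in the data to be read off from a lower
Lebesgue integral. -/
lemma measurable_smoteMean (k : ℕ) (B : ℝ) {g : Cov d → ℝ} (hg : Measurable g) :
    Measurable (smoteMean (n := n) k B g) := by
  refine Measurable.sub_const (Measurable.ennreal_toReal ?_) _
  exact (Measure.measurable_lintegral (hg.add_const B).ennreal_ofReal).comp (measurable_smote k)

lemma smoteMean_eq {k : ℕ} {B : ℝ} {g : Cov d → ℝ} (hg : Measurable g) (hB : ∀ x, |g x| ≤ B)
    {z : Fin n → Obs d} (hk : 0 < k) (hkm : k < numMin (labels z)) :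
    smoteMean k B g z = ∫ x, g x ∂smote k z := by
  have := isProbabilityMeasure_smote hk hkm
  have hi : Integrable g (smote k z) :=
    Integrable.of_bound hg.aestronglyMeasurable B (ae_of_all _ hB)
  rw [smoteMean, ← integral_eq_lintegral_of_nonneg_ae
    (ae_of_all _ fun x => by have := (abs_le.1 (hB x)).1; simp only [Pi.zero_apply]; linarith)
    (hg.add_const B).aestronglyMeasurable, integral_add hi (integrable_const _)]
  simp

end SmoteMeasurable

/-! ### Deviation of the data part of the risk, and of the class counts. -/

section RiskEvents

lemma lintegral_rad_ite_le {ι 𝒳 : Type*} [Countable ι] [MeasurableSpace 𝒳] {n N : ℕ}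
    {V : ι → 𝒳 → ℝ} (hV : ∀ f, Measurable (V f)) {P : Measure 𝒳} [IsProbabilityMeasure P]
    (ν : Fin n → Measure 𝒳) [∀ i, IsProbabilityMeasure (ν i)] (y : Fin n → Bool)
    (hν : ∀ i, y i = true → ν i = P) (hN : n ≤ N) :
    ∫⁻ x, rad (fun i f => if y i then V f (x i) else 0) ∂Measure.pi ν ≤ radInt V (Fin N) P := by
  classical
  have hI : ∀ i ∈ minority y, ν i = P := fun i hi => hν i (mem_minority.1 hi)
  have h1 : ∀ x : Fin n → 𝒳, rad (fun i f => if y i then V f (x i) else 0) =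
      rad fun (i : minority y) f => V f (x i) := by
    intro x
    have := rad_indicator_range (fun i : minority y => (i : Fin n)) Subtype.val_injective
      (fun i f => V f (x i))
    rw [Function.comp_def] at this
    rw [← this]
    congr 1
    ext i f
    simp only [Subtype.range_coe_subtype, mem_ofPred_eq, mem_minority]
    split_ifs <;> rfl
  simp_rw [h1]
  rw [lintegral_rad_subtype hV ν _ hI]
  have hc : (minority y).card ≤ N := (Finset.card_le_univ _).trans (by simpa using hN)
  exact radInt_mono hV P (Fin.castLE hc) (Fin.castLE_injective hc)

variable {d n k : ℕ} {ℓ : Bool → ℝ → ℝ} {F F₀ : Set (Cov d → ℝ)} {P₀ P₁ : Measure (Cov d)}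
  {b L D δ p : ℝ} {Ω : Type*} [MeasurableSpace Ω] {μ : Measure Ω} {Z : Ω → Fin n → Obs d}

lemma balanced_eq : balanced P₀ P₁ =
    (2 : ℝ≥0∞)⁻¹ • P₀.map (fun x => (x, false)) + (2 : ℝ≥0∞)⁻¹ • P₁.map (fun x => (x, true)) := by
  have : ENNReal.ofReal (1 / 2) = 2⁻¹ := by
    rw [one_div, ENNReal.ofReal_inv_of_pos (by norm_num), ENNReal.ofReal_ofNat]
  rw [balanced, labelMixture, show (1 - 1 / 2 : ℝ) = 1 / 2 by norm_num, this]

lemma radInt_label_le {ι : Type*} [Countable ι] {V : ι → Obs d → ℝ} (hV : ∀ f, Measurable (V f))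
    [IsProbabilityMeasure P₀] [IsProbabilityMeasure P₁] (N : ℕ) (c : Bool) :
    radInt (fun f x => V f (x, c)) (Fin N) (if c then P₁ else P₀) ≤
      2 * radInt V (Fin N) (balanced P₀ P₁) := by
  have h0 : IsProbabilityMeasure (P₀.map fun x => (x, false)) :=
    Measure.isProbabilityMeasure_map (measurable_pair_label false).aemeasurable
  have h1 : IsProbabilityMeasure (P₁.map fun x => (x, true)) :=
    Measure.isProbabilityMeasure_map (measurable_pair_label true).aemeasurable
  rw [balanced_eq]
  cases c
  · simp only [Bool.false_eq_true, if_false]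
    rw [← radInt_map hV P₀ (measurable_pair_label false)]
    exact radInt_le_two_mul_mixture hV _ _
  · simp only [if_true]
    rw [← radInt_map hV P₁ (measurable_pair_label true), add_comm]
    exact radInt_le_two_mul_mixture hV _ _

/-- The deviation of the empirical risk from its conditional mean given the labels. -/
noncomputable def dataDev {ι : Type*} (V : ι → Obs d → ℝ) (P₀ P₁ : Measure (Cov d)) (y : Fin n → Bool)
    (x : Fin n → Cov d) : ℝ≥0∞ :=
  sampleDev (fun i f a => V f (a, y i)) (condLaw P₀ P₁ y) x

/-- The exponent is `-2 log (4/δ)`, which yields `(δ/4)² ≤ δ/16`. -/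
lemma exp_fluctuation_le {N : ℕ} (hN : 0 < N) {B : ℝ} (hB : 0 < B) (hδ0 : 0 < δ)
    (hδ1 : δ < 1) :
    Real.exp (-2 * (B * √(N : ℝ) * √(Real.log (4 / δ))) ^ 2 / (N * B ^ 2)) ≤ δ / 16 := by
  have hN' : (0 : ℝ) < N := by exact_mod_cast hN
  have ha : 1 ≤ 4 / δ := by rw [le_div_iff₀ hδ0]; linarith
  have e1 : -2 * (B * √(N : ℝ) * √(Real.log (4 / δ))) ^ 2 / (N * B ^ 2) =
      -2 * √(1 * Real.log (4 / δ)) ^ 2 := by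
    rw [mul_pow, mul_pow, Real.sq_sqrt hN'.le, one_mul]
    field_simp
  rw [e1, exp_neg_two_mul_sq_sqrt (by norm_num) ha 2 (by norm_num), inv_div]
  nlinarith

namespace RegularClass

variable (h : RegularClass ℓ F F₀ P₀ P₁ b L D) [IsProbabilityMeasure P₀] [IsProbabilityMeasure P₁]
include h

/-- Given the labels the data are not identically distributed, so the family is split by label. Each
part is an i.i.d. sample of size at most `N`, and passing from one class to the balanced mixture
costs a factor `2` (`radInt_label_le`). -/
lemma lintegral_rad_data_le (y : Fin n → Bool) {N : ℕ} (hN : n ≤ N) :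
    ∫⁻ x, rad (fun i f => clampLoss ℓ F₀ b f (x i, y i)) ∂Measure.pi (condLaw P₀ P₁ y) ≤
      4 * radInt (clampLoss ℓ F₀ b) (Fin N) (balanced P₀ P₁) := by
  have := h.countable
  have hV := h.measurable_clampLoss
  have hVc : ∀ (c : Bool) f, Measurable fun x : Cov d => clampLoss ℓ F₀ b f (x, c) :=
    fun c f => (hV f).comp (measurable_pair_label c)
  have h1 := lintegral_rad_ite_le (hVc true) (P := P₁) (condLaw P₀ P₁ y) y
    (fun i hi => by simp [condLaw, hi]) hN
  have h0 := lintegral_rad_ite_le (hVc false) (P := P₀) (condLaw P₀ P₁ y) (fun i => !(y i))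
    (fun i hi => by simp at hi; simp [condLaw, hi]) hN
  have h1' := radInt_label_le (P₀ := P₀) (P₁ := P₁) hV N true
  have h0' := radInt_label_le (P₀ := P₀) (P₁ := P₁) hV N false
  simp only [Bool.false_eq_true, if_true, if_false] at h1' h0'
  have hm : Measurable fun x : Fin n → Cov d =>
      rad (fun i f => if y i then clampLoss ℓ F₀ b f (x i, true) else 0) := by
    refine measurable_rad fun i f => ?_
    cases y i
    · simp
    · simpa [Function.comp_def] using (hVc true f).comp (measurable_pi_apply i)
  calc _ ≤ ∫⁻ x, (rad (fun i f => if y i then clampLoss ℓ F₀ b f (x i, true) else 0) +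
        rad (fun i f => if !(y i) then clampLoss ℓ F₀ b f (x i, false) else 0))
          ∂Measure.pi (condLaw P₀ P₁ y) := by
        refine lintegral_mono fun x => (rad_le_ite_add_ite y _).trans (le_of_eq ?_)
        congr 2
        · ext i f; cases hy : y i <;> simp
        · ext i f; cases hy : y i <;> simp
    _ ≤ 2 * radInt (clampLoss ℓ F₀ b) (Fin N) (balanced P₀ P₁) +
        2 * radInt (clampLoss ℓ F₀ b) (Fin N) (balanced P₀ P₁) := by
        rw [lintegral_add_left hm]
        exact add_le_add (h1.trans h1') (h0.trans h0')
    _ = _ := by ring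

/-- The constant `8` is the `2` of symmetrization times the `4` of `lintegral_rad_data_le`. -/
lemma measure_dataDev_le {N : ℕ} (hN : n ≤ N) (hN0 : 0 < N) (hδ0 : 0 < δ) (hδ1 : δ < 1)
    (y : Fin n → Bool) :
    Measure.pi (condLaw P₀ P₁ y) {x | ¬ dataDev (clampLoss ℓ F₀ b) P₀ P₁ y x ≤
      ENNReal.ofReal (N * (8 * radComplexity ℓ F N (balanced P₀ P₁)) +
        2 * b * √(N : ℝ) * √(Real.log (4 / δ)))} ≤ ENNReal.ofReal (δ / 16) := by
  have := h.countable
  have hb := h.b_pos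
  have hR := radComplexity_nonneg (ℓ := ℓ) (F := F) N (balanced P₀ P₁)
  have hV := h.measurable_clampLoss
  have hU : ∀ (i : Fin n) f, Measurable fun a : Cov d => clampLoss ℓ F₀ b f (a, y i) :=
    fun i f => (hV f).comp (measurable_pair_label (y i))
  have hbd : ∀ (i : Fin n) f (a : Cov d), |clampLoss ℓ F₀ b f (a, y i)| ≤ b :=
    fun i f a => abs_clampLoss_le hb f _
  have hσ : (0 : ℝ) < N * (2 * b) ^ 2 := by positivity
  refine measure_not_le_le_of_tail _ (measurable_sampleDev hU _) le_rfl
    (measure_sampleDev_gt_le hU (condLaw P₀ P₁ y) (β := fun _ => b) (fun _ => hb.le) hbd hσ ?_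
      (by positivity)) ?_ (Or.inr (exp_fluctuation_le hN0 (by positivity) hδ0 hδ1))
  · rw [Finset.sum_const, Finset.card_univ, Fintype.card_fin, nsmul_eq_mul]
    gcongr
  · rw [ENNReal.ofReal_one, one_mul, ENNReal.ofReal_add (by positivity) (by positivity)]
    refine add_le_add ((lintegral_sampleDev_le hU _ hbd).trans ?_) le_rfl
    refine (mul_le_mul_right (h.lintegral_rad_data_le y hN) _).trans (le_of_eq ?_)
    have hN' : (N : ℝ≥0∞) ≠ 0 := by simpa using hN0.ne'
    rw [ENNReal.ofReal_mul (by positivity), ENNReal.ofReal_mul (by positivity),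
      ENNReal.ofReal_natCast, ← h.ofReal_radComplexity_balanced hN0, ENNReal.ofReal_ofNat,
      mul_left_comm (8 : ℝ≥0∞), ENNReal.mul_inv_cancel_left hN' (ENNReal.natCast_ne_top N),
      ← mul_assoc]
    norm_num

end RegularClass

/-- The number of majority observations concentrates around its mean. -/
lemma measure_numMaj_le [IsProbabilityMeasure P₀] [IsProbabilityMeasure P₁] (hp0 : 0 ≤ p)
    (hp1 : p ≤ 1) (hZ : Measurable Z)
    (hlaw : μ.map Z = Measure.pi fun _ => labelMixture p P₀ P₁) {N : ℕ} (hN : n ≤ N) (hN0 : 0 < N)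
    (hδ0 : 0 < δ) (hδ1 : δ < 1) :
    μ {ω | ¬ |(numMaj (labels (Z ω)) : ℝ) - n * (1 - p)| ≤ √(N : ℝ) * √(Real.log (4 / δ))} ≤
      ENNReal.ofReal (δ / 8) := by
  have := isProbabilityMeasure_labelMixture (P₀ := P₀) (P₁ := P₁) hp0 hp1
  set ν : Fin n → Measure (Obs d) := fun _ => labelMixture p P₀ P₁
  set g : Obs d → ℝ := fun z => if z.2 = false then 1 else 0 with hg
  have hset : MeasurableSet {z : Obs d | z.2 = false} :=
    measurable_snd (measurableSet_singleton false)
  have hgm : Measurable g := Measurable.ite hset measurable_const measurable_const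
  have hg01 : ∀ z, 0 ≤ g z ∧ g z ≤ 1 := by
    intro z; simp only [hg]; split_ifs <;> norm_num
  set G : (Fin n → Obs d) → ℝ := fun z => ∑ i, g (z i) with hG
  have hGm : Measurable G := Finset.measurable_sum _ fun i _ => hgm.comp (measurable_pi_apply i)
  have hGeq : ∀ z, (numMaj (labels z) : ℝ) = G z := by
    intro z; simp only [hG, hg, numMaj, labels, Finset.sum_boole]; congr!
  have hgi : ∫ z, g z ∂labelMixture p P₀ P₁ = 1 - p := by
    have h1 : g = Set.indicator {z : Obs d | z.2 = false} 1 := by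
      ext z; simp [hg, Set.indicator]
    rw [h1, integral_indicator_one hset]
    have h2 := labelMixture_apply_inter (p := p) (P₀ := P₀) (P₁ := P₁) univ MeasurableSet.univ false
    simp only [mem_univ, and_true, Bool.false_eq_true, if_false, measure_univ, mul_one] at h2
    rw [measureReal_def, h2, ENNReal.toReal_ofReal (by linarith)]
  have hGi : ∫ z, G z ∂Measure.pi ν = n * (1 - p) := by
    rw [hG, integral_finsetSum]
    · simp_rw [integral_pi_eval ν _ hgm]
      simp only [ν, hgi, Finset.sum_const, Finset.card_univ, Fintype.card_fin, nsmul_eq_mul]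
    · intro i _
      exact Integrable.of_bound (hgm.comp (measurable_pi_apply i)).aestronglyMeasurable 1
        (ae_of_all _ fun z => by
          rw [Real.norm_eq_abs, abs_of_nonneg (hg01 _).1]; exact (hg01 _).2)
  have hup : ∀ x i a, |G x - G (Function.update x i a)| ≤ 1 := by
    intro x i a
    rw [hG]
    simp only
    rw [← Finset.sum_sub_distrib, Finset.sum_eq_single i]
    · rw [Function.update_self, abs_le]
      have h1 := hg01 (x i); have h2 := hg01 a
      constructor <;> linarith [h1.1, h1.2, h2.1, h2.2]
    · intro j _ hj
      rw [Function.update_of_ne hj, sub_self]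
    · simp
  have hup' : ∀ x i a, |(-G x) - (-G (Function.update x i a))| ≤ 1 := by
    intro x i a
    rw [neg_sub_neg, abs_sub_comm]
    exact hup x i a
  have hσ : (0 : ℝ) < N := by exact_mod_cast hN0
  have hc : ∑ _i : Fin n, (1 : ℝ) ^ 2 ≤ N := by simpa using hN
  have hexp := exp_fluctuation_le hN0 one_pos hδ0 hδ1
  rw [one_mul, one_pow, mul_one] at hexp
  have e1 := (measure_ge_le_of_update ν hGm hup hσ hc
    (t := √(N : ℝ) * √(Real.log (4 / δ))) (by positivity)).trans (ENNReal.ofReal_le_ofReal hexp)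
  have e2 := (measure_ge_le_of_update ν hGm.neg hup' hσ hc
    (t := √(N : ℝ) * √(Real.log (4 / δ))) (by positivity)).trans (ENNReal.ofReal_le_ofReal hexp)
  rw [show (-G) = fun z => -G z from rfl] at e2
  simp only at e2
  rw [integral_neg, hGi] at e2
  rw [hGi] at e1
  have hmeas : MeasurableSet {z : Fin n → Obs d |
      ¬ |(numMaj (labels z) : ℝ) - n * (1 - p)| ≤ √(N : ℝ) * √(Real.log (4 / δ))} := by
    simp_rw [hGeq]
    exact (measurableSet_le (hGm.sub_const _).abs measurable_const).compl
  have e3 : μ {ω | ¬ |(numMaj (labels (Z ω)) : ℝ) - n * (1 - p)| ≤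
      √(N : ℝ) * √(Real.log (4 / δ))} = Measure.pi ν {z : Fin n → Obs d |
      ¬ |(numMaj (labels z) : ℝ) - n * (1 - p)| ≤ √(N : ℝ) * √(Real.log (4 / δ))} := by
    rw [← hlaw, Measure.map_apply hZ hmeas]
    rfl
  rw [e3]
  refine (measure_mono ?_).trans ((measure_union_le _ _).trans ((add_le_add e1 e2).trans ?_))
  · intro z hz
    rw [mem_ofPred_eq, hGeq, abs_le, not_and_or] at hz
    rcases hz with hz | hz
    · right
      simp only [mem_ofPred_eq]
      linarith
    · left
      simp only [mem_ofPred_eq]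
      linarith
  · rw [← ENNReal.ofReal_add (by positivity) (by positivity)]
    exact ENNReal.ofReal_le_ofReal (by linarith)

end RiskEvents

/-! ### Deviation of the synthetic sample given the data. -/

section SyntheticSample

variable {d n k J : ℕ} {ℓ : Bool → ℝ → ℝ} {F F₀ : Set (Cov d → ℝ)} {P₀ P₁ : Measure (Cov d)}
  {b L D δ : ℝ} {Ω : Type*} [MeasurableSpace Ω] {μ : Measure Ω} {Z : Ω → Fin n → Obs d}

/-- The deviation of a synthetic sample from its mean given the data. -/
noncomputable def synDev {ι : Type*} (V : ι → Cov d → ℝ) (k : ℕ) (B : ℝ) (z : Fin n → Obs d)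
    (s : Fin J → Cov d) : ℝ≥0∞ :=
  supE fun f => ∑ j, (V f (s j) - smoteMean k B (V f) z)

/-- The level that the deviation of the synthetic sample exceeds with small probability only. -/
noncomputable def synLevel {ι : Type*} (V : ι → Cov d → ℝ) (J : ℕ) (ρ : ℕ → ℝ) (t : ℝ)
    (z : Fin n → Obs d) : ℝ≥0∞ :=
  2 * (boot V J (minority (labels z)) (fun i => (z i).1) +
    J * ENNReal.ofReal (ρ (numMin (labels z)))) + ENNReal.ofReal t

lemma measurable_synLevel {ι : Type*} [Countable ι] {V : ι → Cov d → ℝ}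
    (hV : ∀ f, Measurable (V f)) (J : ℕ) (ρ : ℕ → ℝ) (t : ℝ) :
    Measurable (synLevel (n := n) V J ρ t) := by
  have h0 : ∀ I : Finset (Fin n), Measurable fun x : Fin n → Cov d => boot V J I x := by
    intro I
    rcases I.eq_empty_or_nonempty with rfl | hI
    · have h : (fun x : Fin n → Cov d => boot V J ∅ x) =
          fun _ => boot V J ∅ (fun _ : Fin n => (0 : Cov d)) := by
        funext x
        unfold boot
        congr 1
        funext f j
        exact absurd j.2 (Finset.notMem_empty _)
      rw [h]
      exact measurable_const
    · exact measurable_boot hV J hI.card_pos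
  have h1 : Measurable fun q : (Fin n → Bool) × (Fin n → Cov d) => boot V J (minority q.1) q.2 :=
    measurable_from_prod_countable_right fun y => h0 (minority y)
  have h2 : Measurable fun z : Fin n → Obs d => (labels z, fun i => (z i).1) :=
    measurable_labels.prodMk (by fun_prop)
  have h3 : Measurable fun z : Fin n → Obs d => ENNReal.ofReal (ρ (numMin (labels z))) :=
    (Measurable.of_discrete (f := fun y : Fin n → Bool => ENNReal.ofReal (ρ (numMin y)))).comp
      measurable_labels
  exact (((h1.comp h2).add (h3.const_mul _)).const_mul _).add_const _

lemma measurable_synDev {ι : Type*} [Countable ι] {V : ι → Cov d → ℝ}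
    (hV : ∀ f, Measurable (V f)) (k : ℕ) (B : ℝ) :
    Measurable fun q : (Fin n → Obs d) × (Fin J → Cov d) => synDev V k B q.1 q.2 :=
  measurable_supE fun f => Finset.measurable_sum _ fun j _ =>
    ((hV f).comp ((measurable_pi_apply j).comp measurable_snd)).sub
      ((measurable_smoteMean k B (hV f)).comp measurable_fst)

namespace RegularClass

variable (h : RegularClass ℓ F F₀ P₀ P₁ b L D) [IsProbabilityMeasure P₁]
include h

omit [IsProbabilityMeasure P₁] in
lemma measurable_clampOne' (B : ℝ) (f : F₀) : Measurable (clampOne ℓ F₀ B f) :=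
  (measurable_const.max (measurable_const.min (h.measurable f))).comp (measurable_pair_label true)

/-- Given the data the synthetic points are i.i.d. with losses bounded by `b + 2LD`. The mean
deviation is at most twice the complexity of the SMOTE law, which is that of the bootstrap up to `J
L` times the mean radius; this is the content of `synLevel`. -/
lemma measure_synDev_le {z : Fin n → Obs d}
    (hz : ∀ j ∈ minority (labels z), (z j).1 ∈ P₁.support) (hk : 0 < k)
    (hkm : k < numMin (labels z)) {ρ : ℕ → ℝ} (hρ : L * meanRadius k z ≤ ρ (numMin (labels z)))
    {N : ℕ} (hN : J ≤ N) (hN0 : 0 < N) (hδ0 : 0 < δ) (hδ1 : δ < 1) :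
    Measure.pi (fun _ : Fin J => smote k z)
      {s | ¬ (synDev (clampOne ℓ F₀ (b + 2 * L * D)) k (b + 2 * L * D) z s ≤
          synLevel (clampOne ℓ F₀ b) J ρ
            (2 * (b + 2 * L * D) * √(N : ℝ) * √(Real.log (4 / δ))) z ∧
        ∀ j f, |lossOne ℓ F₀ f (s j)| ≤ b + 2 * L * D)} ≤ ENNReal.ofReal (δ / 16) := by
  have := h.countable
  have hb := h.b_pos
  have hL := h.L_pos
  have hD := h.D_pos
  have := isProbabilityMeasure_smote hk hkm
  set B := b + 2 * L * D with hBdef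
  have hB : 0 < B := by positivity
  have hV := h.measurable_clampOne' B
  have hbd : ∀ f x, |clampOne ℓ F₀ B f x| ≤ B := fun f x => abs_clampLoss_le hB f _
  have hnull : Measure.pi (fun _ : Fin J => smote k z)
      {s | ¬ ∀ j f, |lossOne ℓ F₀ f (s j)| ≤ B} = 0 := by
    have h1 : ∀ᵐ x ∂smote k z, ∀ f, |lossOne ℓ F₀ f x| ≤ B :=
      (h.ae_smote_bound hz).mono fun x hx f => hx f (h.dense.1 f.2)
    exact eventually_all.2 fun j => ae_pi_eval (fun _ : Fin J => smote k z) j h1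
  have hdev : Measure.pi (fun _ : Fin J => smote k z)
      {s | ¬ synDev (clampOne ℓ F₀ B) k B z s ≤ synLevel (clampOne ℓ F₀ b) J ρ
        (2 * B * √(N : ℝ) * √(Real.log (4 / δ))) z} ≤ ENNReal.ofReal (δ / 16) := by
    have heq : ∀ s : Fin J → Cov d, synDev (clampOne ℓ F₀ B) k B z s =
        sampleDev (fun _ => clampOne ℓ F₀ B) (fun _ => smote k z) s := by
      intro s
      simp only [synDev, sampleDev, smoteMean_eq (hV _) (hbd _) hk hkm]
    simp_rw [heq]
    have hσ : (0 : ℝ) < N * (2 * B) ^ 2 := by positivity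
    refine measure_not_le_le_of_tail _ (measurable_sampleDev (fun _ => hV) _) le_rfl
      (measure_sampleDev_gt_le (fun _ => hV) _ (β := fun _ => B) (fun _ => hB.le)
        (fun _ => hbd) hσ ?_ (by positivity)) ?_
      (Or.inr (exp_fluctuation_le hN0 (by positivity) hδ0 hδ1))
    · rw [Finset.sum_const, Finset.card_univ, Fintype.card_fin, nsmul_eq_mul]
      gcongr
    · rw [ENNReal.ofReal_one, one_mul]
      refine add_le_add ((lintegral_sampleDev_le (fun _ => hV) _ (fun _ => hbd)).trans ?_) le_rfl
      refine mul_le_mul_right ?_ _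
      have h1 : radInt (clampOne ℓ F₀ B) (Fin J) (smote k z) =
          radInt (lossOne ℓ F₀) (Fin J) (smote k z) := by
        refine radInt_congr_ae _ ((h.ae_smote_bound hz).mono fun x hx f => ?_)
        exact clampLoss_eq (hx f (h.dense.1 f.2))
      refine h1.le.trans ((h.radInt_smote_le_boot hz hk hkm J).trans (add_le_add le_rfl ?_))
      exact mul_le_mul_right (ENNReal.ofReal_le_ofReal hρ) _
  refine (measure_mono fun s hs => ?_).trans ((measure_union_le _ _).trans
    ((add_le_add hdev hnull.le).trans (by rw [add_zero])))
  rw [mem_ofPred_eq, not_and_or] at hs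
  exact hs

/-- The conditional bound is integrated over the data. The packing bound replaces the mean radius,
which makes the level a measurable function of the data. -/
lemma measure_isSmoteSample_le [IsProbabilityMeasure μ] (hd : 0 < d) (hk : 0 < k)
    (hsupp : ∀ᵐ ω ∂μ, ∀ j ∈ minority (labels (Z ω)), (Z ω j).1 ∈ P₁.support)
    {S : Ω → Fin J → Cov d} (hS : IsSmoteSample k μ Z S) {N : ℕ} (hN : J ≤ N) (hN0 : 0 < N)
    (hδ0 : 0 < δ) (hδ1 : δ < 1) :
    μ {ω | k < numMin (labels (Z ω)) ∧
      ¬ (synDev (clampOne ℓ F₀ (b + 2 * L * D)) k (b + 2 * L * D) (Z ω) (S ω) ≤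
          synLevel (clampOne ℓ F₀ b) J
            (fun m => L * (4 * D * ((k : ℝ) / m) ^ (1 / d : ℝ)))
            (2 * (b + 2 * L * D) * √(N : ℝ) * √(Real.log (4 / δ))) (Z ω) ∧
        ∀ j f, |lossOne ℓ F₀ f (S ω j)| ≤ b + 2 * L * D)} ≤ ENNReal.ofReal (δ / 16) := by
  have := h.countable
  set A : Set ((Fin n → Obs d) × (Fin J → Cov d)) :=
    {q | ¬ (synDev (clampOne ℓ F₀ (b + 2 * L * D)) k (b + 2 * L * D) q.1 q.2 ≤
        synLevel (clampOne ℓ F₀ b) J (fun m => L * (4 * D * ((k : ℝ) / m) ^ (1 / d : ℝ)))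
          (2 * (b + 2 * L * D) * √(N : ℝ) * √(Real.log (4 / δ))) q.1 ∧
      ∀ j f, |lossOne ℓ F₀ f (q.2 j)| ≤ b + 2 * L * D)} with hA
  have hAm : MeasurableSet A := by
    refine MeasurableSet.compl ((measurableSet_le (measurable_synDev (h.measurable_clampOne' _) _ _)
      ((measurable_synLevel h.measurable_clampOne _ _ _).comp measurable_fst)).inter ?_)
    have : {q : (Fin n → Obs d) × (Fin J → Cov d) |
        ∀ j f, |lossOne ℓ F₀ f (q.2 j)| ≤ b + 2 * L * D} =
        ⋂ j, ⋂ f, {q | |lossOne ℓ F₀ f (q.2 j)| ≤ b + 2 * L * D} := by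
      ext q; simp
    change MeasurableSet {q : (Fin n → Obs d) × (Fin J → Cov d) |
        ∀ j f, |lossOne ℓ F₀ f (q.2 j)| ≤ b + 2 * L * D}
    rw [this]
    refine MeasurableSet.iInter fun j => MeasurableSet.iInter fun f => ?_
    exact measurableSet_le ((h.measurable_lossOne f).comp
      ((measurable_pi_apply j).comp measurable_snd)).abs measurable_const
  change μ {ω | k < numMin (labels (Z ω)) ∧ (Z ω, S ω) ∈ A} ≤ _
  rw [hS A hAm]
  calc _ ≤ ∫⁻ _ω in {ω | k < numMin (labels (Z ω))}, ENNReal.ofReal (δ / 16) ∂μ := by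
        refine setLIntegral_mono_ae measurable_const.aemeasurable ?_
        filter_upwards [hsupp] with ω hω hkω
        refine h.measure_synDev_le hω hk hkω (mul_le_mul_of_nonneg_left ?_ h.L_pos.le) hN hN0
          hδ0 hδ1
        exact meanRadius_le hd h.D_pos (lt_of_le_of_lt (Nat.zero_le k) hkω)
          fun j hj => h.norm_le _ (hω j hj)
    _ ≤ _ := by
        rw [lintegral_const]
        refine mul_le_of_le_one_right (zero_le) ?_
        rw [Measure.restrict_apply_univ]
        exact prob_le_one

end RegularClass

end SyntheticSample

/-! ### Decomposition of the augmented risk. -/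

section ExcessRisk

variable {d n k J : ℕ} {ℓ : Bool → ℝ → ℝ} {F F₀ : Set (Cov d → ℝ)} {P₀ P₁ : Measure (Cov d)}
  {b L D δ : ℝ}

lemma sum_ite_label (y : Fin n → Bool) (a₀ a₁ : ℝ) :
    ∑ i, (if y i then a₁ else a₀) = numMin y * a₁ + numMaj y * a₀ := by
  rw [Finset.sum_ite, Finset.sum_const, Finset.sum_const, nsmul_eq_mul, nsmul_eq_mul]
  congr 3
  simp only [Bool.not_eq_true]
  rfl

lemma numMin_add_numMaj (y : Fin n → Bool) : (numMin y : ℝ) + numMaj y = n := by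
  have := sum_ite_label y 1 1
  simp at this
  linarith

namespace RegularClass

variable (h : RegularClass ℓ F F₀ P₀ P₁ b L D) [IsProbabilityMeasure P₀] [IsProbabilityMeasure P₁]
include h

omit [IsProbabilityMeasure P₀] [IsProbabilityMeasure P₁] in
lemma ae_balanced : ∀ᵐ z ∂balanced P₀ P₁, ∀ f : F₀, |lossFn ℓ F₀ f z| ≤ b := by
  have := h.countable
  have hset : MeasurableSet {z : Obs d | ∀ f, |lossFn ℓ F₀ f z| ≤ b} := by
    simp only [ofPred_forall]
    exact MeasurableSet.iInter fun f => measurableSet_le (h.measurable f).abs measurable_const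
  refine ae_labelMixture hset ?_ ?_
  · filter_upwards [h.bound_false] with x hx f using hx f (h.dense.1 f.2)
  · filter_upwards [Measure.support_mem_ae (μ := P₁)] with x hx f
      using h.bound_true x hx f (h.dense.1 f.2)

lemma integral_balanced (f : F₀) : ∫ z, lossFn ℓ F₀ f z ∂balanced P₀ P₁ =
    (∫ x, clampLoss ℓ F₀ b f (x, false) ∂P₀ + ∫ x, clampLoss ℓ F₀ b f (x, true) ∂P₁) / 2 := by
  have hV := h.measurable_clampLoss f
  have hb : ∀ z, ‖clampLoss ℓ F₀ b f z‖ ≤ b := abs_clampLoss_le h.b_pos f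
  have h1 : ∫ z, lossFn ℓ F₀ f z ∂balanced P₀ P₁ = ∫ z, clampLoss ℓ F₀ b f z ∂balanced P₀ P₁ :=
    integral_congr_ae (h.ae_balanced.mono fun z hz => (clampLoss_eq (hz f)).symm)
  have h0 : IsProbabilityMeasure (P₀.map fun x => (x, false)) :=
    Measure.isProbabilityMeasure_map (measurable_pair_label false).aemeasurable
  have h1' : IsProbabilityMeasure (P₁.map fun x => (x, true)) :=
    Measure.isProbabilityMeasure_map (measurable_pair_label true).aemeasurable
  rw [h1, balanced_eq, integral_add_measure, integral_smul_measure, integral_smul_measure,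
    integral_map (measurable_pair_label false).aemeasurable hV.aestronglyMeasurable,
    integral_map (measurable_pair_label true).aemeasurable hV.aestronglyMeasurable]
  · simp; ring
  · exact (Integrable.of_bound hV.aestronglyMeasurable b (ae_of_all _ hb)).smul_measure (by simp)
  · exact (Integrable.of_bound hV.aestronglyMeasurable b (ae_of_all _ hb)).smul_measure (by simp)

lemma abs_augRisk_sub_le_of_mem {z : Fin n → Obs d} {s : Fin J → Cov d} {T₁ T₂ T₃ : ℝ}
    (hT₁ : 0 ≤ T₁) (hT₂ : 0 ≤ T₂) (hT₃ : 0 ≤ T₃)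
    (hz : ∀ j ∈ minority (labels z), (z j).1 ∈ P₁.support) (hk : 0 < k)
    (hkm : k < numMin (labels z)) (hb : ∀ i f, |lossFn ℓ F₀ f (z i)| ≤ b)
    (hB : ∀ j f, |lossOne ℓ F₀ f (s j)| ≤ b + 2 * L * D)
    (h1 : dataDev (clampLoss ℓ F₀ b) P₀ P₁ (labels z) (fun i => (z i).1) ≤ ENNReal.ofReal T₁)
    (h2 : synDev (clampOne ℓ F₀ (b + 2 * L * D)) k (b + 2 * L * D) z s ≤ ENNReal.ofReal T₂)
    (h3 : supE (fun f => ∫ x, lossOne ℓ F₀ f x ∂smote k z - ∫ x, lossOne ℓ F₀ f x ∂P₁) ≤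
      ENNReal.ofReal T₃) (f : F₀) :
    |augRisk ℓ z s f - ∫ w, ℓ w.2 ((f : Cov d → ℝ) w.1) ∂balanced P₀ P₁| ≤
      (T₁ + T₂ + J * T₃) / ((n + J : ℕ) : ℝ) +
        2 * b * |(numMaj (labels z) : ℝ) / ((n + J : ℕ) : ℝ) - 1 / 2| := by
  have hbpos := h.b_pos
  have hBpos : 0 < b + 2 * L * D := by
    have := h.L_pos; have := h.D_pos; positivity
  have hN : (0 : ℝ) < ((n + J : ℕ) : ℝ) := by
    have : numMin (labels z) ≤ n := (Finset.card_le_univ _).trans (by simp)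
    exact_mod_cast (by omega : 0 < n + J)
  set a₀ := ∫ x, clampLoss ℓ F₀ b f (x, false) ∂P₀ with ha₀
  set a₁ := ∫ x, clampLoss ℓ F₀ b f (x, true) ∂P₁ with ha₁
  set q := ∫ x, lossOne ℓ F₀ f x ∂smote k z
  have habs : ∀ (c : Bool) (P : Measure (Cov d)) [IsProbabilityMeasure P],
      |∫ x, clampLoss ℓ F₀ b f (x, c) ∂P| ≤ b := by
    intro c P _
    have := norm_integral_le_of_norm_le_const (μ := P) (f := fun x => clampLoss ℓ F₀ b f (x, c))
      (ae_of_all _ fun x => abs_clampLoss_le hbpos f (x, c))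
    simpa using this
  have e1 : |∑ i, ℓ (z i).2 (f.1 (z i).1) -
      (numMin (labels z) * a₁ + numMaj (labels z) * a₀)| ≤ T₁ := by
    have := abs_le_of_enorm_le hT₁ ((le_supE (fun f => ∑ i, (clampLoss ℓ F₀ b f
      ((z i).1, labels z i) - ∫ a, clampLoss ℓ F₀ b f (a, labels z i)
        ∂condLaw P₀ P₁ (labels z) i)) f).trans h1)
    rw [Finset.sum_sub_distrib] at this
    rw [← sum_ite_label]
    convert this using 3
    · exact Finset.sum_congr rfl fun i _ => (clampLoss_eq (hb i f)).symm
    · refine Finset.sum_congr rfl fun i _ => ?_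
      rw [condLaw]
      cases labels z i <;> simp [ha₀, ha₁]
  have e2 : |∑ j, ℓ true (f.1 (s j)) - J * q| ≤ T₂ := by
    have := abs_le_of_enorm_le hT₂ ((le_supE (fun f => ∑ j, (clampOne ℓ F₀ (b + 2 * L * D) f (s j) -
      smoteMean k (b + 2 * L * D) (clampOne ℓ F₀ (b + 2 * L * D) f) z)) f).trans h2)
    rw [Finset.sum_sub_distrib, Finset.sum_const, Finset.card_univ, Fintype.card_fin,
      nsmul_eq_mul, smoteMean_eq (h.measurable_clampOne' _ f)
        (fun x => abs_clampLoss_le hBpos f _) hk hkm] at this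
    convert this using 3
    · exact Finset.sum_congr rfl fun j _ => (clampLoss_eq (z := (s j, true)) (hB j f)).symm
    · congr 1
      refine integral_congr_ae ((h.ae_smote_bound hz).mono fun x hx => ?_)
      exact (clampLoss_eq (z := (x, true)) (hx f (h.dense.1 f.2))).symm
  have e3 : |q - a₁| ≤ T₃ := by
    have := abs_le_of_enorm_le hT₃ ((le_supE (fun f => ∫ x, lossOne ℓ F₀ f x ∂smote k z -
      ∫ x, lossOne ℓ F₀ f x ∂P₁) f).trans h3)
    convert this using 3
    exact integral_congr_ae (h.ae_clampOne_eq.mono fun x hx => hx f)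
  have e4 : |a₀ - a₁| ≤ 2 * b := by
    have := abs_sub a₀ a₁
    have := habs false P₀
    have := habs true P₁
    linarith
  have hcount := numMin_add_numMaj (labels z)
  have hQ : ∫ w, ℓ w.2 ((f : Cov d → ℝ) w.1) ∂balanced P₀ P₁ = (a₀ + a₁) / 2 :=
    h.integral_balanced f
  rw [hQ, augRisk]
  set S₁ := ∑ i, ℓ (z i).2 (f.1 (z i).1)
  set S₂ := ∑ j, ℓ true (f.1 (s j))
  set n₀ : ℝ := (numMaj (labels z) : ℝ)
  set n₁ : ℝ := (numMin (labels z) : ℝ)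
  -- If all deviations vanished, the augmented risk would be the mixture of the class risks `a₀` and
  -- `a₁` with weights `n₀/(n+J)` and `(n₁+J)/(n+J) = 1 - n₀/(n+J)`. Compared with equal weights,
  -- this leaves the imbalance times `a₀ - a₁`.
  have key : 1 / ((n : ℝ) + J) * (S₁ + S₂) - (a₀ + a₁) / 2 =
      ((S₁ - (n₁ * a₁ + n₀ * a₀)) + (S₂ - J * q) + J * (q - a₁)) / ((n + J : ℕ) : ℝ) +
        (n₀ / ((n + J : ℕ) : ℝ) - 1 / 2) * (a₀ - a₁) := by
    push_cast at hN ⊢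
    field_simp
    rw [← hcount]
    ring
  rw [key]
  refine (abs_add_le _ _).trans (add_le_add ?_ ?_)
  · rw [abs_div, abs_of_pos hN]
    gcongr
    refine (abs_add_le _ _).trans (add_le_add ((abs_add_le _ _).trans (add_le_add e1 e2)) ?_)
    rw [abs_mul, abs_of_nonneg (by positivity : (0 : ℝ) ≤ J)]
    gcongr
  · rw [abs_mul, mul_comm]
    gcongr

lemma abs_augRisk_sub_le {z : Fin n → Obs d} {s : Fin J → Cov d} {K : ℝ}
    (hK : ∀ f : F₀, |augRisk ℓ z s f - ∫ w, ℓ w.2 ((f : Cov d → ℝ) w.1) ∂balanced P₀ P₁| ≤ K)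
    {f : Cov d → ℝ} (hf : f ∈ F) :
    |augRisk ℓ z s f - ∫ w, ℓ w.2 (f w.1) ∂balanced P₀ P₁| ≤ K := by
  have hQ : IsProbabilityMeasure (balanced P₀ P₁) :=
    isProbabilityMeasure_labelMixture (by norm_num) (by norm_num)
  obtain ⟨u, hu, hlim⟩ := h.dense.2 f hf
  have h1 : Tendsto (fun m => ∫ w, ℓ w.2 (u m w.1) ∂balanced P₀ P₁) atTop
      (𝓝 (∫ w, ℓ w.2 (f w.1) ∂balanced P₀ P₁)) :=
    tendsto_integral_of_bound (B := b) (fun m => h.measurable ⟨u m, hu m⟩)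
      (h.ae_balanced.mono fun w hw m => hw ⟨u m, hu m⟩) fun w => hlim w.1 w.2
  have h2 : Tendsto (fun m => augRisk ℓ z s (u m)) atTop (𝓝 (augRisk ℓ z s f)) :=
    ((tendsto_finsetSum _ fun i _ => hlim _ _).add
      (tendsto_finsetSum _ fun j _ => hlim _ _)).const_mul _
  exact le_of_tendsto (h2.sub h1).abs (Eventually.of_forall fun m => hK ⟨u m, hu m⟩)

lemma integrable_balanced {f : Cov d → ℝ} (hf : f ∈ F) :
    Integrable (fun w : Obs d => ℓ w.2 (f w.1)) (balanced P₀ P₁) := by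
  have hQ : IsProbabilityMeasure (balanced P₀ P₁) :=
    isProbabilityMeasure_labelMixture (by norm_num) (by norm_num)
  obtain ⟨u, hu, hlim⟩ := h.dense.2 f hf
  have hlim' : ∀ w : Obs d, Tendsto (fun m => ℓ w.2 (u m w.1)) atTop (𝓝 (ℓ w.2 (f w.1))) :=
    fun w => hlim w.1 w.2
  have hm : Measurable fun w : Obs d => ℓ w.2 (f w.1) :=
    measurable_of_tendsto_metrizable (fun m => h.measurable ⟨u m, hu m⟩)
      (tendsto_pi_nhds.2 hlim')
  refine Integrable.of_bound hm.aestronglyMeasurable b (h.ae_balanced.mono fun w hw => ?_)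
  exact le_of_tendsto (hlim' w).norm (Eventually.of_forall fun m => hw ⟨u m, hu m⟩)

/-- The usual argument for empirical minimisers: one uniform deviation is spent on `fhat` and one on
`fstar`. -/
lemma excessRisk_le {z : Fin n → Obs d} {s : Fin J → Cov d} {K : ℝ}
    (hK : ∀ f : F₀, |augRisk ℓ z s f - ∫ w, ℓ w.2 ((f : Cov d → ℝ) w.1) ∂balanced P₀ P₁| ≤ K)
    {fhat fstar : Cov d → ℝ} (hf : IsRebalancedERM ℓ F z s fhat) (hstar : fstar ∈ F) :
    excessRisk ℓ (balanced P₀ P₁) fhat fstar ≤ 2 * K := by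
  rw [excessRisk, integral_sub (h.integrable_balanced hf.1) (h.integrable_balanced hstar)]
  have h1 := abs_le.1 (h.abs_augRisk_sub_le hK hf.1)
  have h2 := abs_le.1 (h.abs_augRisk_sub_le hK hstar)
  have h3 := hf.2 fstar hstar
  linarith [h1.1, h2.2]

end RegularClass

end ExcessRisk

/-! ### Collecting the deviations into the remainder term. -/

section Numerics

/-- The remainder term of the excess risk bound. -/
noncomputable def remainder (d k : ℕ) (b L D δ θ : ℝ) (N m : ℕ) : ℝ :=
  L * D * (6 * ((k : ℝ) / m) ^ (1 / d : ℝ) +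
    √(Real.log (2 / δ)) * ((k * 5 ^ d + 1) / √(m : ℝ))) + b * θ + fluctuation b δ N +
      b * √(Real.log (1 / δ) / m)

variable {d k J N m : ℕ} {b L D δ θ : ℝ}

lemma fluctuation_nonneg (hb : 0 ≤ b) : 0 ≤ fluctuation b δ N := by
  unfold fluctuation; positivity

lemma mul_sqrt_log_le_fluctuation (hb : 0 ≤ b) (hδ0 : 0 < δ) (hδ1 : δ < 1) :
    14 * (b * √(Real.log (4 / δ)) / √(N : ℝ)) ≤ fluctuation b δ N := by
  have hlog : 0 ≤ Real.log (4 / δ) := Real.log_nonneg (by rw [le_div_iff₀ hδ0]; linarith)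
  have h1 : √(Real.log (4 / δ)) ≤ √(2 * Real.log (4 / δ)) := Real.sqrt_le_sqrt (by linarith)
  have h2 : 0 ≤ b / √(N : ℝ) := by positivity
  calc _ = 14 * √(Real.log (4 / δ)) * (b / √(N : ℝ)) := by ring
    _ ≤ fluctuation b δ N := by
      unfold fluctuation
      gcongr
      linarith

lemma sqrt_log_four_div_le (hδ0 : 0 < δ) (hδ1 : δ < 1) :
    √(Real.log (4 / δ)) ≤ 2 * √(Real.log (2 / δ)) := by
  have e : (2 : ℝ) = √4 := by
    rw [show (4 : ℝ) = 2 ^ 2 by norm_num, Real.sqrt_sq (by norm_num)]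
  have h1 : Real.log (4 / δ) ≤ 2 * Real.log (2 / δ) := by
    rw [← Real.log_rpow (by positivity)]
    refine Real.log_le_log (by positivity) ?_
    rw [Real.rpow_two, div_pow]
    norm_num
    gcongr
    nlinarith
  have h2 : 0 ≤ Real.log (2 / δ) := Real.log_nonneg (by rw [le_div_iff₀ hδ0]; linarith)
  calc √(Real.log (4 / δ)) ≤ √(4 * Real.log (2 / δ)) := Real.sqrt_le_sqrt (by linarith)
    _ = _ := by rw [Real.sqrt_mul (by norm_num), ← e]

lemma two_mul_sqrt_mul_eq (hδ0 : 0 < δ) (hδ1 : δ < 1) :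
    2 * √(4 * Real.log (1 / δ)) * (b / √(m : ℝ)) = 4 * (b * √(Real.log (1 / δ) / m)) := by
  have hlog : 0 ≤ Real.log (1 / δ) := Real.log_nonneg (by rw [le_div_iff₀ hδ0]; linarith)
  have e : √4 = (2 : ℝ) := by
    rw [show (4 : ℝ) = 2 ^ 2 by norm_num, Real.sqrt_sq (by norm_num)]
  rw [Real.sqrt_mul (by norm_num), e, Real.sqrt_div hlog]
  ring

/-- After division by `N` each term is matched with one of the remainder. The `2LD` part of the
synthetic fluctuation, of order `LD √(log (4/δ)) / √N`, goes into the second term of the remainder,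
using `1/√N ≤ (k 5^d + 1)/√m` and `√(log (4/δ)) ≤ 2 √(log (2/δ))`. -/
lemma deviation_le_remainder (hb : 0 < b) (hL : 0 < L) (hD : 0 < D) (hδ0 : 0 < δ) (hδ1 : δ < 1)
    (hm : 0 < m) (hmN : m ≤ N) (hJN : J ≤ N) (hθ : 0 ≤ θ) {RN Rm β E : ℝ} (hRm : 0 ≤ Rm)
    (hE : E ≤ θ + √(Real.log (4 / δ)) / √(N : ℝ)) :
    (N * (8 * RN) + 2 * b * √(N : ℝ) * √(Real.log (4 / δ)) +
      (2 * (J * β + J * (L * (4 * D * ((k : ℝ) / m) ^ (1 / d : ℝ)))) +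
        2 * (b + 2 * L * D) * √(N : ℝ) * √(Real.log (4 / δ))) +
      J * (L * (4 * D * ((k : ℝ) / m) ^ (1 / d : ℝ)) + (2 * 20 * Rm +
        2 * √(4 * Real.log (1 / δ)) * (b / √(m : ℝ))))) / (N : ℝ) + 2 * b * E ≤
      8 * RN + 40 * Rm + 2 * ((J : ℝ) / N * β) + 8 * remainder d k b L D δ θ N m := by
  have hN : (0 : ℝ) < N := by exact_mod_cast lt_of_lt_of_le hm hmN
  have hm' : (0 : ℝ) < m := by exact_mod_cast hm
  have hmN' : (m : ℝ) ≤ N := by exact_mod_cast hmN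
  have hu1 : (J : ℝ) / N ≤ 1 := by
    rw [div_le_one hN]; exact_mod_cast hJN
  have hu0 : (0 : ℝ) ≤ (J : ℝ) / N := by positivity
  have hfl := mul_sqrt_log_le_fluctuation (N := N) hb.le hδ0 hδ1
  have hfl0 := fluctuation_nonneg (δ := δ) (N := N) hb.le
  have hq := sqrt_log_four_div_le hδ0 hδ1
  rw [two_mul_sqrt_mul_eq hδ0 hδ1]
  have hκ0 : 0 ≤ ((k : ℝ) / m) ^ (1 / d : ℝ) := by positivity
  unfold remainder
  set κ := ((k : ℝ) / m) ^ (1 / d : ℝ)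
  have hη0 : 0 ≤ b * √(Real.log (1 / δ) / m) := by positivity
  set η := b * √(Real.log (1 / δ) / m)
  set q := √(Real.log (4 / δ))
  have hq0 : 0 ≤ q := Real.sqrt_nonneg _
  have hsN : √(N : ℝ) / N = 1 / √(N : ℝ) := Real.sqrt_div_self'
  have hw : 1 / √(N : ℝ) ≤ ((k : ℝ) * 5 ^ d + 1) / √(m : ℝ) := by
    have h1 : (1 : ℝ) ≤ (k : ℝ) * 5 ^ d + 1 := by
      have : (0 : ℝ) ≤ (k : ℝ) * 5 ^ d := by positivity
      linarith
    gcongr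
  set w := 1 / √(N : ℝ) with hwdef
  have hw0 : 0 ≤ w := by positivity
  set g := ((k : ℝ) * 5 ^ d + 1) / √(m : ℝ)
  set r := √(Real.log (2 / δ))
  have hr0 : 0 ≤ r := Real.sqrt_nonneg _
  have e1 : b * q / √(N : ℝ) = b * q * w := by rw [hwdef]; ring
  have e2 : q / √(N : ℝ) = q * w := by rw [hwdef]; ring
  rw [e1] at hfl
  rw [e2] at hE
  set u := (J : ℝ) / N with hu
  have lhs : (N * (8 * RN) + 2 * b * √(N : ℝ) * q + (2 * (J * β + J * (L * (4 * D * κ))) +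
      2 * (b + 2 * L * D) * √(N : ℝ) * q) + J * (L * (4 * D * κ) + (2 * 20 * Rm + 4 * η))) / (N : ℝ) =
      8 * RN + 2 * (b * q * w) + 2 * (u * β) + 2 * (u * (L * (4 * D * κ))) +
        2 * (b * q * w) + 4 * (L * D * (q * w)) + u * (L * (4 * D * κ)) +
          u * (40 * Rm) + u * (4 * η) := by
    rw [← hsN, hu]
    field_simp
    ring
  rw [lhs]
  have hqw : q * w ≤ 2 * r * g := mul_le_mul hq hw hw0 (by positivity)
  have hLD : 0 < L * D := by positivity
  have i1 : L * D * (q * w) ≤ L * D * (2 * r * g) := mul_le_mul_of_nonneg_left hqw hLD.le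
  have hx : 0 ≤ L * (4 * D * κ) := by positivity
  have i2 : u * (L * (4 * D * κ)) ≤ 1 * (L * (4 * D * κ)) := mul_le_mul_of_nonneg_right hu1 hx
  have i3 : u * (40 * Rm) ≤ 1 * (40 * Rm) := mul_le_mul_of_nonneg_right hu1 (by positivity)
  have i4 : u * (4 * η) ≤ 1 * (4 * η) := mul_le_mul_of_nonneg_right hu1 (by positivity)
  have i5 : b * E ≤ b * (θ + q * w) := mul_le_mul_of_nonneg_left hE hb.le
  have hbθ : 0 ≤ b * θ := by positivity
  have hg0 : 0 ≤ L * D * (r * g) := by positivity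
  have hκ1 : 0 ≤ L * D * κ := by positivity
  have hbw : 0 ≤ b * q * w := by positivity
  nlinarith

lemma resampleFactor_eq (hm : 0 < m) :
    resampleFactor m J = √((m : ℝ) / J * Real.log (2 * m)) +
      √((m : ℝ) / J * Real.log (2 * m)) ^ 2 := by
  have : (1 : ℝ) ≤ m := by exact_mod_cast hm
  have hlog : 0 ≤ Real.log (2 * m) := Real.log_nonneg (by linarith)
  rw [Real.sq_sqrt (by positivity)]
  rfl

end Numerics

/-! ### Comparison of complexities, and the excess risk outside the exceptional events. -/

section Final

variable {d n k J : ℕ} {ℓ : Bool → ℝ → ℝ} {F F₀ : Set (Cov d → ℝ)} {P₀ P₁ : Measure (Cov d)}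
  {b L D δ p : ℝ} {Ω : Type*} [MeasurableSpace Ω] {μ : Measure Ω} {Z : Ω → Fin n → Obs d}

namespace RegularClass

variable (h : RegularClass ℓ F F₀ P₀ P₁ b L D) [IsProbabilityMeasure P₀] [IsProbabilityMeasure P₁]
include h

lemma radComplexity_balanced_le {M N : ℕ} (hM : 0 < M) (hMN : M ≤ N) :
    radComplexity ℓ F N (balanced P₀ P₁) ≤ 2 * radComplexity ℓ F M (balanced P₀ P₁) := by
  have := h.countable
  have hQ : IsProbabilityMeasure (balanced P₀ P₁) :=
    isProbabilityMeasure_labelMixture (by norm_num) (by norm_num)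
  have hR := radComplexity_nonneg (ℓ := ℓ) (F := F) M (balanced P₀ P₁)
  rw [← ENNReal.ofReal_le_ofReal_iff (by positivity), ENNReal.ofReal_mul (by norm_num),
    ← h.ofReal_radComplexity_balanced hM, ← h.ofReal_radComplexity_balanced (hM.trans_le hMN),
    ENNReal.ofReal_ofNat]
  exact radInt_fin_le_two_mul h.measurable_clampLoss _ hM hMN

/-- One factor `2` comes from passing to the balanced mixture, the other from normalising by `2m`
instead of `m`. -/
lemma radComplexity_minority_le {m : ℕ} (hm : 0 < m) :
    radComplexity ℓ F m (withLabelOne P₁) ≤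
      4 * radComplexity ℓ F (2 * m) (balanced P₀ P₁) := by
  have := h.countable
  have hR := radComplexity_nonneg (ℓ := ℓ) (F := F) (2 * m) (balanced P₀ P₁)
  rw [← ENNReal.ofReal_le_ofReal_iff (by positivity), ENNReal.ofReal_mul (by norm_num),
    ← h.ofReal_radComplexity_balanced (by omega), ← h.ofReal_radComplexity_minority hm,
    ENNReal.ofReal_ofNat]
  have h1 : radInt (clampOne ℓ F₀ b) (Fin m) P₁ ≤ radInt (clampOne ℓ F₀ b) (Fin (2 * m)) P₁ :=
    radInt_mono h.measurable_clampOne P₁ (Fin.castLE (by omega)) (Fin.castLE_injective _)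
  have h2 := radInt_label_le (P₀ := P₀) (P₁ := P₁) h.measurable_clampLoss (2 * m) true
  simp only [if_true] at h2
  refine (mul_le_mul_right (h1.trans h2) _).trans (le_of_eq ?_)
  have hm0 : (m : ℝ≥0∞) ≠ 0 := by simpa using hm.ne'
  rw [Nat.cast_mul, ENNReal.mul_inv (Or.inr (ENNReal.natCast_ne_top m)) (Or.inl (by simp)),
    Nat.cast_ofNat, show (4 : ℝ≥0∞) = 2 * 2 by norm_num]
  calc _ = (m : ℝ≥0∞)⁻¹ * (1 * 2 * radInt (clampLoss ℓ F₀ b) (Fin (2 * m)) (balanced P₀ P₁)) := by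
        ring
    _ = (m : ℝ≥0∞)⁻¹ * ((2 * 2⁻¹) * 2 *
          radInt (clampLoss ℓ F₀ b) (Fin (2 * m)) (balanced P₀ P₁)) := by
        rw [ENNReal.mul_inv_cancel (by norm_num) (by norm_num)]
    _ = _ := by ring

lemma ae_loss_le (y : Fin n → Bool) :
    ∀ᵐ x ∂Measure.pi (condLaw P₀ P₁ y), ∀ i, ∀ f : F₀, |lossFn ℓ F₀ f (x i, y i)| ≤ b := by
  rw [ae_all_iff]
  intro i
  refine ae_pi_eval (condLaw P₀ P₁ y) i (p := fun a => ∀ f : F₀, |lossFn ℓ F₀ f (a, y i)| ≤ b) ?_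
  cases hi : y i
  · rw [condLaw, hi]
    exact h.bound_false.mono fun x hx f => hx f (h.dense.1 f.2)
  · rw [condLaw, hi]
    filter_upwards [Measure.support_mem_ae (μ := P₁)] with x hx f
      using h.bound_true x hx f (h.dense.1 f.2)

/-- The excess risk on the event where all the deviations are small, in terms of a bound `β` for
the complexity of the resampled minority class. -/
lemma excessRisk_le_of_deviation (hd : 0 < d) {z : Fin n → Obs d} {s : Fin J → Cov d} {θ β : ℝ}
    (hδ0 : 0 < δ) (hδ1 : δ < 1)
    (hθ : 0 ≤ θ) (hβ : 0 ≤ β)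
    (hz : ∀ j ∈ minority (labels z), (z j).1 ∈ P₁.support) (hk : 0 < k)
    (hkm : k < numMin (labels z)) (hb : ∀ i, ∀ f, |lossFn ℓ F₀ f (z i)| ≤ b)
    (hB : ∀ j f, |lossOne ℓ F₀ f (s j)| ≤ b + 2 * L * D)
    (h1 : dataDev (clampLoss ℓ F₀ b) P₀ P₁ (labels z) (fun i => (z i).1) ≤
      ENNReal.ofReal (((n + J : ℕ) : ℝ) * (8 * radComplexity ℓ F (n + J) (balanced P₀ P₁)) +
        2 * b * √((n + J : ℕ) : ℝ) * √(Real.log (4 / δ))))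
    (h2 : synDev (clampOne ℓ F₀ (b + 2 * L * D)) k (b + 2 * L * D) z s ≤
      synLevel (clampOne ℓ F₀ b) J (fun m => L * (4 * D * ((k : ℝ) / m) ^ (1 / d : ℝ)))
        (2 * (b + 2 * L * D) * √((n + J : ℕ) : ℝ) * √(Real.log (4 / δ))) z)
    (h3 : subDev (clampOne ℓ F₀ b) P₁ (minority (labels z)) (fun i => (z i).1) ≤
      ENNReal.ofReal (2 * 20 * radComplexity ℓ F (numMin (labels z)) (withLabelOne P₁) +
        2 * √(4 * Real.log (1 / δ)) * (b / √(numMin (labels z) : ℝ))))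
    (h4 : boot (clampOne ℓ F₀ b) J (minority (labels z)) (fun i => (z i).1) ≤
      J * ENNReal.ofReal β)
    (hE : |(numMaj (labels z) : ℝ) / ((n + J : ℕ) : ℝ) - 1 / 2| ≤
      θ + √(Real.log (4 / δ)) / √((n + J : ℕ) : ℝ))
    {fhat fstar : Cov d → ℝ} (hf : IsRebalancedERM ℓ F z s fhat) (hstar : fstar ∈ F) :
    excessRisk ℓ (balanced P₀ P₁) fhat fstar ≤
      2 * (8 * radComplexity ℓ F (n + J) (balanced P₀ P₁) +
        40 * radComplexity ℓ F (numMin (labels z)) (withLabelOne P₁) +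
          2 * ((J : ℝ) / ((n + J : ℕ) : ℝ) * β) +
            8 * remainder d k b L D δ θ (n + J) (numMin (labels z))) := by
  have hbp := h.b_pos
  have hL := h.L_pos
  have hD := h.D_pos
  have hRN := radComplexity_nonneg (ℓ := ℓ) (F := F) (n + J) (balanced P₀ P₁)
  have hRm := radComplexity_nonneg (ℓ := ℓ) (F := F) (numMin (labels z)) (withLabelOne P₁)
  have hm : 0 < numMin (labels z) := by omega
  have hmn : numMin (labels z) ≤ n := (Finset.card_le_univ _).trans (by simp)
  have hκ : 0 ≤ L * (4 * D * ((k : ℝ) / numMin (labels z)) ^ (1 / d : ℝ)) := by positivity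
  refine h.excessRisk_le (fun f => (h.abs_augRisk_sub_le_of_mem
    (T₁ := ((n + J : ℕ) : ℝ) * (8 * radComplexity ℓ F (n + J) (balanced P₀ P₁)) +
        2 * b * √((n + J : ℕ) : ℝ) * √(Real.log (4 / δ)))
    (T₂ := 2 * (J * β + J * (L * (4 * D * ((k : ℝ) / numMin (labels z)) ^ (1 / d : ℝ)))) +
      2 * (b + 2 * L * D) * √((n + J : ℕ) : ℝ) * √(Real.log (4 / δ)))
    (T₃ := L * (4 * D * ((k : ℝ) / numMin (labels z)) ^ (1 / d : ℝ)) +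
      (2 * 20 * radComplexity ℓ F (numMin (labels z)) (withLabelOne P₁) +
        2 * √(4 * Real.log (1 / δ)) * (b / √(numMin (labels z) : ℝ))))
    (by positivity) (by positivity) (by positivity) hz hk hkm hb hB h1 (h2.trans ?_) ?_ f).trans
      (deviation_le_remainder hbp hL hD hδ0 hδ1 hm (by omega) (by omega) hθ hRm hE)) hf hstar
  · rw [synLevel, ENNReal.ofReal_add (p := 2 * _) (by positivity) (by positivity),
      ENNReal.ofReal_mul (p := 2) (by norm_num), ENNReal.ofReal_add (by positivity) (by positivity),
      ENNReal.ofReal_mul (p := (J : ℝ)) (q := β) (by positivity),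
      ENNReal.ofReal_mul (p := (J : ℝ)) (by positivity), ENNReal.ofReal_natCast,
      ENNReal.ofReal_ofNat]
    gcongr
  · refine (h.supE_smote_sub_le hz hk hkm).trans ?_
    rw [ENNReal.ofReal_add hκ (by positivity)]
    refine add_le_add (ENNReal.ofReal_le_ofReal (mul_le_mul_of_nonneg_left ?_ hL.le)) h3
    exact meanRadius_le hd hD hm fun j hj => h.norm_le _ (hz j hj)

end RegularClass

lemma excess_numerics {RN Rm a rf β η R u : ℝ} (hRN : 0 ≤ RN) (hRm : 0 ≤ Rm) (ha : 0 ≤ a)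
    (hu : u ≤ 1) (hη : 0 ≤ η) (hηR : η ≤ R) (hrf : rf = a + a ^ 2)
    (hβ : β = 20 * (1.65 * rf) * Rm + 4 * η) :
    2 * (8 * RN + 40 * Rm + 2 * (u * β) + 8 * R) ≤ 1500 * (RN + (1 + a) ^ 2 * Rm + R) := by
  have hrf0 : 0 ≤ rf := by rw [hrf]; positivity
  have hβ0 : 0 ≤ β := by rw [hβ]; positivity
  have h1 : u * β ≤ β := mul_le_of_le_one_left hβ0 hu
  have h2 : rf * Rm ≤ (1 + a) ^ 2 * Rm := mul_le_mul_of_nonneg_right (by rw [hrf]; nlinarith) hRm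
  have h3 : 1 * Rm ≤ (1 + a) ^ 2 * Rm := mul_le_mul_of_nonneg_right (by nlinarith) hRm
  rw [hβ] at h1
  nlinarith

/-- The constant `1500` is dictated here: with `rf ≤ 2 (1 + a')²`, the coefficient of `(1 + a')² R₂`
is at most `16 · 2 + 80 · 4 + 132 · 8 = 1408`. -/
lemma excess_numerics_of_le {RN Rm R₂ a a' rf β η R u : ℝ} (hRm : 0 ≤ Rm)
    (hR₂ : 0 ≤ R₂) (ha : 0 ≤ a) (ha' : 0 ≤ a') (hu : u ≤ 1) (hη : 0 ≤ η) (hηR : η ≤ R)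
    (hRN2 : RN ≤ 2 * R₂) (hRm2 : Rm ≤ 4 * R₂) (haa : a ^ 2 ≤ 2 * a' ^ 2) (hrf : rf = a + a ^ 2)
    (hβ : β = 20 * (1.65 * rf) * Rm + 4 * η) :
    2 * (8 * RN + 40 * Rm + 2 * (u * β) + 8 * R) ≤ 1500 * ((1 + a') ^ 2 * R₂ + R) := by
  have hrf0 : 0 ≤ rf := by rw [hrf]; positivity
  have hβ0 : 0 ≤ β := by rw [hβ]; positivity
  have h1 : u * β ≤ β := mul_le_of_le_one_left hβ0 hu
  have haa' : a ≤ 2 * a' := by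
    refine abs_le_of_sq_le_sq' ?_ (by positivity) |>.2
    nlinarith [sq_nonneg a']
  have h2 : rf ≤ 2 * (1 + a') ^ 2 := by rw [hrf]; nlinarith
  have h3 : rf * Rm ≤ 2 * (1 + a') ^ 2 * (4 * R₂) := mul_le_mul h2 hRm2 hRm (by positivity)
  have h4 : 1 * R₂ ≤ (1 + a') ^ 2 * R₂ := mul_le_mul_of_nonneg_right (by nlinarith) hR₂
  rw [hβ] at h1
  nlinarith

lemma excess_numerics_of_gt {RN Rm R₂ a' R v : ℝ} (hR₂ : 0 ≤ R₂) (ha' : 0 ≤ a') (hR : 0 ≤ R)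
    (hv : v ≤ 5 * R) (hRN2 : RN ≤ 2 * R₂) (hRm2 : Rm ≤ 4 * R₂) :
    2 * (8 * RN + 40 * Rm + 2 * v + 8 * R) ≤ 1500 * ((1 + a') ^ 2 * R₂ + R) := by
  have h4 : 1 * R₂ ≤ (1 + a') ^ 2 * R₂ := mul_le_mul_of_nonneg_right (by nlinarith) hR₂
  nlinarith

end Final

/-! ### Union of the exceptional events and the excess risk bounds. -/

section ExcessBound

variable {d n k J : ℕ} {ℓ : Bool → ℝ → ℝ} {F F₀ : Set (Cov d → ℝ)} {P₀ P₁ : Measure (Cov d)}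
  {b L D δ p : ℝ} {Ω : Type*} [MeasurableSpace Ω] {μ : Measure Ω} {Z : Ω → Fin n → Obs d}

/-- The set of covariates for which all the deviations that involve the data are small. -/
def goodData (ℓ : Bool → ℝ → ℝ) (F F₀ : Set (Cov d → ℝ)) (P₀ P₁ : Measure (Cov d)) (J : ℕ)
    (b δ : ℝ) (y : Fin n → Bool) : Set (Fin n → Cov d) :=
  {x | (∀ j ∈ minority y, x j ∈ P₁.support) ∧ (∀ i, ∀ f : F₀, |lossFn ℓ F₀ f (x i, y i)| ≤ b) ∧
    dataDev (clampLoss ℓ F₀ b) P₀ P₁ y x ≤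
      ENNReal.ofReal (((n + J : ℕ) : ℝ) * (8 * radComplexity ℓ F (n + J) (balanced P₀ P₁)) +
        2 * b * √((n + J : ℕ) : ℝ) * √(Real.log (4 / δ))) ∧
    subDev (clampOne ℓ F₀ b) P₁ (minority y) x ≤
      ENNReal.ofReal (2 * 20 * radComplexity ℓ F (numMin y) (withLabelOne P₁) +
        2 * √(4 * Real.log (1 / δ)) * (b / √(numMin y : ℝ))) ∧
    boot (clampOne ℓ F₀ b) J (minority y) x ≤
      J * ENNReal.ofReal (20 * (1.65 * resampleFactor (numMin y) J) *
        radComplexity ℓ F (numMin y) (withLabelOne P₁) +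
        2 * √(4 * Real.log (1 / δ)) * (b / √(numMin y : ℝ)))}

namespace RegularClass

variable (h : RegularClass ℓ F F₀ P₀ P₁ b L D) [IsProbabilityMeasure P₀] [IsProbabilityMeasure P₁]
include h

lemma measure_goodData_compl_le (hJ : 0 < J) (hδ0 : 0 < δ) (hδ1 : δ < 1) {y : Fin n → Bool}
    (hm : 0 < numMin y) :
    Measure.pi (condLaw P₀ P₁ y) (goodData ℓ F F₀ P₀ P₁ J b δ y)ᶜ ≤
      ENNReal.ofReal (δ / 16 + δ / 10 + δ / 10) := by
  -- For `δ > 1/2` the Markov factor `20` suffices; for `δ ≤ 1/2` McDiarmid gives `δ⁸ ≤ δ/128`.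
  have hT : (20 : ℝ)⁻¹ ≤ δ / 10 ∨ Real.exp (-2 * √(4 * Real.log (1 / δ)) ^ 2) ≤ δ / 10 := by
    rcases le_or_gt δ (1 / 2) with hδ | hδ
    · right
      rw [exp_neg_two_mul_sq_sqrt (by norm_num) (by rw [le_div_iff₀ hδ0]; linarith) 8
        (by norm_num), inv_div, div_one]
      have : δ ^ 7 ≤ (1 / 2) ^ 7 := by gcongr
      nlinarith
    · left
      norm_num
      linarith
  have h1 := ae_mem_support (P₀ := P₀) (P₁ := P₁) y
  have h2 := h.ae_loss_le y
  have h3 := h.measure_dataDev_le (N := n + J) (by omega) (by omega) hδ0 hδ1 y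
  have h4 := h.measure_subDev_le hm (a := 20) (s := √(4 * Real.log (1 / δ))) (by norm_num)
    (Real.sqrt_nonneg _) hT
  have h5 := h.measure_boot_le hJ hm (a := 20) (s := √(4 * Real.log (1 / δ))) (by norm_num)
    (Real.sqrt_nonneg _) hT
  rw [ENNReal.ofReal_add (by positivity) (by positivity),
    ENNReal.ofReal_add (by positivity) (by positivity)]
  have h12 : Measure.pi (condLaw P₀ P₁ y) {x | ¬ ((∀ j ∈ minority y, x j ∈ P₁.support) ∧
      ∀ i, ∀ f : F₀, |lossFn ℓ F₀ f (x i, y i)| ≤ b)} = 0 := h1.and h2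
  refine (measure_mono fun x hx => ?_).trans ((measure_union_le _ _).trans (add_le_add
    ((measure_union_le _ _).trans (add_le_add ((measure_union_le _ _).trans
      (add_le_add h12.le h3)) h4)) h5 |>.trans (by rw [zero_add])))
  by_contra hcon
  rw [mem_union, mem_union, mem_union, not_or, not_or, not_or] at hcon
  obtain ⟨⟨⟨g1, g2⟩, g3⟩, g4⟩ := hcon
  have g1 := not_not.1 g1
  exact hx ⟨g1.1, g1.2, not_not.1 g2, not_not.1 g3, not_not.1 g4⟩

lemma excessRisk_bounds (hd : 0 < d) (hJ : 0 < J) {z : Fin n → Obs d} {s : Fin J → Cov d}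
    (hδ0 : 0 < δ) (hδ1 : δ < 1) (hk : 0 < k) (hkm : k < numMin (labels z))
    (hgood : (fun i => (z i).1) ∈ goodData ℓ F F₀ P₀ P₁ J b δ (labels z))
    (hB : ∀ j f, |lossOne ℓ F₀ f (s j)| ≤ b + 2 * L * D)
    (h2 : synDev (clampOne ℓ F₀ (b + 2 * L * D)) k (b + 2 * L * D) z s ≤
      synLevel (clampOne ℓ F₀ b) J (fun m => L * (4 * D * ((k : ℝ) / m) ^ (1 / d : ℝ)))
        (2 * (b + 2 * L * D) * √((n + J : ℕ) : ℝ) * √(Real.log (4 / δ))) z)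
    (hmaj : |(numMaj (labels z) : ℝ) - n * (1 - p)| ≤
      √((n + J : ℕ) : ℝ) * √(Real.log (4 / δ)))
    {fhat fstar : Cov d → ℝ} (hf : IsRebalancedERM ℓ F z s fhat) (hstar : fstar ∈ F) :
    excessRisk ℓ (balanced P₀ P₁) fhat fstar ≤
        1500 * (radComplexity ℓ F (n + J) (balanced P₀ P₁) +
          (1 + √((numMin (labels z) : ℝ) / J * Real.log (2 * numMin (labels z)))) ^ 2 *
            radComplexity ℓ F (numMin (labels z)) (withLabelOne P₁) +
          remainder d k b L D δ |(n : ℝ) * (1 - p) / (n + J) - 1 / 2| (n + J)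
            (numMin (labels z))) ∧
      (numMin (labels z) < numMaj (labels z) →
        excessRisk ℓ (balanced P₀ P₁) fhat fstar ≤
          1500 * ((1 + √((numMin (labels z) : ℝ) / ((numMaj (labels z) : ℝ) - numMin (labels z)) *
            Real.log (2 * numMin (labels z)))) ^ 2 *
              radComplexity ℓ F (2 * numMin (labels z)) (balanced P₀ P₁) +
            remainder d k b L D δ |(n : ℝ) * (1 - p) / (n + J) - 1 / 2| (n + J)
              (numMin (labels z)))) := by
  obtain ⟨g1, g2, g3, g4, g5⟩ := hgood
  have hb := h.b_pos
  have hL := h.L_pos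
  have hD := h.D_pos
  set y := labels z with hy
  set m := numMin y with hmdef
  have hm : 0 < m := by omega
  have hm1 : (1 : ℝ) ≤ m := by exact_mod_cast hm
  have hJ' : (0 : ℝ) < J := by exact_mod_cast hJ
  have hcount := numMin_add_numMaj y
  have hlog : 0 ≤ Real.log (2 * m) := Real.log_nonneg (by linarith)
  set θ := |(n : ℝ) * (1 - p) / (n + J) - 1 / 2| with hθ
  have hθ0 : 0 ≤ θ := abs_nonneg _
  have hN : (0 : ℝ) < ((n + J : ℕ) : ℝ) := by exact_mod_cast (by omega : 0 < n + J)
  set q := √(Real.log (4 / δ))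
  have hE : |(numMaj y : ℝ) / ((n + J : ℕ) : ℝ) - 1 / 2| ≤ θ + q / √((n + J : ℕ) : ℝ) := by
    have e1 : (numMaj y : ℝ) / ((n + J : ℕ) : ℝ) - 1 / 2 =
        ((n : ℝ) * (1 - p) / (n + J) - 1 / 2) +
          ((numMaj y : ℝ) - n * (1 - p)) / ((n + J : ℕ) : ℝ) := by
      push_cast; ring
    have e2 : |((numMaj y : ℝ) - n * (1 - p)) / ((n + J : ℕ) : ℝ)| ≤ q / √((n + J : ℕ) : ℝ) := by
      rw [abs_div, abs_of_pos hN]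
      calc _ ≤ √((n + J : ℕ) : ℝ) * q / ((n + J : ℕ) : ℝ) := by gcongr
        _ = q * (√((n + J : ℕ) : ℝ) / ((n + J : ℕ) : ℝ)) := by ring
        _ = _ := by rw [Real.sqrt_div_self']; ring
    rw [e1]
    exact (abs_add_le _ _).trans (add_le_add le_rfl e2)
  set β := 20 * (1.65 * resampleFactor m J) * radComplexity ℓ F m (withLabelOne P₁) +
        2 * √(4 * Real.log (1 / δ)) * (b / √(m : ℝ)) with hβ
  have hRm := radComplexity_nonneg (ℓ := ℓ) (F := F) m (withLabelOne P₁)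
  have hRN := radComplexity_nonneg (ℓ := ℓ) (F := F) (n + J) (balanced P₀ P₁)
  have hR₂ := radComplexity_nonneg (ℓ := ℓ) (F := F) (2 * m) (balanced P₀ P₁)
  have hrf := resampleFactor_nonneg (J := J) hm
  have hβ0 : 0 ≤ β := by positivity
  have hbase := h.excessRisk_le_of_deviation hd hδ0 hδ1 hθ0 hβ0 g1 hk hkm g2 hB g3 h2 g4 g5 hE hf
    hstar
  rw [two_mul_sqrt_mul_eq hδ0 hδ1] at hβ
  set R := remainder d k b L D δ θ (n + J) m with hR
  have hfl := fluctuation_nonneg (δ := δ) (N := n + J) hb.le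
  have hη0 : 0 ≤ b * √(Real.log (1 / δ) / m) := by positivity
  have hκ0 : 0 ≤ L * D * (6 * ((k : ℝ) / m) ^ (1 / d : ℝ) +
    √(Real.log (2 / δ)) * ((k * 5 ^ d + 1) / √(m : ℝ))) := by positivity
  have hbθ : 0 ≤ b * θ := by positivity
  have hηR : b * √(Real.log (1 / δ) / m) ≤ R := by
    rw [hR, remainder]; linarith
  have hu : (J : ℝ) / ((n + J : ℕ) : ℝ) ≤ 1 := by
    rw [div_le_one hN]; push_cast; linarith [(Nat.cast_nonneg n : (0 : ℝ) ≤ n)]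
  refine ⟨hbase.trans (excess_numerics hRN hRm (Real.sqrt_nonneg _) hu hη0 hηR
    (resampleFactor_eq hm) hβ), fun hlt => ?_⟩
  have hlt' : (m : ℝ) < numMaj y := by exact_mod_cast hlt
  have hRN2 := h.radComplexity_balanced_le (M := 2 * m) (N := n + J) (by omega) (by
    have : (2 * m : ℝ) ≤ ((n + J : ℕ) : ℝ) := by push_cast; linarith
    exact_mod_cast this)
  have hRm2 := h.radComplexity_minority_le hm
  -- If `n₀ - n₁ ≤ 2J`, then `n₁/J ≤ 2 n₁/(n₀ - n₁)` and the resampling factor is controlled by the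
  -- one in the claim. Otherwise the synthetic points are so few that the trivial bound `β = b` for
  -- their complexity suffices.
  rcases le_or_gt ((numMaj y : ℝ) - m) (2 * J) with hg | hg
  · refine hbase.trans (excess_numerics_of_le hRm hR₂ (Real.sqrt_nonneg _)
      (Real.sqrt_nonneg _) hu hη0 hηR hRN2 hRm2 ?_ (resampleFactor_eq hm) hβ)
    have hg0 : 0 < (numMaj y : ℝ) - m := by linarith
    rw [Real.sq_sqrt (by positivity), Real.sq_sqrt (by positivity), ← mul_assoc]
    gcongr
    rw [← mul_div_assoc, div_le_div_iff₀ hJ' hg0]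
    nlinarith
  · have hbase' := h.excessRisk_le_of_deviation hd hδ0 hδ1 hθ0 hb.le g1 hk hkm g2 hB g3 h2 g4
      (boot_le_ofReal h.abs_clampOne_le J hm _) hE hf hstar
    refine hbase'.trans (excess_numerics_of_gt hR₂ (Real.sqrt_nonneg _)
      (hη0.trans hηR) ?_ hRN2 hRm2)
    -- Here `2n₀ - (n + J) = n₀ - n₁ - J > J`, so `J b / (n + J)` is at most twice `b` times the
    -- imbalance, which the remainder contains up to the fluctuation of `n₀`.
    have e1 : (J : ℝ) / ((n + J : ℕ) : ℝ) ≤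
        2 * |(numMaj y : ℝ) / ((n + J : ℕ) : ℝ) - 1 / 2| := by
      refine le_trans ?_ (mul_le_mul_of_nonneg_left (le_abs_self _) (by norm_num))
      have : 2 * ((numMaj y : ℝ) / ((n + J : ℕ) : ℝ) - 1 / 2) =
          (2 * numMaj y - ((n + J : ℕ) : ℝ)) / ((n + J : ℕ) : ℝ) := by
        field_simp
      rw [this]
      gcongr
      push_cast
      linarith
    have e2 := mul_sqrt_log_le_fluctuation (N := n + J) hb.le hδ0 hδ1
    have e3 : (J : ℝ) / ((n + J : ℕ) : ℝ) * b ≤ 2 * (θ + q / √((n + J : ℕ) : ℝ)) * b :=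
      mul_le_mul_of_nonneg_right (by linarith) hb.le
    have e4 : b * q / √((n + J : ℕ) : ℝ) = q / √((n + J : ℕ) : ℝ) * b := by ring
    change 14 * (b * q / √((n + J : ℕ) : ℝ)) ≤ _ at e2
    rw [e4] at e2
    have e5 : (J : ℝ) / ((n + J : ℕ) : ℝ) * b ≤ 5 * R := by
      rw [hR, remainder]
      nlinarith
    exact e5

theorem measure_excessRisk_le [IsProbabilityMeasure μ] (hd : 0 < d) (hJ : 0 < J) (hk : 0 < k)
    (hp0 : 0 < p) (hp1 : p < 1) (hδ0 : 0 < δ) (hδ1 : δ < 1) (hZ : Measurable Z)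
    (hlaw : μ.map Z = Measure.pi fun _ => labelMixture p P₀ P₁) {S : Ω → Fin J → Cov d}
    (hS : IsSmoteSample k μ Z S) {fhat : Ω → Cov d → ℝ}
    (hf : ∀ᵐ ω ∂μ, k < numMin (labels (Z ω)) → IsRebalancedERM ℓ F (Z ω) (S ω) (fhat ω))
    {fstar : Cov d → ℝ} (hstar : fstar ∈ F) :
    μ {ω | k < numMin (labels (Z ω)) ∧ ¬ (
      excessRisk ℓ (balanced P₀ P₁) (fhat ω) fstar ≤
        1500 * (radComplexity ℓ F (n + J) (balanced P₀ P₁) +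
          (1 + √((numMin (labels (Z ω)) : ℝ) / J * Real.log (2 * numMin (labels (Z ω))))) ^ 2 *
            radComplexity ℓ F (numMin (labels (Z ω))) (withLabelOne P₁) +
          remainder d k b L D δ |(n : ℝ) * (1 - p) / (n + J) - 1 / 2| (n + J)
            (numMin (labels (Z ω)))) ∧
      (numMin (labels (Z ω)) < numMaj (labels (Z ω)) →
        excessRisk ℓ (balanced P₀ P₁) (fhat ω) fstar ≤
          1500 * ((1 + √((numMin (labels (Z ω)) : ℝ) /
              ((numMaj (labels (Z ω)) : ℝ) - numMin (labels (Z ω))) *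
                Real.log (2 * numMin (labels (Z ω))))) ^ 2 *
              radComplexity ℓ F (2 * numMin (labels (Z ω))) (balanced P₀ P₁) +
            remainder d k b L D δ |(n : ℝ) * (1 - p) / (n + J) - 1 / 2| (n + J)
              (numMin (labels (Z ω))))))} ≤ ENNReal.ofReal δ := by
  have hsupp : ∀ᵐ ω ∂μ, ∀ j ∈ minority (labels (Z ω)), (Z ω j).1 ∈ P₁.support := by
    -- The threshold `k = 0` loses nothing, since without minority points the claim is vacuous.
    have h0 := measure_exists_labels_le hp0.le hp1.le hZ hlaw (k := 0) (η := 0)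
      (fun y => {x | ¬ ∀ j ∈ minority y, x j ∈ P₁.support})
      (fun y _ => (ae_mem_support (P₀ := P₀) y).le)
    refine measure_mono_null (fun ω hω => ?_) (le_antisymm h0 (zero_le))
    refine ⟨?_, hω⟩
    by_contra hcon
    refine hω fun j hj => absurd (Finset.card_pos.2 ⟨j, hj⟩) hcon
  have e1 := measure_exists_labels_le hp0.le hp1.le hZ hlaw (k := k)
    (fun y => (goodData ℓ F F₀ P₀ P₁ J b δ y)ᶜ)
    (fun y hy => h.measure_goodData_compl_le hJ hδ0 hδ1 (y := y) (by omega))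
  have e2 := h.measure_isSmoteSample_le hd hk hsupp hS (N := n + J) (by omega) (by omega) hδ0 hδ1
  have e3 := measure_numMaj_le hp0.le hp1.le hZ hlaw (N := n + J) (by omega) (by omega) hδ0 hδ1
  have e4 : μ {ω | ¬ (k < numMin (labels (Z ω)) → IsRebalancedERM ℓ F (Z ω) (S ω) (fhat ω))} = 0 :=
    hf
  -- In order: the events of `goodData` (data deviation, minority deviation, bootstrap), the
  -- synthetic sample, the class counts, and the null set on which `fhat` fails to be a minimiser.
  have hsum : ENNReal.ofReal (δ / 16 + δ / 10 + δ / 10) + ENNReal.ofReal (δ / 16) +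
      ENNReal.ofReal (δ / 8) + 0 ≤ ENNReal.ofReal δ := by
    rw [add_zero, ← ENNReal.ofReal_add (by positivity) (by positivity),
      ← ENNReal.ofReal_add (by positivity) (by positivity)]
    exact ENNReal.ofReal_le_ofReal (by linarith)
  refine (measure_mono fun ω hω => ?_).trans ((measure_union_le _ _).trans (add_le_add
    ((measure_union_le _ _).trans (add_le_add ((measure_union_le _ _).trans
      (add_le_add e1 e2)) e3)) e4.le |>.trans hsum))
  obtain ⟨hkm, hω⟩ := hω
  by_contra hcon
  rw [mem_union, mem_union, mem_union, not_or, not_or, not_or] at hcon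
  obtain ⟨⟨⟨g1, g2⟩, g3⟩, g4⟩ := hcon
  have g1 : (fun i => (Z ω i).1) ∈ goodData ℓ F F₀ P₀ P₁ J b δ (labels (Z ω)) := by
    by_contra hg
    exact g1 ⟨hkm, hg⟩
  have g2 := not_not.1 fun hg => g2 ⟨hkm, hg⟩
  exact hω (h.excessRisk_bounds hd hJ hδ0 hδ1 hk hkm g1 g2.2 g2.1 (not_not.1 g3)
    (not_not.1 g4 hkm) hstar)

end RegularClass

end ExcessBound

theorem mainTheorem3 :
    ∃ C : ℝ, 0 < C ∧
      ∀ (d n J k : ℕ), 0 < d → 0 < J → 0 < k →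
      ∀ (p₁ : ℝ), 0 < p₁ → p₁ < 1 →
      ∀ (P₀ P₁ : Measure (Cov d)) [IsProbabilityMeasure P₀] [IsProbabilityMeasure P₁]
        (ℓ : Bool → ℝ → ℝ) (F : Set (Cov d → ℝ)) (b L D δ : ℝ),
        0 < b → 0 < L → 0 < D → 0 < δ → δ < 1 →
        -- regularity of the class of losses
        (∀ f ∈ F, Measurable fun z : Obs d => ℓ z.2 (f z.1)) →
        PointwiseSeparable ℓ F →
        -- uniformly bounded loss and bounded covariates, almost surely
        (∀ᵐ z ∂(labelMixture p₁ P₀ P₁), ∀ f ∈ F, |ℓ z.2 (f z.1)| ≤ b) →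
        (∀ᵐ z ∂(labelMixture p₁ P₀ P₁), ‖z.1‖ ≤ D) →
        -- Lipschitz minority-class loss
        (∀ f ∈ F, ∀ x ∈ convexHull ℝ P₁.support, ∀ x' ∈ convexHull ℝ P₁.support,
          |ℓ true (f x) - ℓ true (f x')| ≤ L * ‖x - x'‖) →
      ∀ (Ω : Type*) [MeasurableSpace Ω] (μ : Measure Ω) [IsProbabilityMeasure μ]
        (Z : Ω → Fin n → Obs d), Measurable Z →
        -- the observations are i.i.d. from the imbalanced distribution
        μ.map Z = Measure.pi (fun _ => labelMixture p₁ P₀ P₁) →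
        -- the SMOTE distribution, conditionally on the labels
        (∀ y : Fin n → Bool, k < numMin y →
          ∀ H : ℝ, (H = smoteH2 d k D δ (numMin y) ∨
              ∃ c : ℝ, 0 < c ∧ BallLowerBound c P₁ ∧
                H = min (smoteH1 d k c δ (numMin y)) (smoteH2 d k D δ (numMin y))) →
            μ {ω | labels (Z ω) = y ∧
                ¬ ∀ f ∈ F, |∫ x, ℓ true (f x) ∂(smote k (Z ω)) - ∫ x, ℓ true (f x) ∂P₁| ≤
                  2 * radComplexity ℓ F (numMin y) (withLabelOne P₁) + L * H +
                    2 * √(2 * Real.log (2 / δ)) * (b / √(numMin y : ℝ))}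
              ≤ ENNReal.ofReal δ * μ {ω | labels (Z ω) = y} ∧
            μ {ω | labels (Z ω) = y ∧
                ¬ radComplexity ℓ F J (withLabelOne (smote k (Z ω))) ≤
                  4 * (√((numMin y : ℝ) / J * Real.log (2 * numMin y)) +
                      (numMin y : ℝ) / J * Real.log (2 * numMin y)) *
                    radComplexity ℓ F (numMin y) (withLabelOne P₁) + L * H +
                    2 * √(2 * Real.log (1 / δ)) * (b / √(numMin y : ℝ))}
              ≤ ENNReal.ofReal δ * μ {ω | labels (Z ω) = y}) ∧
        -- the excess risk of the rebalanced empirical risk minimiser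
        (∀ (S : Ω → Fin J → Cov d), Measurable S → IsSmoteSample k μ Z S →
          ∀ (fhat : Ω → Cov d → ℝ), (∀ᵐ ω ∂μ, k < numMin (labels (Z ω)) →
              IsRebalancedERM ℓ F (Z ω) (S ω) (fhat ω)) →
          ∀ fstar ∈ F,
            μ {ω | k < numMin (labels (Z ω)) ∧
              ¬ (let n₁ : ℕ := numMin (labels (Z ω))
                 let n₀ : ℕ := numMaj (labels (Z ω))
                 let R : ℝ :=
                   L * D * (6 * ((k : ℝ) / n₁) ^ (1 / d : ℝ) +
                       √(Real.log (2 / δ)) * ((k * 5 ^ d + 1) / √(n₁ : ℝ))) +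
                     b * |(n : ℝ) * (1 - p₁) / (n + J) - 1 / 2| +
                     fluctuation b δ (n + J) + b * √(Real.log (1 / δ) / n₁)
                 excessRisk ℓ (balanced P₀ P₁) (fhat ω) fstar ≤
                     C * (radComplexity ℓ F (n + J) (balanced P₀ P₁) +
                       (1 + √((n₁ : ℝ) / J * Real.log (2 * n₁))) ^ 2 *
                         radComplexity ℓ F n₁ (withLabelOne P₁) + R) ∧
                   (n₁ < n₀ →
                     excessRisk ℓ (balanced P₀ P₁) (fhat ω) fstar ≤
                       C * ((1 + √((n₁ : ℝ) / ((n₀ : ℝ) - n₁) * Real.log (2 * n₁))) ^ 2 *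
                         radComplexity ℓ F (2 * n₁) (balanced P₀ P₁) + R)))}
              ≤ ENNReal.ofReal δ) := by
  refine ⟨1500, by norm_num, ?_⟩
  intro d n J k hd hJ hk p₁ hp0 hp1 P₀ P₁ _ _ ℓ F b L D δ hb hL hD hδ0 hδ1 hmeas hsep hbound hnorm
    hlip Ω _ μ _ Z hZ hlaw
  obtain ⟨F₀, hF₀, hcount, hdense⟩ := hsep
  have h : RegularClass ℓ F F₀ P₀ P₁ b L D :=
    RegularClass.mk' hcount ⟨hF₀, hdense⟩ hp0 hp1 hmeas hbound hnorm hlip hb hL hD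
  refine ⟨fun y hy H hH => ⟨h.measure_smote_deviation_le hd hk hp0 hp1 hδ0 hδ1 hZ hlaw hy hH,
    h.measure_smote_complexity_le hJ hd hk hp0 hp1 hδ0 hδ1 hZ hlaw hy hH⟩, ?_⟩
  intro S _ hS fhat hf fstar hstar
  exact h.measure_excessRisk_le hd hJ hk hp0 hp1 hδ0 hδ1 hZ hlaw hS hf hstar
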